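/- **Conventions.** A manifold is a smooth real manifold of some finite dimension (neither the Hausdorff property nor second countability is required), and vector bundles are smooth, real, and of finite (locally constant) rank. A *Lie algebroid* over a manifold $X$ is a vector bundle $A\to X$ with a morphism of vector bundles $a:A\to TX$ (the anchor) and a Lie bracket on its sheaf of smooth sections such that $a([\xi,\nu])=[a(\xi),a(\nu)]$ and $[\xi,f\nu]=a(\xi)(f)\,\nu+f[\xi,\nu]$ for all open $U\subset X$, $\xi,\nu\in\Gamma(U,A)$ and $f\in C^\infty(U)$. (If $X$ is Hausdorff, this is the same as such a bracket on the space $\Gamma(A)$ of global sections, because the Leibniz rule makes the latter local.) A *morphism* from a Lie algebroid $A$ over $X$ to a Lie algebroid $B$ over $Y$ is a smooth map $f:X\to Y$ with a morphism of vector bundles $\varphi:A\to B$ over $f$ such that $b\circ\varphi=f_*\circ a$ for the anchors $a$, $b$, and such that, whenever sections $\xi,\nu$ of $A$ satisfy $\varphi\circ\xi=\sum_i g_i\,(\xi'_i\circ f)$ and $\varphi\circ\nu=\sum_j h_j\,(\nu'_j\circ f)$ near a point, with smooth functions $g_i,h_j$ on $X$ and sections $\xi'_i,\nu'_j$ of $B$,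 then at this point $$\varphi\circ[\xi,\nu]=\sum_{i,j}g_ih_j\,([\xi'_i,\nu'_j]\circ f)+\sum_j a(\xi)(h_j)\,(\nu'_j\circ f)-\sum_i a(\nu)(g_i)\,(\xi'_i\circ f).$$ Over a fixed manifold ($f=\mathrm{id}$) these are the morphisms of vector bundles which commute with anchors and brackets. Let $\mathcal{LA}\to\mathbf{Man}$ be the category of Lie algebroids with its functor to manifolds and smooth maps, $\mathbf{Man}_{\mathrm{sub}}$ the category of manifolds and submersions, and, for a manifold $X$, $\mathrm{Open}_X$ the category of open subsets of $X$ and inclusions. Denote by $\mathcal{LA}$ over $\mathbf{Man}_{\mathrm{sub}}$, and by $\mathcal{LA}_{\mathrm{Open}_X}$ over $\mathrm{Open}_X$, the pullbacks of $\mathcal{LA}\to\mathbf{Man}$ along the functors from these categories to $\mathbf{Man}$; so the fibre over an object $U$ is the category $\mathcal{LA}_U$ of Lie algebroids over $U$. The covering families of the open cover topology are the jointly surjective families of open embeddings, and those of the étale topology on $\mathbf{Man}_{\mathrm{sub}}$ are the jointly surjective families of étale maps (local diffeomorphisms). A category over a site is a *stack* if it is a fibred category and, for every covering sieve $R$ of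 every object $U$, the functor from the fibre over $U$ to the category of descent data relative to $R$ is an equivalence: morphisms glue uniquely, and descent data of objects are effective. **Theorem.** For every manifold $X$, $\mathcal{LA}_{\mathrm{Open}_X}$ is a stack over $\mathrm{Open}_X$ with respect to the open cover topology. **Corollary.** $\mathcal{LA}$ is a stack over $\mathbf{Man}_{\mathrm{sub}}$ with respect to the open cover topology and with respect to the étale topology. -/

import Mathlib

open CategoryTheory
open scoped Manifold ContDiff Topology

universe u v₁ v₂ u₁ u₂

noncomputable section

namespace FibredStack

open CategoryTheory.Functor Opposite Bicategory

open Functor.Fiber (fiberInclusion)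

variable {𝒮 : Type u₁} {𝒳 : Type u₂} [Category.{v₁} 𝒮] [Category.{v₂} 𝒳] (p : 𝒳 ⥤ 𝒮)

/-- A morphism of the total category over an identity, as a morphism of the fibre. -/
def fiberHom {S : 𝒮} {a b : Fiber p S} (φ : fiberInclusion.obj a ⟶ fiberInclusion.obj b)
    [h : p.IsHomLift (𝟙 S) φ] : a ⟶ b := ⟨φ, h⟩

theorem map_fiberHom {S : 𝒮} {a b : Fiber p S} (φ : fiberInclusion.obj a ⟶ fiberInclusion.obj b)
    [h : p.IsHomLift (𝟙 S) φ] : fiberInclusion.map (fiberHom p φ) = φ := rfl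

/-- The comparison isomorphism, in the fibre over `S`, between the domains of two cartesian
morphisms over the same morphism with the same codomain. -/
def fiberIso {S T : 𝒮} (f : S ⟶ T) {a b : Fiber p S} {c : 𝒳} (φ : fiberInclusion.obj a ⟶ c)
    (ψ : fiberInclusion.obj b ⟶ c) [p.IsCartesian f φ] [p.IsCartesian f ψ] : a ≅ b where
  hom := fiberHom p (IsCartesian.map p f ψ φ)
  inv := fiberHom p (IsCartesian.map p f φ ψ)
  hom_inv_id := Subtype.ext (IsCartesian.domainUniqueUpToIso p f ψ φ).hom_inv_id
  inv_hom_id := Subtype.ext (IsCartesian.domainUniqueUpToIso p f ψ φ).inv_hom_id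

theorem fiberIso_hom_fac {S T : 𝒮} (f : S ⟶ T) {a b : Fiber p S} {c : 𝒳}
    (φ : fiberInclusion.obj a ⟶ c) (ψ : fiberInclusion.obj b ⟶ c)
    [p.IsCartesian f φ] [p.IsCartesian f ψ] :
    fiberInclusion.map (fiberIso p f φ ψ).hom ≫ ψ = φ := IsCartesian.fac p f ψ φ

theorem fiberIso_inv_fac {S T : 𝒮} (f : S ⟶ T) {a b : Fiber p S} {c : 𝒳}
    (φ : fiberInclusion.obj a ⟶ c) (ψ : fiberInclusion.obj b ⟶ c)
    [p.IsCartesian f φ] [p.IsCartesian f ψ] :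
    fiberInclusion.map (fiberIso p f φ ψ).inv ≫ φ = ψ := IsCartesian.fac p f φ ψ

theorem fiber_hom_ext {S T : 𝒮} (f : S ⟶ T) {a b : Fiber p S} {c : 𝒳}
    (ψ : fiberInclusion.obj b ⟶ c) [p.IsCartesian f ψ] {α β : a ⟶ b}
    (h : fiberInclusion.map α ≫ ψ = fiberInclusion.map β ≫ ψ) : α = β :=
  Functor.Fiber.hom_ext (IsCartesian.ext p f ψ _ _ h)

instance isCartesian_id {S : 𝒮} (a : Fiber p S) : p.IsCartesian (𝟙 S) (𝟙 (fiberInclusion.obj a)) :=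
  haveI : p.IsHomLift (𝟙 S) (Iso.refl (fiberInclusion.obj a)).hom := IsHomLift.id a.2
  (inferInstance : p.IsCartesian (𝟙 S) (Iso.refl (fiberInclusion.obj a)).hom)

variable [p.IsFibered]

/-- The chosen pullback of an object of the fibre over `T` along `f : S ⟶ T`. -/
def pull {S T : 𝒮} (f : S ⟶ T) (a : Fiber p T) : Fiber p S :=
  ⟨IsPreFibered.pullbackObj a.2 f, IsPreFibered.pullbackObj_proj a.2 f⟩

/-- The cartesian morphism from the chosen pullback. -/
def pullMap {S T : 𝒮} (f : S ⟶ T) (a : Fiber p T) :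
    fiberInclusion.obj (pull p f a) ⟶ fiberInclusion.obj a :=
  IsPreFibered.pullbackMap a.2 f

instance isCartesian_pullMap {S T : 𝒮} (f : S ⟶ T) (a : Fiber p T) :
    p.IsCartesian f (pullMap p f a) :=
  IsPreFibered.pullbackMap.IsCartesian a.2 f

theorem pull_hom_ext {S T : 𝒮} (f : S ⟶ T) (a : Fiber p T) (b : Fiber p S)
    {α β : b ⟶ pull p f a}
    (h : fiberInclusion.map α ≫ pullMap p f a = fiberInclusion.map β ≫ pullMap p f a) : α = β :=
  fiber_hom_ext p f (pullMap p f a) h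

theorem isHomLift_pullMap_comp {S T : 𝒮} (f : S ⟶ T) {a b : Fiber p T} (φ : a ⟶ b) :
    p.IsHomLift f (pullMap p f a ≫ fiberInclusion.map φ) := by
  have h' : p.IsHomLift (f ≫ 𝟙 T) (pullMap p f a ≫ fiberInclusion.map φ) := inferInstance
  rwa [Category.comp_id] at h'

/-- The action on morphisms of the chosen pullback. -/
def pullHom {S T : 𝒮} (f : S ⟶ T) {a b : Fiber p T} (φ : a ⟶ b) : pull p f a ⟶ pull p f b :=
  haveI := isHomLift_pullMap_comp p f φ
  fiberHom p (IsCartesian.map p f (pullMap p f b) (pullMap p f a ≫ fiberInclusion.map φ))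

theorem pullHom_fac {S T : 𝒮} (f : S ⟶ T) {a b : Fiber p T} (φ : a ⟶ b) :
    fiberInclusion.map (pullHom p f φ) ≫ pullMap p f b =
      pullMap p f a ≫ fiberInclusion.map φ :=
  haveI := isHomLift_pullMap_comp p f φ
  IsCartesian.fac p f (pullMap p f b) (pullMap p f a ≫ fiberInclusion.map φ)

/-- The chosen pullback functor between fibres. -/
def pullFunctor {S T : 𝒮} (f : S ⟶ T) : Fiber p T ⥤ Fiber p S where
  obj a := pull p f a
  map φ := pullHom p f φ
  map_id a := fiber_hom_ext p f (pullMap p f a) (by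
    rw [pullHom_fac, CategoryTheory.Functor.map_id, CategoryTheory.Functor.map_id, Category.comp_id, Category.id_comp])
  map_comp {a b c} φ ψ := fiber_hom_ext p f (pullMap p f c) (by
    rw [pullHom_fac, Functor.map_comp, Functor.map_comp, Category.assoc, pullHom_fac,
      ← Category.assoc, ← Category.assoc, pullHom_fac])

/-- The chosen pullback along an identity is isomorphic to the identity. -/
def pullIdIso (S : 𝒮) (a : Fiber p S) : pull p (𝟙 S) a ≅ a :=
  fiberIso p (𝟙 S) (pullMap p (𝟙 S) a) (𝟙 (fiberInclusion.obj a))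

theorem map_pullIdIso_hom (S : 𝒮) (a : Fiber p S) :
    fiberInclusion.map (pullIdIso p S a).hom = pullMap p (𝟙 S) a := by
  have := fiberIso_hom_fac p (𝟙 S) (pullMap p (𝟙 S) a) (𝟙 (fiberInclusion.obj a))
  rwa [Category.comp_id] at this

/-- The chosen pullback along a composition is isomorphic to the iterated one. -/
def pullCompIso {R S T : 𝒮} (f : R ⟶ S) (g : S ⟶ T) (a : Fiber p T) :
    pull p (f ≫ g) a ≅ pull p f (pull p g a) :=
  fiberIso p (f ≫ g) (pullMap p (f ≫ g) a) (pullMap p f (pull p g a) ≫ pullMap p g a)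

theorem pullCompIso_hom_fac {R S T : 𝒮} (f : R ⟶ S) (g : S ⟶ T) (a : Fiber p T) :
    fiberInclusion.map (pullCompIso p f g a).hom ≫ pullMap p f (pull p g a) ≫ pullMap p g a =
      pullMap p (f ≫ g) a :=
  fiberIso_hom_fac p (f ≫ g) (pullMap p (f ≫ g) a) (pullMap p f (pull p g a) ≫ pullMap p g a)

theorem pullCompIso_inv_fac {R S T : 𝒮} (f : R ⟶ S) (g : S ⟶ T) (a : Fiber p T) :
    fiberInclusion.map (pullCompIso p f g a).inv ≫ pullMap p (f ≫ g) a =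
      pullMap p f (pull p g a) ≫ pullMap p g a :=
  fiberIso_inv_fac p (f ≫ g) (pullMap p (f ≫ g) a) (pullMap p f (pull p g a) ≫ pullMap p g a)

/-- The pullback functor along an identity is isomorphic to the identity. -/
def pullId (S : 𝒮) : pullFunctor p (𝟙 S) ≅ 𝟭 (Fiber p S) :=
  NatIso.ofComponents (fun a ↦ pullIdIso p S a) (fun {a b} φ ↦ Functor.Fiber.hom_ext (by
    change fiberInclusion.map (pullHom p (𝟙 S) φ ≫ (pullIdIso p S b).hom) =
      fiberInclusion.map ((pullIdIso p S a).hom ≫ φ)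
    rw [Functor.map_comp, Functor.map_comp, map_pullIdIso_hom, map_pullIdIso_hom, pullHom_fac]))

/-- The pullback functor along a composition is isomorphic to the composition of the pullback
functors. -/
def pullComp {R S T : 𝒮} (f : R ⟶ S) (g : S ⟶ T) :
    pullFunctor p (f ≫ g) ≅ pullFunctor p g ⋙ pullFunctor p f :=
  NatIso.ofComponents (fun a ↦ pullCompIso p f g a) (fun {a b} φ ↦
    fiber_hom_ext p (f ≫ g) (a := pull p (f ≫ g) a) (b := pull p f (pull p g b))
      (pullMap p f (pull p g b) ≫ pullMap p g b) (by
      change fiberInclusion.map (pullHom p (f ≫ g) φ ≫ (pullCompIso p f g b).hom) ≫ _ =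
        fiberInclusion.map ((pullCompIso p f g a).hom ≫ pullHom p f (pullHom p g φ)) ≫ _
      rw [Functor.map_comp, Functor.map_comp, Category.assoc, pullCompIso_hom_fac, pullHom_fac,
        Category.assoc, ← Category.assoc _ (pullMap p f _), pullHom_fac, Category.assoc,
        pullHom_fac, ← Category.assoc (pullMap p f _), ← Category.assoc, pullCompIso_hom_fac]))

theorem eqToHom_pull_fac {S T : 𝒮} {f g : S ⟶ T} (h : f = g) (a : Fiber p T)
    (h' : pull p f a = pull p g a) :
    fiberInclusion.map (eqToHom h') ≫ pullMap p g a = pullMap p f a := by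
  subst h
  simp

theorem eqToHom_toNatTrans_app {S T : 𝒮} {f g : S ⟶ T} (h : f = g)
    (h' : (pullFunctor p f).toCatHom = (pullFunctor p g).toCatHom) (a : Fiber p T)
    (k : fiberInclusion.obj (pull p g a) ⟶ fiberInclusion.obj a) (hk : k = pullMap p g a) :
    fiberInclusion.map ((eqToHom h').toNatTrans.app a) ≫ k = pullMap p f a := by
  subst h hk
  exact Category.id_comp _

theorem pull_assoc_coherence {R S T U : 𝒮} (f : R ⟶ S) (g : S ⟶ T) (h : T ⟶ U)
    (a : Fiber p U) :
    fiberInclusion.map ((pullCompIso p f (g ≫ h) a).hom ≫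
      pullHom p f (pullCompIso p g h a).hom ≫
      (pullCompIso p f g (pull p h a)).inv ≫ (pullCompIso p (f ≫ g) h a).inv) ≫
      pullMap p ((f ≫ g) ≫ h) a = pullMap p (f ≫ g ≫ h) a := by
  rw [Functor.map_comp, Functor.map_comp, Functor.map_comp, Category.assoc, Category.assoc,
    Category.assoc, pullCompIso_inv_fac,
    ← Category.assoc (fiberInclusion.map (pullCompIso p f g (pull p h a)).inv),
    pullCompIso_inv_fac, Category.assoc, ← Category.assoc (fiberInclusion.map (pullHom _ _ _)),
    pullHom_fac, Category.assoc, pullCompIso_hom_fac, pullCompIso_hom_fac]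

theorem pull_left_coherence {R S : 𝒮} (f : R ⟶ S) (a : Fiber p S) :
    fiberInclusion.map ((pullCompIso p f (𝟙 S) a).hom ≫ pullHom p f (pullIdIso p S a).hom) ≫
      pullMap p f a = pullMap p (f ≫ 𝟙 S) a := by
  rw [Functor.map_comp, Category.assoc, pullHom_fac, map_pullIdIso_hom, pullCompIso_hom_fac]

theorem pull_right_coherence {R S : 𝒮} (f : R ⟶ S) (a : Fiber p S) :
    fiberInclusion.map ((pullCompIso p (𝟙 R) f a).hom ≫ (pullIdIso p R (pull p f a)).hom) ≫
      pullMap p f a = pullMap p (𝟙 R ≫ f) a := by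
  rw [Functor.map_comp, Category.assoc, map_pullIdIso_hom, pullCompIso_hom_fac]

/-- The pseudofunctor of fibres of a fibred category, for the chosen pullbacks. -/
def fiberPseudofunctor : LocallyDiscrete 𝒮ᵒᵖ ⥤ᵖ Cat.{v₂, u₂} :=
  LocallyDiscrete.mkPseudofunctor
    (fun S ↦ Cat.of (Fiber p S.unop))
    (fun f ↦ (pullFunctor p f.unop).toCatHom)
    (fun S ↦ Cat.Hom.isoMk (pullId p S.unop))
    (fun f g ↦ Cat.Hom.isoMk (pullComp p g.unop f.unop))
    (fun {S₀ S₁ S₂ S₃} f g h ↦ by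
      ext1
      ext a
      refine pull_hom_ext p ((h.unop ≫ g.unop) ≫ f.unop) a (pull p (h.unop ≫ g.unop ≫ f.unop) a) ?_
      refine Eq.trans ?_ (eqToHom_toNatTrans_app p (Category.assoc _ _ _).symm _ a _ rfl).symm
      refine Eq.trans ?_ (pull_assoc_coherence p h.unop g.unop f.unop a)
      congr 2
      exact congrArg (fun t ↦ (pullCompIso p h.unop (g.unop ≫ f.unop) a).hom ≫
        pullHom p h.unop (pullCompIso p g.unop f.unop a).hom ≫ t)
        (Category.id_comp ((pullCompIso p h.unop g.unop (pull p f.unop a)).inv ≫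
          (pullCompIso p (h.unop ≫ g.unop) f.unop a).inv)))
    (fun f ↦ by
      ext1
      ext a
      refine pull_hom_ext p f.unop a (pull p (f.unop ≫ 𝟙 _) a) ?_
      refine Eq.trans ?_ (eqToHom_toNatTrans_app p (Category.comp_id _) _ a _ rfl).symm
      refine Eq.trans ?_ (pull_left_coherence p f.unop a)
      congr 2
      exact congrArg (fun t ↦ (pullCompIso p f.unop (𝟙 _) a).hom ≫ t)
        (Category.comp_id (pullHom p f.unop (pullIdIso p _ a).hom)))
    (fun f ↦ by
      ext1
      ext a
      refine pull_hom_ext p f.unop a (pull p (𝟙 _ ≫ f.unop) a) ?_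
      refine Eq.trans ?_ (eqToHom_toNatTrans_app p (Category.id_comp _) _ a _ rfl).symm
      refine Eq.trans ?_ (pull_right_coherence p f.unop a)
      congr 2
      exact congrArg (fun t ↦ (pullCompIso p (𝟙 _) f.unop a).hom ≫ t)
        (Category.comp_id (pullIdIso p _ (pull p f.unop a)).hom))

/-- A functor `p : 𝒳 ⥤ 𝒮` is a stack for `J` if it is a fibred category whose descent functors
for all covering sieves are equivalences. -/
def IsStackOver {𝒮 : Type u₁} {𝒳 : Type u₂} [Category.{v₁} 𝒮] [Category.{v₂} 𝒳] (p : 𝒳 ⥤ 𝒮)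
    (J : GrothendieckTopology 𝒮) : Prop :=
  ∃ _ : p.IsFibered, (fiberPseudofunctor p).IsStack J

end FibredStack

/-- A smooth manifold (without boundary, of some finite dimension). Neither the Hausdorff property nor
second countability is required. -/
structure Man : Type (u + 1) where
  carrier : Type u
  dim : ℕ
  [top : TopologicalSpace carrier]
  [charted : ChartedSpace (EuclideanSpace ℝ (Fin dim)) carrier]
  [smooth : IsManifold (𝓡 dim) ∞ carrier]

namespace Man

instance : CoeSort Man.{u} (Type u) := ⟨Man.carrier⟩

attribute [instance] top charted smooth

/-- Smooth maps. -/
@[ext]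
structure Hom (X Y : Man.{u}) : Type u where
  toFun : X → Y
  contMDiff : ContMDiff (𝓡 X.dim) (𝓡 Y.dim) ∞ toFun

instance category : Category.{u} Man.{u} where
  Hom X Y := Man.Hom X Y
  id X := ⟨fun x ↦ x, contMDiff_id⟩
  comp f g := ⟨fun x ↦ g.toFun (f.toFun x), g.contMDiff.comp f.contMDiff⟩

instance {X Y : Man.{u}} : CoeFun (X ⟶ Y) (fun _ ↦ X → Y) := ⟨Man.Hom.toFun⟩

theorem hom_ext {X Y : Man.{u}} {f g : X ⟶ Y} (h : ∀ x : X, f x = g x) : f = g :=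
  Man.Hom.ext (funext h)

theorem comp_apply {X Y Z : Man.{u}} (f : X ⟶ Y) (g : Y ⟶ Z) (x : X) : (f ≫ g) x = g (f x) :=
  rfl

theorem id_apply {X : Man.{u}} (x : X) : (𝟙 X : X ⟶ X) x = x := rfl

/-- The derivative `T_x X → T_{f x} Y` of a smooth map. -/
def dMap {X Y : Man.{u}} (f : X ⟶ Y) (x : X) :
    TangentSpace (𝓡 X.dim) x →L[ℝ] TangentSpace (𝓡 Y.dim) (f x) :=
  mfderiv (𝓡 X.dim) (𝓡 Y.dim) f x

theorem mdifferentiableAt {X Y : Man.{u}} (f : X ⟶ Y) (x : X) :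
    MDifferentiableAt (𝓡 X.dim) (𝓡 Y.dim) f x :=
  f.contMDiff.mdifferentiable (by simp) x

theorem dMap_id {X : Man.{u}} (x : X) (v : TangentSpace (𝓡 X.dim) x) :
    dMap (𝟙 X) x v = v := by
  have : dMap (𝟙 X) x = ContinuousLinearMap.id ℝ (TangentSpace (𝓡 X.dim) x) := mfderiv_id
  rw [this]; rfl

theorem dMap_comp {X Y Z : Man.{u}} (f : X ⟶ Y) (g : Y ⟶ Z) (x : X)
    (v : TangentSpace (𝓡 X.dim) x) :
    dMap (f ≫ g) x v = dMap g (f x) (dMap f x v) := by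
  have : dMap (f ≫ g) x = (dMap g (f x)).comp (dMap f x) :=
    mfderiv_comp x (mdifferentiableAt g (f x)) (mdifferentiableAt f x)
  rw [this]; rfl

/-- Submersions: smooth maps all of whose derivatives are surjective. -/
def submersion : MorphismProperty Man.{u} :=
  fun _ _ f ↦ ∀ x, Function.Surjective (dMap f x)

instance : submersion.{u}.IsMultiplicative where
  id_mem _ _ v := ⟨v, dMap_id _ v⟩
  comp_mem f g hf hg x v := by
    obtain ⟨w, rfl⟩ := hg (f x) v
    obtain ⟨w, rfl⟩ := hf x w
    exact ⟨w, dMap_comp f g x w⟩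

/-- Étale maps: local diffeomorphisms. -/
def IsEtale {X Y : Man.{u}} (f : X ⟶ Y) : Prop :=
  IsLocalDiffeomorph (𝓡 X.dim) (𝓡 Y.dim) ∞ f

/-- Open embeddings of manifolds: local diffeomorphisms which are homeomorphisms onto an open
subset. -/
def IsOpenEmb {X Y : Man.{u}} (f : X ⟶ Y) : Prop :=
  IsEtale f ∧ Topology.IsOpenEmbedding f

/-- The open submanifold of `X` defined by an open subset. -/
def ofOpens (X : Man.{u}) (U : TopologicalSpace.Opens X) : Man.{u} where
  carrier := U
  dim := X.dim

/-- The functor sending an open subset of `X` to the open submanifold which it defines, and an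
inclusion of open subsets to the corresponding smooth map. -/
def opensToMan (X : Man.{u}) : TopologicalSpace.Opens X ⥤ Man.{u} where
  obj U := X.ofOpens U
  map {U V} i := ⟨TopologicalSpace.Opens.inclusion (leOfHom i), 
    (contMDiff_inclusion (leOfHom i) :
      ContMDiff (𝓡 X.dim) (𝓡 X.dim) ∞ (TopologicalSpace.Opens.inclusion (leOfHom i)))⟩

end Man

/-- The category of manifolds and submersions. -/
abbrev ManSub : Type (u + 1) := WideSubcategory Man.submersion.{u}

namespace ManSub

/-- The inclusion of the category of manifolds and submersions into that of manifolds. -/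
abbrev toMan : ManSub.{u} ⥤ Man.{u} := wideSubcategoryInclusion Man.submersion

/-- The covering families of the open cover topology: jointly surjective families of open
embeddings. -/
def openCovers : Precoverage ManSub.{u} where
  coverings X := { R | (∀ ⦃U : ManSub.{u}⦄ (f : U ⟶ X), R f → Man.IsOpenEmb f.hom) ∧
    ∀ x : X.obj, ∃ (U : ManSub.{u}) (f : U ⟶ X) (y : U.obj), R f ∧ f.hom y = x }

/-- The covering families of the étale topology: jointly surjective families of étale maps. -/
def etaleCovers : Precoverage ManSub.{u} where
  coverings X := { R | (∀ ⦃U : ManSub.{u}⦄ (f : U ⟶ X), R f → Man.IsEtale f.hom) ∧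
    ∀ x : X.obj, ∃ (U : ManSub.{u}) (f : U ⟶ X) (y : U.obj), R f ∧ f.hom y = x }

/-- The open cover topology on the category of manifolds and submersions. -/
def openCoverTopology : GrothendieckTopology ManSub.{u} := openCovers.toGrothendieck

/-- The étale topology on the category of manifolds and submersions. -/
def etaleTopology : GrothendieckTopology ManSub.{u} := etaleCovers.toGrothendieck

end ManSub

namespace Man

variable {X : Man.{u}}

/-- The derivative `v(f)` of a function `f` in the direction of a tangent vector `v` at `x`. -/
def dirDeriv (f : X → ℝ) (x : X) : TangentSpace (𝓡 X.dim) x →L[ℝ] ℝ :=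
  mfderiv (𝓡 X.dim) 𝓘(ℝ, ℝ) f x

/-- Smoothness near a point `x` of a function with values in a finite-dimensional space. -/
abbrev SmoothAt {V : Type*} [NormedAddCommGroup V] [NormedSpace ℝ V] (f : X → V) (x : X) : Prop :=
  ContMDiffAt (𝓡 X.dim) 𝓘(ℝ, V) ∞ f x

end Man

/-- A local trivialisation of a family `E` of vector spaces on `X`, as a vector bundle of constant
rank on an open subset `baseSet`. The values of `coord` and `symm` outside of `baseSet` are
irrelevant. -/
structure LocalTriv (X : Man.{u}) (E : X → Type u) [∀ x, AddCommGroup (E x)]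
    [∀ x, Module ℝ (E x)] : Type u where
  baseSet : Set X
  isOpen_baseSet : IsOpen baseSet
  rank : ℕ
  coord : ∀ x, E x →ₗ[ℝ] (Fin rank → ℝ)
  symm : ∀ x, (Fin rank → ℝ) →ₗ[ℝ] E x
  symm_coord : ∀ x ∈ baseSet, ∀ v : E x, symm x (coord x v) = v
  coord_symm : ∀ x ∈ baseSet, ∀ v : Fin rank → ℝ, coord x (symm x v) = v

/-- A smooth real vector bundle of finite (locally constant) rank, given by a smooth atlas of local
trivialisations. -/
structure VBundle (X : Man.{u}) : Type (u + 1) where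
  Fiber : X → Type u
  [addCommGroup : ∀ x, AddCommGroup (Fiber x)]
  [module : ∀ x, Module ℝ (Fiber x)]
  atlas : Set (LocalTriv X Fiber)
  exists_mem_baseSet : ∀ x, ∃ e ∈ atlas, x ∈ e.baseSet
  smooth_transition : ∀ e ∈ atlas, ∀ e' ∈ atlas, ∀ v : Fin e.rank → ℝ,
    ContMDiffOn (𝓡 X.dim) 𝓘(ℝ, Fin e'.rank → ℝ) ∞ (fun x ↦ e'.coord x (e.symm x v))
      (e.baseSet ∩ e'.baseSet)

namespace VBundle

attribute [instance] addCommGroup module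

variable {X : Man.{u}} (E : VBundle X)

/-- The space of smooth sections over an open subset `U`, where a section over `U` is encoded by its
extension by zero outside of `U`. -/
def Γ (U : TopologicalSpace.Opens X) : Submodule ℝ (∀ x, E.Fiber x) where
  carrier := { σ | (∀ e ∈ E.atlas, ∀ x ∈ U, x ∈ e.baseSet → Man.SmoothAt (fun y ↦ e.coord y (σ y)) x) ∧
    ∀ x ∉ U, σ x = 0 }
  add_mem' {σ τ} hσ hτ := by
    refine ⟨fun e he x hU hx ↦ ?_, fun x hx ↦ ?_⟩
    · refine ((hσ.1 e he x hU hx).add (hτ.1 e he x hU hx)).congr_of_eventuallyEq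
        (.of_forall fun y ↦ ?_)
      exact map_add (e.coord y) _ _
    · rw [Pi.add_apply, hσ.2 x hx, hτ.2 x hx, add_zero]
  zero_mem' := by
    refine ⟨fun e he x hU hx ↦ ?_, fun x hx ↦ rfl⟩
    simpa using (contMDiffAt_const : Man.SmoothAt (fun _ : X ↦ (0 : Fin e.rank → ℝ)) x)
  smul_mem' c σ hσ := by
    refine ⟨fun e he x hU hx ↦ ?_, fun x hx ↦ ?_⟩
    · refine ((contMDiffAt_const (c := c) : Man.SmoothAt (fun _ : X ↦ c) x).smul
        (hσ.1 e he x hU hx)).congr_of_eventuallyEq (.of_forall fun y ↦ ?_)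
      exact map_smul (e.coord y) _ _
    · rw [Pi.smul_apply, hσ.2 x hx, smul_zero]

instance (U : TopologicalSpace.Opens X) : CoeFun (E.Γ U) (fun _ ↦ ∀ x, E.Fiber x) :=
  ⟨Subtype.val⟩

variable {E} {U V : TopologicalSpace.Opens X}

open Classical in
/-- The section over `U` defined by a family `σ` of vectors which is smooth at the points of `U`. -/
def sectionOn (U : TopologicalSpace.Opens X) (σ : ∀ x, E.Fiber x)
    (hσ : ∀ e ∈ E.atlas, ∀ x ∈ U, x ∈ e.baseSet → Man.SmoothAt (fun y ↦ e.coord y (σ y)) x) :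
    E.Γ U :=
  ⟨fun x ↦ if x ∈ U then σ x else 0, fun e he x hU hx ↦ by
    refine (hσ e he x hU hx).congr_of_eventuallyEq ?_
    filter_upwards [U.isOpen.mem_nhds hU] with y hy
    exact congrArg (e.coord y) (if_pos hy), fun x hx ↦ if_neg hx⟩

theorem sectionOn_apply {σ : ∀ x, E.Fiber x}
    {hσ : ∀ e ∈ E.atlas, ∀ x ∈ U, x ∈ e.baseSet → Man.SmoothAt (fun y ↦ e.coord y (σ y)) x}
    {x : X} (hx : x ∈ U) : sectionOn U σ hσ x = σ x := if_pos hx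

/-- The restriction of a section over `U` to an open subset `V`. -/
def res (h : V ≤ U) (σ : E.Γ U) : E.Γ V :=
  sectionOn V σ fun e he x hx hx' ↦ σ.2.1 e he x (h hx) hx'

theorem res_apply {h : V ≤ U} {σ : E.Γ U} {x : X} (hx : x ∈ V) : res h σ x = σ x :=
  sectionOn_apply hx

/-- The product of a section over `U` with a function which is smooth at the points of `U`. -/
def smul (f : X → ℝ) (hf : ∀ x ∈ U, X.SmoothAt f x) (σ : E.Γ U) : E.Γ U :=
  ⟨fun x ↦ f x • σ x, fun e he x hU hx ↦ by
    refine ((hf x hU).smul (σ.2.1 e he x hU hx)).congr_of_eventuallyEq (.of_forall fun y ↦ ?_)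
    exact map_smul (e.coord y) _ _, fun x hx ↦ (congrArg (f x • ·) (σ.2.2 x hx)).trans (smul_zero _)⟩

theorem smul_apply (f : X → ℝ) (hf : ∀ x ∈ U, X.SmoothAt f x) (σ : E.Γ U) (x : X) :
    smul f hf σ x = f x • σ x := rfl

theorem sum_apply {ι : Type*} (s : Finset ι) (σ : ι → E.Γ U) (x : X) :
    (∑ i ∈ s, σ i : E.Γ U) x = ∑ i ∈ s, σ i x := by
  rw [← Finset.sum_apply]
  exact congrFun (AddSubmonoidClass.coe_finsetSum σ s) x

theorem section_ext {σ τ : E.Γ U} (h : ∀ x ∈ U, σ x = τ x) : σ = τ := by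
  refine Subtype.ext (funext fun x ↦ ?_)
  by_cases hx : x ∈ U
  · exact h x hx
  · exact (σ.2.2 x hx).trans (τ.2.2 x hx).symm

end VBundle

/-- A Lie algebroid over `X`: a vector bundle with a bundle morphism to the tangent bundle (the
anchor) and a Lie bracket on smooth sections, such that the anchor induces a morphism of Lie algebras
to the vector fields and the Leibniz rule holds.

The bracket is given on the sections over all open subsets, compatibly with restrictions. By the
Leibniz rule, a bracket on global sections over a Hausdorff manifold extends uniquely to such a
bracket (`GlobalBracket.toLieAlgebroid` and `VBundle.bracket_unique` below); on other manifolds, where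
global sections can be scarce, the bracket of sections over open subsets is what the restriction to
open subsets requires. -/
structure LieAlgebroid (X : Man.{u}) : Type (u + 1) extends VBundle X where
  anchor : ∀ x, Fiber x →ₗ[ℝ] TangentSpace (𝓡 X.dim) x
  smooth_anchor : ∀ e ∈ atlas, ∀ v : Fin e.rank → ℝ,
    ContMDiffOn (𝓡 X.dim) (𝓡 X.dim).tangent ∞
      (fun x ↦ (⟨x, anchor x (e.symm x v)⟩ : TangentBundle (𝓡 X.dim) X)) e.baseSet
  bracket : ∀ U, toVBundle.Γ U →ₗ[ℝ] toVBundle.Γ U →ₗ[ℝ] toVBundle.Γ U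
  bracket_res : ∀ {U V} (h : V ≤ U) (ξ ν : toVBundle.Γ U),
    bracket V (VBundle.res h ξ) (VBundle.res h ν) = VBundle.res h (bracket U ξ ν)
  bracket_self : ∀ U ξ, bracket U ξ ξ = 0
  jacobi : ∀ U ξ ν ζ, bracket U ξ (bracket U ν ζ) =
    bracket U (bracket U ξ ν) ζ + bracket U ν (bracket U ξ ζ)
  anchor_bracket : ∀ U (ξ ν : toVBundle.Γ U), ∀ x ∈ U, anchor x (bracket U ξ ν x) =
    VectorField.mlieBracket (𝓡 X.dim) (fun y ↦ anchor y (ξ y)) (fun y ↦ anchor y (ν y)) x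
  leibniz : ∀ U (ξ ν : toVBundle.Γ U) (f : X → ℝ) (hf : ∀ x ∈ U, X.SmoothAt f x), ∀ x ∈ U,
    bracket U ξ (VBundle.smul f hf ν) x =
      X.dirDeriv f x (anchor x (ξ x)) • ν x + f x • bracket U ξ ν x

namespace LieAlgebroid

/-- The right-hand side of the bracket formula for morphisms of Lie algebroids. If
the images of two sections `ξ` and `ν` decompose as `∑ i, g i • ξ' i ∘ f` and `∑ j, h j • ν' j ∘ f`,
and `u` and `w` are the tangent vectors at `x` defined by `ξ` and `ν`, the formula is
`∑ i j, g i * h j • [ξ' i, ν' j] + ∑ j, ξ (h j) • ν' j - ∑ i, ν (g i) • ξ' i`. -/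
def bracketFormula {X Y : Man.{u}} (B : LieAlgebroid Y) (f : X ⟶ Y) (x : X)
    (u w : TangentSpace (𝓡 X.dim) x) {V : TopologicalSpace.Opens Y} {m n : ℕ} (g : Fin m → X → ℝ)
    (ξ' : Fin m → B.Γ V) (h : Fin n → X → ℝ) (ν' : Fin n → B.Γ V) : B.Fiber (f x) :=
  ∑ i, ∑ j, (g i x * h j x) • B.bracket V (ξ' i) (ν' j) (f x) +
    ∑ j, X.dirDeriv (h j) x u • ν' j (f x) - ∑ i, X.dirDeriv (g i) x w • ξ' i (f x)

/-- A (base-changing) morphism of Lie algebroids over `f : X ⟶ Y`: a morphism of vector bundles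
over `f` which is compatible with the anchors and with the brackets. The latter means that, whenever
the images of two sections `ξ` and `ν` of `A` decompose near a point as
`∑ i, g i • ξ' i ∘ f` and `∑ j, h j • ν' j ∘ f`, for smooth functions `g i`, `h j` on `X` and
sections `ξ' i`, `ν' j` of `B`, the image of the bracket of `ξ` and `ν` is given at this point by
`bracketFormula`. -/
@[ext]
structure Hom {X Y : Man.{u}} (A : LieAlgebroid X) (B : LieAlgebroid Y) (f : X ⟶ Y) : Type u where
  toFun : ∀ x, A.Fiber x →ₗ[ℝ] B.Fiber (f x)
  smooth : ∀ e ∈ A.atlas, ∀ e' ∈ B.atlas, ∀ v : Fin e.rank → ℝ,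
    ContMDiffOn (𝓡 X.dim) 𝓘(ℝ, Fin e'.rank → ℝ) ∞
      (fun x ↦ e'.coord (f x) (toFun x (e.symm x v))) (e.baseSet ∩ f ⁻¹' e'.baseSet)
  anchor_comm : ∀ x v, B.anchor (f x) (toFun x v) = Man.dMap f x (A.anchor x v)
  map_bracket : ∀ U (ξ ν : A.Γ U), ∀ x ∈ U, ∀ V, f x ∈ V → ∀ (m n : ℕ) (g : Fin m → X → ℝ)
    (ξ' : Fin m → B.Γ V) (h : Fin n → X → ℝ) (ν' : Fin n → B.Γ V),
    (∀ i, X.SmoothAt (g i) x) → (∀ j, X.SmoothAt (h j) x) →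
    (∀ᶠ y in 𝓝 x, toFun y (ξ y) = ∑ i, g i y • ξ' i (f y)) →
    (∀ᶠ y in 𝓝 x, toFun y (ν y) = ∑ j, h j y • ν' j (f y)) →
    toFun x (A.bracket U ξ ν x) =
      B.bracketFormula f x (A.anchor x (ξ x)) (A.anchor x (ν x)) g ξ' h ν'

end LieAlgebroid

namespace Man

variable {X : Man.{u}}

theorem SmoothAt.mdiff {V : Type*} [NormedAddCommGroup V] [NormedSpace ℝ V] {f : X → V} {x : X}
    (h : SmoothAt f x) : MDifferentiableAt (𝓡 X.dim) 𝓘(ℝ, V) f x :=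
  h.mdifferentiableAt (by simp)

theorem dirDeriv_congr {f g : X → ℝ} {x : X} (h : f =ᶠ[𝓝 x] g)
    (v : TangentSpace (𝓡 X.dim) x) : X.dirDeriv f x v = X.dirDeriv g x v := by
  have : (mfderiv (𝓡 X.dim) 𝓘(ℝ, ℝ) f x : TangentSpace (𝓡 X.dim) x →L[ℝ] ℝ) =
    mfderiv (𝓡 X.dim) 𝓘(ℝ, ℝ) g x := h.mfderiv_eq
  exact congrArg (fun L : TangentSpace (𝓡 X.dim) x →L[ℝ] ℝ ↦ L v) this

theorem dirDeriv_mul {f g : X → ℝ} {x : X} (hf : SmoothAt f x) (hg : SmoothAt g x)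
    (v : TangentSpace (𝓡 X.dim) x) : X.dirDeriv (fun y ↦ f y * g y) x v =
      f x * X.dirDeriv g x v + g x * X.dirDeriv f x v := by
  have := (hf.mdiff.hasMFDerivAt.mul hg.mdiff.hasMFDerivAt).mfderiv
  exact congrArg (fun L : TangentSpace (𝓡 X.dim) x →L[ℝ] ℝ ↦ L v) this

theorem smoothAt_mul {f g : X → ℝ} {x : X} (hf : SmoothAt f x) (hg : SmoothAt g x) :
    SmoothAt (fun y ↦ f y * g y) x := hf.mul hg

theorem smoothAt_sum {ι : Type*} (s : Finset ι) {f : ι → X → ℝ} {x : X}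
    (hf : ∀ i ∈ s, SmoothAt (f i) x) : SmoothAt (fun y ↦ ∑ i ∈ s, f i y) x := by
  classical
  induction s using Finset.induction_on with
  | empty => simpa using (contMDiffAt_const : SmoothAt (fun _ : X ↦ (0 : ℝ)) x)
  | insert i s hi ih =>
    simp only [Finset.sum_insert hi]
    exact (hf i (Finset.mem_insert_self i s)).add
      (ih fun j hj ↦ hf j (Finset.mem_insert_of_mem hj))

theorem dirDeriv_sum {ι : Type*} (s : Finset ι) {f : ι → X → ℝ} {x : X}
    (hf : ∀ i ∈ s, SmoothAt (f i) x) (v : TangentSpace (𝓡 X.dim) x) :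
    X.dirDeriv (fun y ↦ ∑ i ∈ s, f i y) x v = ∑ i ∈ s, X.dirDeriv (f i) x v := by
  classical
  induction s using Finset.induction_on with
  | empty =>
    have : mfderiv (𝓡 X.dim) 𝓘(ℝ, ℝ) (fun _ : X ↦ (0 : ℝ)) x = 0 := mfderiv_const
    simp only [Finset.sum_empty]
    exact congrArg (fun L : TangentSpace (𝓡 X.dim) x →L[ℝ] ℝ ↦ L v) this
  | insert i s hi ih =>
    have hi' := hf i (Finset.mem_insert_self i s)
    have hs : ∀ j ∈ s, SmoothAt (f j) x := fun j hj ↦ hf j (Finset.mem_insert_of_mem hj)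
    rw [Finset.sum_insert hi, ← ih hs]
    simp only [Finset.sum_insert hi]
    have := (hi'.mdiff.hasMFDerivAt.add (smoothAt_sum s hs).mdiff.hasMFDerivAt).mfderiv
    exact congrArg (fun L : TangentSpace (𝓡 X.dim) x →L[ℝ] ℝ ↦ L v) this

theorem dirDeriv_comp {Y : Man.{u}} (f : X ⟶ Y) {h : Y → ℝ} {x : X} (hh : SmoothAt h (f x))
    (v : TangentSpace (𝓡 X.dim) x) :
    X.dirDeriv (fun y ↦ h (f y)) x v = Y.dirDeriv h (f x) (dMap f x v) := by
  have := mfderiv_comp x hh.mdiff (mdifferentiableAt f x)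
  exact congrArg (fun L : TangentSpace (𝓡 X.dim) x →L[ℝ] ℝ ↦ L v) this

theorem SmoothAt.comp_hom {V : Type*} [NormedAddCommGroup V] [NormedSpace ℝ V]
    {Y : Man.{u}} (f : X ⟶ Y) {h : Y → V} {x : X} (hh : SmoothAt h (f x)) :
    SmoothAt (fun y ↦ h (f y)) x :=
  hh.comp x (f.contMDiff x)

end Man

namespace VBundle

variable {X : Man.{u}} {E : VBundle X} {U : TopologicalSpace.Opens X}

/-- The frame defined by a local trivialisation. -/
def frame {e : LocalTriv X E.Fiber} (he : e ∈ E.atlas) (k : Fin e.rank) :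
    E.Γ ⟨e.baseSet, e.isOpen_baseSet⟩ :=
  sectionOn _ (fun y ↦ e.symm y (Pi.single k 1)) fun e' he' _ hx hx' ↦
    (E.smooth_transition e he e' he' _).contMDiffAt
      ((e.isOpen_baseSet.inter e'.isOpen_baseSet).mem_nhds ⟨hx, hx'⟩)

theorem frame_apply {e : LocalTriv X E.Fiber} (he : e ∈ E.atlas) (k : Fin e.rank) {y : X}
    (hy : y ∈ e.baseSet) : frame he k y = e.symm y (Pi.single k 1) :=
  sectionOn_apply (U := ⟨e.baseSet, e.isOpen_baseSet⟩) hy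

theorem symm_eq_sum (e : LocalTriv X E.Fiber) (y : X) (v : Fin e.rank → ℝ) :
    e.symm y v = ∑ k, v k • e.symm y (Pi.single k 1) := by
  conv_lhs => rw [pi_eq_sum_univ' v]
  rw [map_sum]
  refine Finset.sum_congr rfl fun k _ ↦ ?_
  rw [map_smul]

theorem eq_sum_frame {e : LocalTriv X E.Fiber} (he : e ∈ E.atlas) {y : X} (hy : y ∈ e.baseSet)
    (v : E.Fiber y) : v = ∑ k, e.coord y v k • frame he k y := by
  conv_lhs => rw [← e.symm_coord y hy v, symm_eq_sum]
  simp only [frame_apply he _ hy]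

theorem coord_smoothAt {e : LocalTriv X E.Fiber} (he : e ∈ E.atlas) {z : X} (hz : z ∈ e.baseSet)
    (hU : z ∈ U) (σ : E.Γ U) (k : Fin e.rank) : X.SmoothAt (fun y ↦ e.coord y (σ y) k) z :=
  contMDiffAt_pi_space.1 (σ.2.1 e he z hU hz) k

theorem bracket_congr_of_res (br : ∀ U, E.Γ U →ₗ[ℝ] E.Γ U →ₗ[ℝ] E.Γ U)
    (br_res : ∀ {U V} (h : V ≤ U) (ξ ν : E.Γ U), br V (res h ξ) (res h ν) = res h (br U ξ ν))
    {U V : TopologicalSpace.Opens X} {ξ ν : E.Γ U} {ξ' ν' : E.Γ V} {z : X} (hU : z ∈ U) (hV : z ∈ V)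
    (h : ∀ᶠ y in 𝓝 z, ξ y = ξ' y) (h' : ∀ᶠ y in 𝓝 z, ν y = ν' y) :
    br U ξ ν z = br V ξ' ν' z := by
  obtain ⟨W, hW, hWo, hz⟩ := eventually_nhds_iff.1 (h.and h')
  let W' : TopologicalSpace.Opens X := ⟨W, hWo⟩ ⊓ (U ⊓ V)
  have hz' : z ∈ W' := ⟨hz, hU, hV⟩
  have hWU : W' ≤ U := inf_le_right.trans inf_le_left
  have hWV : W' ≤ V := inf_le_right.trans inf_le_right
  have e1 : res hWU ξ = res hWV ξ' := section_ext fun x hx ↦ by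
    rw [res_apply hx, res_apply hx, (hW x hx.1).1]
  have e2 : res hWU ν = res hWV ν' := section_ext fun x hx ↦ by
    rw [res_apply hx, res_apply hx, (hW x hx.1).2]
  rw [← res_apply (h := hWU) hz', ← res_apply (h := hWV) hz', ← br_res,
    ← br_res, e1, e2]

end VBundle

namespace LieAlgebroid

variable {X : Man.{u}} (A : LieAlgebroid X) {U V : TopologicalSpace.Opens X}

theorem bracket_skew (ξ ν : A.Γ U) : A.bracket U ξ ν = -A.bracket U ν ξ := by
  have h := A.bracket_self U (ξ + ν)
  simp only [map_add, LinearMap.add_apply, A.bracket_self, zero_add, add_zero] at h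
  exact eq_neg_of_add_eq_zero_right h

theorem bracket_congr {ξ ν : A.Γ U} {ξ' ν' : A.Γ V} {z : X} (hU : z ∈ U) (hV : z ∈ V)
    (h : ∀ᶠ y in 𝓝 z, ξ y = ξ' y) (h' : ∀ᶠ y in 𝓝 z, ν y = ν' y) :
    A.bracket U ξ ν z = A.bracket V ξ' ν' z :=
  VBundle.bracket_congr_of_res A.bracket A.bracket_res hU hV h h'

end LieAlgebroid

theorem bracketFormula_algebra {M ι κ α β : Type*} [AddCommGroup M] [Module ℝ M] [Fintype ι]
    [Fintype κ] [Fintype α] [Fintype β] (g dg : ι → ℝ) (h dh : κ → ℝ) (p : ι → α → ℝ)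
    (q : κ → β → ℝ) (dp : κ → ι → α → ℝ) (dq : ι → κ → β → ℝ) (V : α → β → M) (c : α → M)
    (c' : β → M) :
    ∑ i, ∑ j, (g i * h j) • (∑ k, ∑ l, (p i k * q j l) • V k l + ∑ l, dq i j l • c' l -
      ∑ k, dp j i k • c k) + ∑ j, dh j • ∑ l, q j l • c' l - ∑ i, dg i • ∑ k, p i k • c k =
    ∑ k, ∑ l, ((∑ i, g i * p i k) * ∑ j, h j * q j l) • V k l +
      ∑ l, (∑ j, (h j * (∑ i, g i * dq i j l) + q j l * dh j)) • c' l -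
      ∑ k, (∑ i, (g i * (∑ j, h j * dp j i k) + p i k * dg i)) • c k := by
  have e1 : ∑ k, ∑ l, ((∑ i, g i * p i k) * ∑ j, h j * q j l) • V k l =
      ∑ i, ∑ j, ∑ k, ∑ l, ((g i * h j) * (p i k * q j l)) • V k l := by
    calc _ = ∑ k, ∑ l, ∑ i, ∑ j, ((g i * h j) * (p i k * q j l)) • V k l := by
          refine Finset.sum_congr rfl fun k _ ↦ Finset.sum_congr rfl fun l _ ↦ ?_
          rw [Finset.sum_mul_sum, Finset.sum_smul]
          refine Finset.sum_congr rfl fun i _ ↦ ?_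
          rw [Finset.sum_smul]
          exact Finset.sum_congr rfl fun j _ ↦ by congr 1; ring
      _ = ∑ k, ∑ i, ∑ l, ∑ j, ((g i * h j) * (p i k * q j l)) • V k l :=
          Finset.sum_congr rfl fun k _ ↦ Finset.sum_comm
      _ = ∑ i, ∑ k, ∑ l, ∑ j, ((g i * h j) * (p i k * q j l)) • V k l := Finset.sum_comm
      _ = ∑ i, ∑ k, ∑ j, ∑ l, ((g i * h j) * (p i k * q j l)) • V k l :=
          Finset.sum_congr rfl fun i _ ↦ Finset.sum_congr rfl fun k _ ↦ Finset.sum_comm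
      _ = _ := Finset.sum_congr rfl fun i _ ↦ Finset.sum_comm
  have e2 : ∑ l, (∑ j, (h j * (∑ i, g i * dq i j l) + q j l * dh j)) • c' l =
      ∑ i, ∑ j, ∑ l, ((g i * h j) * dq i j l) • c' l + ∑ j, ∑ l, (dh j * q j l) • c' l := by
    calc _ = ∑ l, ∑ j, (∑ i, ((g i * h j) * dq i j l) • c' l + (dh j * q j l) • c' l) := by
          refine Finset.sum_congr rfl fun l _ ↦ ?_
          rw [Finset.sum_smul]
          refine Finset.sum_congr rfl fun j _ ↦ ?_
          rw [add_smul, Finset.mul_sum, Finset.sum_smul, mul_comm (q j l)]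
          congr 1
          exact Finset.sum_congr rfl fun i _ ↦ by congr 1; ring
      _ = ∑ l, ∑ j, ∑ i, ((g i * h j) * dq i j l) • c' l + ∑ l, ∑ j, (dh j * q j l) • c' l := by
          simp only [Finset.sum_add_distrib]
      _ = ∑ j, ∑ l, ∑ i, ((g i * h j) * dq i j l) • c' l + ∑ j, ∑ l, (dh j * q j l) • c' l :=
          congrArg₂ (· + ·) Finset.sum_comm Finset.sum_comm
      _ = ∑ j, ∑ i, ∑ l, ((g i * h j) * dq i j l) • c' l + ∑ j, ∑ l, (dh j * q j l) • c' l :=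
          congrArg (· + _) (Finset.sum_congr rfl fun j _ ↦ Finset.sum_comm)
      _ = _ := congrArg (· + _) Finset.sum_comm
  have e3 : ∑ k, (∑ i, (g i * (∑ j, h j * dp j i k) + p i k * dg i)) • c k =
      ∑ i, ∑ j, ∑ k, ((g i * h j) * dp j i k) • c k + ∑ i, ∑ k, (dg i * p i k) • c k := by
    calc _ = ∑ k, ∑ i, (∑ j, ((g i * h j) * dp j i k) • c k + (dg i * p i k) • c k) := by
          refine Finset.sum_congr rfl fun k _ ↦ ?_
          rw [Finset.sum_smul]
          refine Finset.sum_congr rfl fun i _ ↦ ?_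
          rw [add_smul, Finset.mul_sum, Finset.sum_smul, mul_comm (p i k)]
          congr 1
          exact Finset.sum_congr rfl fun j _ ↦ by congr 1; ring
      _ = ∑ k, ∑ i, ∑ j, ((g i * h j) * dp j i k) • c k + ∑ k, ∑ i, (dg i * p i k) • c k := by
          simp only [Finset.sum_add_distrib]
      _ = ∑ i, ∑ k, ∑ j, ((g i * h j) * dp j i k) • c k + ∑ i, ∑ k, (dg i * p i k) • c k :=
          congrArg₂ (· + ·) Finset.sum_comm Finset.sum_comm
      _ = _ := congrArg (· + _) (Finset.sum_congr rfl fun i _ ↦ Finset.sum_comm)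
  rw [e1, e2, e3]
  simp only [smul_sub, smul_add, Finset.smul_sum, smul_smul, Finset.sum_add_distrib,
    Finset.sum_sub_distrib]
  abel

namespace LieAlgebroid

variable {X Y Z : Man.{u}}

theorem bracketFormula_congr (B : LieAlgebroid Y) (f : X ⟶ Y) (x : X)
    (u w : TangentSpace (𝓡 X.dim) x) {V : TopologicalSpace.Opens Y} {m n : ℕ}
    {g g₁ : Fin m → X → ℝ} (ξ' : Fin m → B.Γ V) {h h₁ : Fin n → X → ℝ} (ν' : Fin n → B.Γ V)
    (hg : ∀ i, g i =ᶠ[𝓝 x] g₁ i) (hh : ∀ j, h j =ᶠ[𝓝 x] h₁ j) :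
    B.bracketFormula f x u w g ξ' h ν' = B.bracketFormula f x u w g₁ ξ' h₁ ν' := by
  unfold bracketFormula
  simp only [fun i ↦ (hg i).eq_of_nhds, fun i ↦ (hh i).eq_of_nhds,
    fun i ↦ Man.dirDeriv_congr (hg i), fun i ↦ Man.dirDeriv_congr (hh i)]

theorem bracketFormula_res (B : LieAlgebroid Y) (f : X ⟶ Y) (x : X)
    (u w : TangentSpace (𝓡 X.dim) x) {V W : TopologicalSpace.Opens Y} {m n : ℕ}
    (g : Fin m → X → ℝ) (ξ' : Fin m → B.Γ V) (h : Fin n → X → ℝ) (ν' : Fin n → B.Γ V)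
    (hW : W ≤ V) (hx : f x ∈ W) :
    B.bracketFormula f x u w g (fun i ↦ VBundle.res hW (ξ' i)) h (fun i ↦ VBundle.res hW (ν' i)) =
      B.bracketFormula f x u w g ξ' h ν' := by
  unfold bracketFormula
  simp only [B.bracket_res, VBundle.res_apply hx]

theorem bracketFormula_trans (B : LieAlgebroid Y) (C : LieAlgebroid Z) (f : X ⟶ Y) (g : Y ⟶ Z)
    (x : X) (u w : TangentSpace (𝓡 X.dim) x) (ψ : B.Fiber (f x) →ₗ[ℝ] C.Fiber (g (f x)))
    {V : TopologicalSpace.Opens Y} {W : TopologicalSpace.Opens Z}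
    {m n m' n' : ℕ} (G : Fin m → X → ℝ) (ζ : Fin m → B.Γ V) (H : Fin n → X → ℝ)
    (ζ' : Fin n → B.Γ V) (P : Fin m → Fin m' → Y → ℝ) (c : Fin m' → C.Γ W)
    (Q : Fin n → Fin n' → Y → ℝ) (c' : Fin n' → C.Γ W)
    (hG : ∀ i, X.SmoothAt (G i) x) (hH : ∀ j, X.SmoothAt (H j) x)
    (hP : ∀ i k, Y.SmoothAt (P i k) (f x)) (hQ : ∀ j l, Y.SmoothAt (Q j l) (f x))
    (hu : Man.dMap f x u = ∑ i, G i x • B.anchor (f x) (ζ i (f x)))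
    (hw : Man.dMap f x w = ∑ j, H j x • B.anchor (f x) (ζ' j (f x)))
    (hψ : ∀ i, ψ (ζ i (f x)) = ∑ k, P i k (f x) • c k (g (f x)))
    (hψ' : ∀ j, ψ (ζ' j (f x)) = ∑ l, Q j l (f x) • c' l (g (f x)))
    (hb : ∀ i j, ψ (B.bracket V (ζ i) (ζ' j) (f x)) = C.bracketFormula g (f x)
      (B.anchor (f x) (ζ i (f x))) (B.anchor (f x) (ζ' j (f x))) (P i) c (Q j) c') :
    ψ (B.bracketFormula f x u w G ζ H ζ') = C.bracketFormula (f ≫ g) x u w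
      (fun k y ↦ ∑ i, G i y * P i k (f y)) c (fun l y ↦ ∑ j, H j y * Q j l (f y)) c' := by
  have dG : ∀ k, X.dirDeriv (fun y ↦ ∑ i, G i y * P i k (f y)) x w =
      ∑ i, (G i x * (∑ j, H j x * Y.dirDeriv (P i k) (f x) (B.anchor (f x) (ζ' j (f x)))) +
        P i k (f x) * X.dirDeriv (G i) x w) := by
    intro k
    rw [Man.dirDeriv_sum _ (fun i _ ↦ Man.smoothAt_mul (hG i) ((hP i k).comp_hom f))]
    refine Finset.sum_congr rfl fun i _ ↦ ?_
    rw [Man.dirDeriv_mul (hG i) ((hP i k).comp_hom f), Man.dirDeriv_comp f (hP i k), hw, map_sum]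
    simp only [map_smul, smul_eq_mul]
  have dH : ∀ l, X.dirDeriv (fun y ↦ ∑ j, H j y * Q j l (f y)) x u =
      ∑ j, (H j x * (∑ i, G i x * Y.dirDeriv (Q j l) (f x) (B.anchor (f x) (ζ i (f x)))) +
        Q j l (f x) * X.dirDeriv (H j) x u) := by
    intro l
    rw [Man.dirDeriv_sum _ (fun i _ ↦ Man.smoothAt_mul (hH i) ((hQ i l).comp_hom f))]
    refine Finset.sum_congr rfl fun i _ ↦ ?_
    rw [Man.dirDeriv_mul (hH i) ((hQ i l).comp_hom f), Man.dirDeriv_comp f (hQ i l), hu, map_sum]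
    simp only [map_smul, smul_eq_mul]
  unfold bracketFormula at hb ⊢
  simp only [map_sub, map_add, map_sum, map_smul, hb, hψ, hψ', dG, dH]
  exact bracketFormula_algebra _ _ _ _ _ _ _ _ _ _ _

theorem bracket_sum_smul (A : LieAlgebroid X) {U : TopologicalSpace.Opens X} {m n : ℕ}
    (s : Fin m → X → ℝ) (hs : ∀ k, ∀ x ∈ U, X.SmoothAt (s k) x) (b : Fin m → A.Γ U)
    (t : Fin n → X → ℝ) (ht : ∀ k, ∀ x ∈ U, X.SmoothAt (t k) x) (c : Fin n → A.Γ U) {z : X}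
    (hz : z ∈ U) :
    A.bracket U (∑ k, VBundle.smul (s k) (hs k) (b k)) (∑ l, VBundle.smul (t l) (ht l) (c l)) z =
      A.bracketFormula (𝟙 X) z (A.anchor z ((∑ k, VBundle.smul (s k) (hs k) (b k) : A.Γ U) z))
        (A.anchor z ((∑ l, VBundle.smul (t l) (ht l) (c l) : A.Γ U) z)) s b t c := by
  have h1 : ∀ ξ : A.Γ U, ∀ {r : ℕ} (t : Fin r → X → ℝ) (ht : ∀ k, ∀ x ∈ U, X.SmoothAt (t k) x)
      (c : Fin r → A.Γ U), A.bracket U ξ (∑ l, VBundle.smul (t l) (ht l) (c l)) z =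
        ∑ l, (X.dirDeriv (t l) z (A.anchor z (ξ z)) • c l z + t l z • A.bracket U ξ (c l) z) := by
    intro ξ r t ht c
    rw [map_sum, VBundle.sum_apply]
    exact Finset.sum_congr rfl fun l _ ↦ A.leibniz _ _ _ _ _ _ hz
  have h2 : ∀ l, A.bracket U (∑ k, VBundle.smul (s k) (hs k) (b k)) (c l) z =
      ∑ k, s k z • A.bracket U (b k) (c l) z -
        ∑ k, X.dirDeriv (s k) z (A.anchor z (c l z)) • b k z := by
    intro l
    rw [A.bracket_skew]
    change -(A.bracket U (c l) _ z) = _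
    rw [h1, ← Finset.sum_sub_distrib, ← Finset.sum_neg_distrib]
    refine Finset.sum_congr rfl fun k _ ↦ ?_
    rw [A.bracket_skew (b k)]
    change _ = s k z • -(A.bracket U (c l) (b k) z) - _
    rw [smul_neg]
    abel
  have h3 : A.anchor z ((∑ l, VBundle.smul (t l) (ht l) (c l) : A.Γ U) z) =
      ∑ l, t l z • A.anchor z (c l z) := by
    rw [VBundle.sum_apply, map_sum]
    exact Finset.sum_congr rfl fun l _ ↦ map_smul _ _ _
  rw [h1]
  change _ = ∑ k, ∑ l, (s k z * t l z) • A.bracket U (b k) (c l) z +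
    ∑ l, X.dirDeriv (t l) z _ • c l z - ∑ k, X.dirDeriv (s k) z _ • b k z
  rw [h3]
  simp only [h2]
  simp only [map_sum, map_smul, Finset.sum_smul, smul_sub, Finset.smul_sum, smul_smul,
    Finset.sum_add_distrib, Finset.sum_sub_distrib, smul_eq_mul]
  rw [Finset.sum_comm (s := Finset.univ (α := Fin m)),
    Finset.sum_comm (s := Finset.univ (α := Fin m))]
  simp only [mul_comm (t _ z)]
  abel

/-- The bracket in terms of a local frame. -/
theorem bracket_eq_frame (A : LieAlgebroid X) {e : LocalTriv X A.Fiber} (he : e ∈ A.atlas) {z : X}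
    (hz : z ∈ e.baseSet) {U : TopologicalSpace.Opens X} (hU : z ∈ U) (σ τ : A.Γ U) :
    A.bracket U σ τ z = A.bracketFormula (𝟙 X) z (A.anchor z (σ z)) (A.anchor z (τ z))
      (fun k y ↦ e.coord y (σ y) k) (VBundle.frame he) (fun k y ↦ e.coord y (τ y) k)
      (VBundle.frame he) := by
  let V : TopologicalSpace.Opens X := ⟨e.baseSet, e.isOpen_baseSet⟩
  let W : TopologicalSpace.Opens X := U ⊓ V
  have hzW : z ∈ W := ⟨hU, hz⟩
  have hs : ∀ σ : A.Γ U, ∀ k, ∀ x ∈ W, X.SmoothAt (fun y ↦ e.coord y (σ y) k) x :=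
    fun σ k x hx ↦ VBundle.coord_smoothAt he hx.2 hx.1 σ k
  let b : Fin e.rank → A.Γ W := fun k ↦ VBundle.res inf_le_right (VBundle.frame he k)
  have hS : ∀ σ : A.Γ U, ∀ᶠ y in 𝓝 z, σ y = (∑ k, VBundle.smul _ (hs σ k) (b k) : A.Γ W) y :=
    fun σ ↦ by
      filter_upwards [W.isOpen.mem_nhds hzW] with y hy
      rw [VBundle.sum_apply]
      refine (VBundle.eq_sum_frame he hy.2 (σ y)).trans (Finset.sum_congr rfl fun k _ ↦ ?_)
      rw [VBundle.smul_apply, VBundle.res_apply hy]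
  rw [A.bracket_congr hU hzW (hS σ) (hS τ), bracket_sum_smul A _ _ _ _ _ _ hzW,
    ← (hS σ).self_of_nhds, ← (hS τ).self_of_nhds]
  exact bracketFormula_res A (𝟙 X) z _ _ _ _ _ _ inf_le_right hzW

end LieAlgebroid

namespace LieAlgebroid

variable {X Y Z : Man.{u}}

/-- It suffices to check the compatibility with the brackets in one frame around each point. -/
theorem map_bracket_of_frame {A : LieAlgebroid X} {B : LieAlgebroid Y} {f : X ⟶ Y}
    (φ : ∀ x, A.Fiber x →ₗ[ℝ] B.Fiber (f x))
    (anchor_comm : ∀ x v, B.anchor (f x) (φ x v) = Man.dMap f x (A.anchor x v))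
    {U : TopologicalSpace.Opens X} (ξ ν : A.Γ U) (x : X)
    {e : LocalTriv Y B.Fiber} (he : e ∈ B.atlas) (hx : f x ∈ e.baseSet)
    (hφ : φ x (A.bracket U ξ ν x) = B.bracketFormula f x (A.anchor x (ξ x)) (A.anchor x (ν x))
      (fun k y ↦ e.coord (f y) (φ y (ξ y)) k) (VBundle.frame he)
      (fun k y ↦ e.coord (f y) (φ y (ν y)) k) (VBundle.frame he))
    (V : TopologicalSpace.Opens Y) (hV : f x ∈ V)
    (m n : ℕ) (g : Fin m → X → ℝ) (ξ' : Fin m → B.Γ V) (h : Fin n → X → ℝ) (ν' : Fin n → B.Γ V)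
    (hg : ∀ i, X.SmoothAt (g i) x) (hh : ∀ j, X.SmoothAt (h j) x)
    (hξ : ∀ᶠ y in 𝓝 x, φ y (ξ y) = ∑ i, g i y • ξ' i (f y))
    (hν : ∀ᶠ y in 𝓝 x, φ y (ν y) = ∑ j, h j y • ν' j (f y)) :
    φ x (A.bracket U ξ ν x) =
      B.bracketFormula f x (A.anchor x (ξ x)) (A.anchor x (ν x)) g ξ' h ν' := by
  have key := bracketFormula_trans B B f (𝟙 Y) x (A.anchor x (ξ x)) (A.anchor x (ν x))
    LinearMap.id g ξ' h ν' (fun i k y ↦ e.coord y (ξ' i y) k) (VBundle.frame he)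
    (fun i k y ↦ e.coord y (ν' i y) k) (VBundle.frame he) hg hh
    (fun i k ↦ VBundle.coord_smoothAt he hx hV (ξ' i) k)
    (fun i k ↦ VBundle.coord_smoothAt he hx hV (ν' i) k)
    (by rw [← anchor_comm, hξ.self_of_nhds, map_sum]; simp only [map_smul])
    (by rw [← anchor_comm, hν.self_of_nhds, map_sum]; simp only [map_smul])
    (fun i ↦ VBundle.eq_sum_frame he hx (ξ' i (f x)))
    (fun i ↦ VBundle.eq_sum_frame he hx (ν' i (f x)))
    (fun i j ↦ B.bracket_eq_frame he hx hV (ξ' i) (ν' j))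
  refine hφ.trans (Eq.trans ?_ key.symm)
  refine bracketFormula_congr B f x _ _ _ _ (fun k ↦ ?_) (fun k ↦ ?_)
  · filter_upwards [hξ] with y hy
    rw [hy, map_sum, Finset.sum_apply]
    simp only [map_smul, Pi.smul_apply, smul_eq_mul]
  · filter_upwards [hν] with y hy
    rw [hy, map_sum, Finset.sum_apply]
    simp only [map_smul, Pi.smul_apply, smul_eq_mul]

namespace Hom

/-- The identity morphism. -/
def id (A : LieAlgebroid X) : Hom A A (𝟙 X) where
  toFun x := LinearMap.id
  smooth e he e' he' v := A.smooth_transition e he e' he' v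
  anchor_comm x v := (Man.dMap_id x (A.anchor x v)).symm
  map_bracket U ξ ν x hU := by
    obtain ⟨e, he, hx⟩ := A.exists_mem_baseSet x
    exact map_bracket_of_frame (f := 𝟙 X) (fun x ↦ LinearMap.id)
      (fun x v ↦ (Man.dMap_id x (A.anchor x v)).symm) ξ ν x he hx
      (A.bracket_eq_frame he hx hU ξ ν)

variable {A : LieAlgebroid X} {B : LieAlgebroid Y} {C : LieAlgebroid Z} {f : X ⟶ Y} {g : Y ⟶ Z}

theorem smoothAt_symm (φ : Hom A B f) {e : LocalTriv X A.Fiber} (he : e ∈ A.atlas)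
    {e' : LocalTriv Y B.Fiber} (he' : e' ∈ B.atlas) {x : X} (hx : x ∈ e.baseSet)
    (hx' : f x ∈ e'.baseSet) (v : Fin e.rank → ℝ) :
    X.SmoothAt (fun y ↦ e'.coord (f y) (φ.toFun y (e.symm y v))) x :=
  (φ.smooth e he e' he' v).contMDiffAt ((e.isOpen_baseSet.inter
    (e'.isOpen_baseSet.preimage f.contMDiff.continuous)).mem_nhds ⟨hx, hx'⟩)

theorem smoothAt_apply (φ : Hom A B f) {e' : LocalTriv Y B.Fiber} (he' : e' ∈ B.atlas) {x : X}
    (hx' : f x ∈ e'.baseSet) {U : TopologicalSpace.Opens X} (hU : x ∈ U) (ξ : A.Γ U) (k : Fin e'.rank) :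
    X.SmoothAt (fun y ↦ e'.coord (f y) (φ.toFun y (ξ y)) k) x := by
  obtain ⟨e, he, hx⟩ := A.exists_mem_baseSet x
  have h : X.SmoothAt (fun y ↦ ∑ l, e.coord y (ξ y) l *
      e'.coord (f y) (φ.toFun y (e.symm y (Pi.single l 1))) k) x :=
    Man.smoothAt_sum _ fun l _ ↦ Man.smoothAt_mul (VBundle.coord_smoothAt he hx hU ξ l)
      (contMDiffAt_pi_space.1 (φ.smoothAt_symm he he' hx hx' _) k)
  refine h.congr_of_eventuallyEq ?_
  filter_upwards [e.isOpen_baseSet.mem_nhds hx] with y hy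
  conv_lhs => rw [← e.symm_coord y hy (ξ y), VBundle.symm_eq_sum]
  rw [map_sum, map_sum, Finset.sum_apply]
  simp only [map_smul, Pi.smul_apply, smul_eq_mul]

theorem comp_anchor_comm (φ : Hom A B f) (ψ : Hom B C g) (x : X) (v : A.Fiber x) :
    C.anchor ((f ≫ g) x) (((ψ.toFun (f x)).comp (φ.toFun x)) v) =
      Man.dMap (f ≫ g) x (A.anchor x v) := by
  rw [Man.dMap_comp, ← φ.anchor_comm]
  exact ψ.anchor_comm _ _

/-- The composition of morphisms. -/
def comp (φ : Hom A B f) (ψ : Hom B C g) : Hom A C (f ≫ g) where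
  toFun x := (ψ.toFun (f x)).comp (φ.toFun x)
  smooth e he e'' he'' v x hx := by
    obtain ⟨e', he', hx'⟩ := B.exists_mem_baseSet (f x)
    have h : X.SmoothAt (fun y ↦ e''.coord (g (f y)) (ψ.toFun (f y) (φ.toFun y (e.symm y v)))) x := by
      refine contMDiffAt_pi_space.2 fun k ↦ ?_
      have h : X.SmoothAt (fun y ↦ ∑ l, e'.coord (f y) (φ.toFun y (e.symm y v)) l *
          e''.coord (g (f y)) (ψ.toFun (f y) (e'.symm (f y) (Pi.single l 1))) k) x :=
        Man.smoothAt_sum _ fun l _ ↦ Man.smoothAt_mul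
          (contMDiffAt_pi_space.1 (φ.smoothAt_symm he he' hx.1 hx' v) l)
          (contMDiffAt_pi_space.1 ((ψ.smoothAt_symm he' he'' hx' hx.2 _).comp_hom f) k)
      refine h.congr_of_eventuallyEq ?_
      filter_upwards [(e'.isOpen_baseSet.preimage f.contMDiff.continuous).mem_nhds hx'] with y hy
      conv_lhs => rw [← e'.symm_coord (f y) hy (φ.toFun y (e.symm y v)), VBundle.symm_eq_sum]
      rw [map_sum, map_sum, Finset.sum_apply]
      simp only [map_smul, Pi.smul_apply, smul_eq_mul]
    exact h.contMDiffWithinAt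
  anchor_comm := comp_anchor_comm φ ψ
  map_bracket U ξ ν x hU := by
    obtain ⟨e', he', hx'⟩ := B.exists_mem_baseSet (f x)
    obtain ⟨e, he, hx⟩ := C.exists_mem_baseSet (g (f x))
    let b := VBundle.frame he'
    have hφ : ∀ σ : A.Γ U, ∀ᶠ y in 𝓝 x, φ.toFun y (σ y) =
        ∑ k, e'.coord (f y) (φ.toFun y (σ y)) k • b k (f y) := fun σ ↦ by
      filter_upwards [(e'.isOpen_baseSet.preimage f.contMDiff.continuous).mem_nhds hx'] with y hy
      exact VBundle.eq_sum_frame he' hy _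
    have hψ : ∀ {V} (σ : B.Γ V), ∀ᶠ y in 𝓝 (f x), ψ.toFun y (σ y) =
        ∑ k, e.coord (g y) (ψ.toFun y (σ y)) k • VBundle.frame he k (g y) := fun σ ↦ by
      filter_upwards [(e.isOpen_baseSet.preimage g.contMDiff.continuous).mem_nhds hx] with y hy
      exact VBundle.eq_sum_frame he hy _
    have h1 := φ.map_bracket U ξ ν x hU _ hx' _ _ _ b _ b
      (fun k ↦ φ.smoothAt_apply he' hx' hU ξ k)
      (fun k ↦ φ.smoothAt_apply he' hx' hU ν k) (hφ ξ) (hφ ν)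
    have key := bracketFormula_trans B C f g x (A.anchor x (ξ x)) (A.anchor x (ν x))
      (ψ.toFun (f x)) (fun k y ↦ e'.coord (f y) (φ.toFun y (ξ y)) k) b
      (fun k y ↦ e'.coord (f y) (φ.toFun y (ν y)) k) b
      (fun i k y ↦ e.coord (g y) (ψ.toFun y (b i y)) k) (VBundle.frame he)
      (fun i k y ↦ e.coord (g y) (ψ.toFun y (b i y)) k) (VBundle.frame he)
      (fun k ↦ φ.smoothAt_apply he' hx' hU ξ k) (fun k ↦ φ.smoothAt_apply he' hx' hU ν k)
      (fun i k ↦ ψ.smoothAt_apply he hx hx' (b i) k) (fun i k ↦ ψ.smoothAt_apply he hx hx' (b i) k)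
      (by rw [← φ.anchor_comm, (hφ ξ).self_of_nhds, map_sum]
          simp only [map_smul, ← (hφ ξ).self_of_nhds])
      (by rw [← φ.anchor_comm, (hφ ν).self_of_nhds, map_sum]
          simp only [map_smul, ← (hφ ν).self_of_nhds])
      (fun i ↦ (hψ (b i)).self_of_nhds) (fun i ↦ (hψ (b i)).self_of_nhds)
      (fun i j ↦ ψ.map_bracket _ (b i) (b j) (f x) hx' _ hx _ _ _ (VBundle.frame he) _
        (VBundle.frame he) (fun k ↦ ψ.smoothAt_apply he hx hx' (b i) k)
        (fun k ↦ ψ.smoothAt_apply he hx hx' (b j) k) (hψ (b i)) (hψ (b j)))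
    have hcoord : ∀ σ : A.Γ U, ∀ k,
        (fun y ↦ e.coord (g (f y)) (ψ.toFun (f y) (φ.toFun y (σ y))) k)
        =ᶠ[𝓝 x] fun y ↦ ∑ i, e'.coord (f y) (φ.toFun y (σ y)) i *
          e.coord (g (f y)) (ψ.toFun (f y) (b i (f y))) k := fun σ k ↦ by
      filter_upwards [hφ σ] with y hy
      conv_lhs => rw [hy]
      rw [map_sum, map_sum, Finset.sum_apply]
      simp only [map_smul, Pi.smul_apply, smul_eq_mul]
    refine map_bracket_of_frame (f := f ≫ g) (fun x ↦ (ψ.toFun (f x)).comp (φ.toFun x))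
      (comp_anchor_comm φ ψ) ξ ν x he hx ?_
    refine (congrArg (ψ.toFun (f x)) h1).trans (key.trans ?_)
    exact (bracketFormula_congr C (f ≫ g) x _ _ _ _ (hcoord ξ) (hcoord ν)).symm

end Hom

end LieAlgebroid

/-- The objects of the category of Lie algebroids: manifolds with a Lie algebroid over them. -/
structure LA : Type (u + 1) where
  base : Man.{u}
  alg : LieAlgebroid base

namespace LA

/-- Base-changing morphisms of Lie algebroids. -/
structure Hom (P Q : LA.{u}) : Type u where
  base : P.base ⟶ Q.base
  algHom : LieAlgebroid.Hom P.alg Q.alg base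

/-- The category of Lie algebroids and base-changing morphisms. -/
instance category : Category.{u} LA.{u} where
  Hom P Q := LA.Hom P Q
  id P := ⟨𝟙 P.base, LieAlgebroid.Hom.id P.alg⟩
  comp φ ψ := ⟨φ.base ≫ ψ.base, φ.algHom.comp ψ.algHom⟩
  id_comp _ := rfl
  comp_id _ := rfl
  assoc _ _ _ := rfl

/-- The functor sending a Lie algebroid to its base manifold. -/
def toMan : LA.{u} ⥤ Man.{u} where
  obj P := P.base
  map φ := φ.base

end LA

section LAOver

variable {𝒮 : Type u₁} [Category.{v₁} 𝒮]

/-- The objects of the category of Lie algebroids over `𝒮`, for a functor `b` from `𝒮` to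
manifolds: the objects `S` of `𝒮` with a Lie algebroid over the manifold `b.obj S`. -/
structure LAOver (b : 𝒮 ⥤ Man.{u}) : Type (max u₁ (u + 1)) where
  base : 𝒮
  alg : LieAlgebroid (b.obj base)

namespace LAOver

variable {b : 𝒮 ⥤ Man.{u}}

/-- The underlying Lie algebroid. -/
abbrev toLA (P : LAOver b) : LA.{u} := ⟨b.obj P.base, P.alg⟩

/-- A morphism of Lie algebroids over `𝒮`: a morphism `base` of `𝒮` with a base-changing morphism of
Lie algebroids over the smooth map `b.map base`. -/
@[ext]
structure Hom (P Q : LAOver b) : Type (max v₁ u) where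
  base : P.base ⟶ Q.base
  hom : P.toLA ⟶ Q.toLA
  hom_base : hom.base = b.map base

/-- The category of Lie algebroids over `𝒮`, that is, the pullback of the category `LA` along `b`. -/
instance category : Category.{max v₁ u} (LAOver b) where
  Hom P Q := LAOver.Hom P Q
  id P := ⟨𝟙 P.base, 𝟙 P.toLA, (b.map_id P.base).symm⟩
  comp φ ψ := ⟨φ.base ≫ ψ.base, φ.hom ≫ ψ.hom, by
    rw [b.map_comp, ← φ.hom_base, ← ψ.hom_base]; rfl⟩
  id_comp φ := LAOver.Hom.ext (Category.id_comp φ.base) (Category.id_comp φ.hom)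
  comp_id φ := LAOver.Hom.ext (Category.comp_id φ.base) (Category.comp_id φ.hom)
  assoc φ ψ χ := LAOver.Hom.ext (Category.assoc φ.base ψ.base χ.base)
    (Category.assoc φ.hom ψ.hom χ.hom)

/-- The projection to `𝒮`. -/
def proj (b : 𝒮 ⥤ Man.{u}) : LAOver b ⥤ 𝒮 where
  obj P := P.base
  map φ := φ.base

end LAOver

end LAOver

section Global

namespace Man

variable {X : Man.{u}} [T2Space X]

theorem exists_bump {U : Set X} (hU : IsOpen U) {z : X} (hz : z ∈ U) :
    ∃ χ : X → ℝ, (∀ x, X.SmoothAt χ x) ∧ tsupport χ ⊆ U ∧ ∀ᶠ y in 𝓝 z, χ y = 1 := by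
  obtain ⟨χ, -, hχ⟩ := (SmoothBumpFunction.nhds_basis_tsupport (I := 𝓡 X.dim) z).mem_iff.1
    (hU.mem_nhds hz)
  exact ⟨χ, χ.contMDiff, hχ, χ.eventuallyEq_one⟩

theorem smoothAt_bump_smul {X : Man.{u}} {V : Type*} [NormedAddCommGroup V] [NormedSpace ℝ V]
    {U : Set X} {χ : X → ℝ} (hs : ∀ x, X.SmoothAt χ x) (hχ : tsupport χ ⊆ U) {F : X → V} {x : X}
    (hF : x ∈ U → SmoothAt F x) : SmoothAt (fun y ↦ χ y • F y) x := by
  by_cases hx : x ∈ tsupport χ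
  · exact (hs x).smul (hF (hχ hx))
  · have h0 : ∀ᶠ y in 𝓝 x, y ∉ tsupport χ :=
      (isClosed_tsupport (χ : X → ℝ)).isOpen_compl.mem_nhds hx
    refine (contMDiffAt_const (c := (0 : V))).congr_of_eventuallyEq ?_
    filter_upwards [h0] with y hy
    rw [image_eq_zero_of_notMem_tsupport hy, zero_smul]

end Man

/-- The structure of a Lie algebroid in terms of a bracket on global sections only. -/
structure GlobalBracket {X : Man.{u}} (E : VBundle X)
    (anchor : ∀ x, E.Fiber x →ₗ[ℝ] TangentSpace (𝓡 X.dim) x) : Type u where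
  bracket : E.Γ ⊤ →ₗ[ℝ] E.Γ ⊤ →ₗ[ℝ] E.Γ ⊤
  bracket_self : ∀ ξ, bracket ξ ξ = 0
  jacobi : ∀ ξ ν ζ, bracket ξ (bracket ν ζ) = bracket (bracket ξ ν) ζ + bracket ν (bracket ξ ζ)
  anchor_bracket : ∀ (ξ ν : E.Γ ⊤) (x : X), anchor x (bracket ξ ν x) =
    VectorField.mlieBracket (𝓡 X.dim) (fun y ↦ anchor y (ξ y)) (fun y ↦ anchor y (ν y)) x
  leibniz : ∀ (ξ ν : E.Γ ⊤) (f : X → ℝ) (hf : ∀ x, X.SmoothAt f x) (x : X),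
    bracket ξ (VBundle.smul f (fun x _ ↦ hf x) ν) x =
      X.dirDeriv f x (anchor x (ξ x)) • ν x + f x • bracket ξ ν x

namespace GlobalBracket

variable {X : Man.{u}} {E : VBundle X}
  {anchor : ∀ x, E.Fiber x →ₗ[ℝ] TangentSpace (𝓡 X.dim) x} (G : GlobalBracket E anchor)
  {U : TopologicalSpace.Opens X}

theorem bracket_skew (ξ ν : E.Γ ⊤) : G.bracket ξ ν = -G.bracket ν ξ := by
  have h := G.bracket_self (ξ + ν)
  simp only [map_add, LinearMap.add_apply, G.bracket_self, zero_add, add_zero] at h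
  exact eq_neg_of_add_eq_zero_right h

variable [T2Space X]

theorem exists_extension (ξ : E.Γ U) {z : X} (hz : z ∈ U) :
    ∃ ξ' : E.Γ ⊤, ∀ᶠ y in 𝓝 z, ξ' y = ξ y := by
  obtain ⟨χ, hs, hχ, h1⟩ := Man.exists_bump U.isOpen hz
  refine ⟨⟨fun y ↦ χ y • ξ y, fun e he x _ hx ↦ ?_, fun x hx ↦ (hx trivial).elim⟩, ?_⟩
  · refine (Man.smoothAt_bump_smul hs hχ (F := fun y ↦ e.coord y (ξ y)) (x := x)
      fun hx' ↦ ξ.2.1 e he x hx' hx).congr_of_eventuallyEq (.of_forall fun y ↦ ?_)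
    exact map_smul (e.coord y) _ _
  · filter_upwards [h1] with y hy
    rw [hy, one_smul]

theorem bracket_apply_eq_zero (ξ ν : E.Γ ⊤) {z : X} (h : ∀ᶠ y in 𝓝 z, ν y = 0) :
    G.bracket ξ ν z = 0 := by
  obtain ⟨U, hU, hUo, hzU⟩ := eventually_nhds_iff.1 h
  obtain ⟨χ, hs, hχ, h1⟩ := Man.exists_bump hUo hzU
  have h0 : VBundle.smul χ (fun x _ ↦ hs x) ν = 0 := by
    refine VBundle.section_ext fun y _ ↦ ?_
    change χ y • ν y = 0
    by_cases hy : y ∈ tsupport χ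
    · rw [hU y (hχ hy), smul_zero]
    · rw [image_eq_zero_of_notMem_tsupport hy, zero_smul]
  have h2 := G.leibniz ξ ν χ hs z
  rw [h0, map_zero, h.self_of_nhds, h1.self_of_nhds, smul_zero, one_smul, zero_add] at h2
  exact h2.symm

theorem bracket_congr {ξ ξ' ν ν' : E.Γ ⊤} {z : X} (h : ∀ᶠ y in 𝓝 z, ξ y = ξ' y)
    (h' : ∀ᶠ y in 𝓝 z, ν y = ν' y) : G.bracket ξ ν z = G.bracket ξ' ν' z := by
  have h1 : G.bracket ξ (ν - ν') z = 0 := G.bracket_apply_eq_zero _ _ (by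
    filter_upwards [h'] with y hy
    change ν y - ν' y = 0
    rw [hy, sub_self])
  have h2 : G.bracket ν' (ξ - ξ') z = 0 := G.bracket_apply_eq_zero _ _ (by
    filter_upwards [h] with y hy
    change ξ y - ξ' y = 0
    rw [hy, sub_self])
  rw [map_sub] at h1 h2
  have h1' : G.bracket ξ ν z = G.bracket ξ ν' z := sub_eq_zero.1 h1
  have h2' : G.bracket ν' ξ z = G.bracket ν' ξ' z := sub_eq_zero.1 h2
  rw [h1', G.bracket_skew ξ ν', G.bracket_skew ξ' ν']
  exact congrArg Neg.neg h2'

open Classical in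
/-- A global section which agrees with `ξ` near `z`, if `z` is in `U`. -/
def ext (ξ : E.Γ U) (z : X) : E.Γ ⊤ :=
  if h : z ∈ U then (exists_extension ξ h).choose else 0

theorem ext_spec (ξ : E.Γ U) {z : X} (hz : z ∈ U) : ∀ᶠ y in 𝓝 z, ext ξ z y = ξ y := by
  unfold ext
  rw [dif_pos hz]
  exact (exists_extension ξ hz).choose_spec

theorem bracket_ext {ξ ν : E.Γ U} {z : X} (hz : z ∈ U) {ξ' ν' : E.Γ ⊤}
    (h : ∀ᶠ y in 𝓝 z, ξ' y = ξ y) (h' : ∀ᶠ y in 𝓝 z, ν' y = ν y) :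
    G.bracket (ext ξ z) (ext ν z) z = G.bracket ξ' ν' z :=
  G.bracket_congr (by filter_upwards [h, ext_spec ξ hz] with y h1 h2; rw [h1, h2])
    (by filter_upwards [h', ext_spec ν hz] with y h1 h2; rw [h1, h2])

theorem eventually_bracket_ext {ξ ν : E.Γ U} {z : X} (hz : z ∈ U) {ξ' ν' : E.Γ ⊤}
    (h : ∀ᶠ y in 𝓝 z, ξ' y = ξ y) (h' : ∀ᶠ y in 𝓝 z, ν' y = ν y) :
    ∀ᶠ y in 𝓝 z, G.bracket (ext ξ y) (ext ν y) y = G.bracket ξ' ν' y := by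
  filter_upwards [U.isOpen.mem_nhds hz, eventually_eventually_nhds.2 h,
    eventually_eventually_nhds.2 h'] with y hy h1 h2
  exact G.bracket_ext hy h1 h2

/-- The bracket of two sections over `U` determined by a bracket of global sections. -/
def localBracket (ξ ν : E.Γ U) : E.Γ U :=
  VBundle.sectionOn U (fun z ↦ G.bracket (ext ξ z) (ext ν z) z) fun e he x hU hx ↦ by
    refine ((G.bracket (ext ξ x) (ext ν x)).2.1 e he x trivial hx).congr_of_eventuallyEq ?_
    filter_upwards [G.eventually_bracket_ext hU (ext_spec ξ hU) (ext_spec ν hU)] with y hy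
    rw [hy]

theorem localBracket_apply {ξ ν : E.Γ U} {z : X} (hz : z ∈ U) {ξ' ν' : E.Γ ⊤}
    (h : ∀ᶠ y in 𝓝 z, ξ' y = ξ y) (h' : ∀ᶠ y in 𝓝 z, ν' y = ν y) :
    G.localBracket ξ ν z = G.bracket ξ' ν' z :=
  (VBundle.sectionOn_apply hz).trans (G.bracket_ext hz h h')

theorem eventually_localBracket {ξ ν : E.Γ U} {z : X} (hz : z ∈ U) {ξ' ν' : E.Γ ⊤}
    (h : ∀ᶠ y in 𝓝 z, ξ' y = ξ y) (h' : ∀ᶠ y in 𝓝 z, ν' y = ν y) :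
    ∀ᶠ y in 𝓝 z, G.bracket ξ' ν' y = G.localBracket ξ ν y := by
  filter_upwards [U.isOpen.mem_nhds hz, eventually_eventually_nhds.2 h,
    eventually_eventually_nhds.2 h'] with y hy h1 h2
  exact (G.localBracket_apply hy h1 h2).symm

/-- On a Hausdorff manifold, a bracket on global sections defines a Lie algebroid. -/
def toLieAlgebroid (smooth_anchor : ∀ e ∈ E.atlas, ∀ v : Fin e.rank → ℝ,
    ContMDiffOn (𝓡 X.dim) (𝓡 X.dim).tangent ∞
      (fun x ↦ (⟨x, anchor x (e.symm x v)⟩ : TangentBundle (𝓡 X.dim) X)) e.baseSet) :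
    LieAlgebroid X where
  toVBundle := E
  anchor := anchor
  smooth_anchor := smooth_anchor
  bracket U := LinearMap.mk₂ ℝ G.localBracket
    (fun ξ ξ₁ ν ↦ VBundle.section_ext fun z hz ↦ by
      have h1 := ext_spec ξ hz
      have h2 := ext_spec ξ₁ hz
      have h3 := ext_spec ν hz
      rw [G.localBracket_apply hz (ξ' := ext ξ z + ext ξ₁ z) (by
        filter_upwards [h1, h2] with y e1 e2
        exact congrArg₂ (· + ·) e1 e2) h3, map_add]
      exact (congrArg₂ (· + ·) (G.localBracket_apply hz h1 h3)
        (G.localBracket_apply hz h2 h3)).symm)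
    (fun c ξ ν ↦ VBundle.section_ext fun z hz ↦ by
      have h1 := ext_spec ξ hz
      have h3 := ext_spec ν hz
      rw [G.localBracket_apply hz (ξ' := c • ext ξ z) (by
        filter_upwards [h1] with y e1
        exact congrArg (c • ·) e1) h3, map_smul]
      exact (congrArg (c • ·) (G.localBracket_apply hz h1 h3)).symm)
    (fun ν ξ ξ₁ ↦ VBundle.section_ext fun z hz ↦ by
      have h1 := ext_spec ξ hz
      have h2 := ext_spec ξ₁ hz
      have h3 := ext_spec ν hz
      rw [G.localBracket_apply hz h3 (ν' := ext ξ z + ext ξ₁ z) (by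
        filter_upwards [h1, h2] with y e1 e2
        exact congrArg₂ (· + ·) e1 e2), map_add]
      exact (congrArg₂ (· + ·) (G.localBracket_apply hz h3 h1)
        (G.localBracket_apply hz h3 h2)).symm)
    (fun c ν ξ ↦ VBundle.section_ext fun z hz ↦ by
      have h1 := ext_spec ξ hz
      have h3 := ext_spec ν hz
      rw [G.localBracket_apply hz h3 (ν' := c • ext ξ z) (by
        filter_upwards [h1] with y e1
        exact congrArg (c • ·) e1), map_smul]
      exact (congrArg (c • ·) (G.localBracket_apply hz h3 h1)).symm)
  bracket_res {U V} h ξ ν := VBundle.section_ext fun z hz ↦ by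
    have h1 := ext_spec ξ (h hz)
    have h2 := ext_spec ν (h hz)
    have hV := V.isOpen.mem_nhds hz
    refine Eq.trans ?_ (VBundle.res_apply hz).symm
    refine (G.localBracket_apply hz (ξ' := ext ξ z) (ν' := ext ν z) ?_ ?_).trans
      (G.localBracket_apply (h hz) h1 h2).symm
    · filter_upwards [h1, hV] with y e1 hy
      rw [e1, VBundle.res_apply hy]
    · filter_upwards [h2, hV] with y e1 hy
      rw [e1, VBundle.res_apply hy]
  bracket_self U ξ := VBundle.section_ext fun z hz ↦ by
    refine (G.localBracket_apply hz (ext_spec ξ hz) (ext_spec ξ hz)).trans ?_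
    rw [G.bracket_self]
    rfl
  jacobi U ξ ν ζ := VBundle.section_ext fun z hz ↦ by
    have h1 := ext_spec ξ hz
    have h2 := ext_spec ν hz
    have h3 := ext_spec ζ hz
    refine (G.localBracket_apply hz h1 (G.eventually_localBracket hz h2 h3)).trans ?_
    rw [G.jacobi]
    exact (congrArg₂ (· + ·) (G.localBracket_apply hz (G.eventually_localBracket hz h1 h2) h3)
      (G.localBracket_apply hz h2 (G.eventually_localBracket hz h1 h3))).symm
  anchor_bracket U ξ ν z hz := by
    have h1 := ext_spec ξ hz
    have h2 := ext_spec ν hz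
    refine (congrArg (anchor z) (G.localBracket_apply hz h1 h2)).trans ?_
    rw [G.anchor_bracket]
    refine Filter.EventuallyEq.mlieBracket_vectorField_eq ?_ ?_
    · filter_upwards [h1] with y hy
      rw [hy]
    · filter_upwards [h2] with y hy
      rw [hy]
  leibniz U ξ ν f hf z hz := by
    have h1 := ext_spec ξ hz
    have h2 := ext_spec ν hz
    obtain ⟨χ, hs, hχ, hone⟩ := Man.exists_bump U.isOpen hz
    have hF : ∀ x, X.SmoothAt (fun y ↦ χ y • f y) x := fun x ↦
      Man.smoothAt_bump_smul hs hχ fun hx ↦ hf x hx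
    have hFf : (fun y ↦ χ y • f y) =ᶠ[𝓝 z] f := by
      filter_upwards [hone] with y hy
      rw [hy, one_smul]
    refine (G.localBracket_apply hz h1 (ν' := VBundle.smul _ (fun x _ ↦ hF x) (ext ν z)) ?_).trans ?_
    · filter_upwards [h2, hFf] with y e1 e2
      rw [VBundle.smul_apply, VBundle.smul_apply, e1, e2]
    · rw [G.leibniz, Man.dirDeriv_congr hFf, h1.self_of_nhds, h2.self_of_nhds,
        hFf.eq_of_nhds, ← G.localBracket_apply hz h1 h2]
      rfl

/-- The bracket on global sections of the resulting Lie algebroid is the given one. -/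
theorem toLieAlgebroid_bracket_top (smooth_anchor : ∀ e ∈ E.atlas, ∀ v : Fin e.rank → ℝ,
    ContMDiffOn (𝓡 X.dim) (𝓡 X.dim).tangent ∞
      (fun x ↦ (⟨x, anchor x (e.symm x v)⟩ : TangentBundle (𝓡 X.dim) X)) e.baseSet) (ξ ν : E.Γ ⊤) :
    (G.toLieAlgebroid smooth_anchor).bracket ⊤ ξ ν = G.bracket ξ ν :=
  VBundle.section_ext fun _ hz ↦ G.localBracket_apply hz (.of_forall fun _ ↦ rfl)
    (.of_forall fun _ ↦ rfl)

end GlobalBracket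

/-- On a Hausdorff manifold, a bracket on the sections over all open subsets which is compatible with
restrictions is determined by the bracket of global sections. -/
theorem VBundle.bracket_unique {X : Man.{u}} [T2Space X] {E : VBundle X}
    (br br' : ∀ U, E.Γ U →ₗ[ℝ] E.Γ U →ₗ[ℝ] E.Γ U)
    (res : ∀ {U V} (h : V ≤ U) (ξ ν : E.Γ U),
      br V (VBundle.res h ξ) (VBundle.res h ν) = VBundle.res h (br U ξ ν))
    (res' : ∀ {U V} (h : V ≤ U) (ξ ν : E.Γ U),
      br' V (VBundle.res h ξ) (VBundle.res h ν) = VBundle.res h (br' U ξ ν))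
    (top : br ⊤ = br' ⊤) : br = br' := by
  funext U
  refine LinearMap.ext fun ξ ↦ LinearMap.ext fun ν ↦ VBundle.section_ext fun z hz ↦ ?_
  have h1 := GlobalBracket.ext_spec ξ hz
  have h2 := GlobalBracket.ext_spec ν hz
  rw [← VBundle.bracket_congr_of_res br res (U := ⊤) trivial hz h1 h2,
    ← VBundle.bracket_congr_of_res br' res' (U := ⊤) trivial hz h1 h2, top]

end Global
end

/-!
The proof has a geometric part, on pullback and gluing of Lie algebroids, and a formal part, which
deduces the stack condition for an arbitrary base category of manifolds and submersions.

*Fibredness.* The pullback of a Lie algebroid `B` over `Y` along a submersion `f : X → Y` is the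
fibre product of `B` with the tangent bundle of `X` over that of `Y`, with the projection to the
tangent bundle as anchor (`LieAlgebroid.pullback`). Since `f` is a submersion, this is the kernel
of a family of surjective linear maps, hence a vector bundle. The bracket is the Lie bracket of
vector fields on the second component and is given on the first one by the formula of the
definition of morphisms. The Jacobiator is linear over the functions, so it suffices that it
vanishes on the sections which project to sections of `B`, and these generate all sections because
vector fields lift along submersions (`VBundle.jacobi_of_generators`). A morphism which identifies
each fibre of its domain with such a fibre product (`LieAlgebroid.Hom.IsCart`) is cartesian: a lift
exists fibrewise, and whether it respects brackets can be tested after the anchor and after the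
cartesian morphism (`LieAlgebroid.Hom.IsCart.existsUnique_lift`).

*Descent.* Over an étale map, cartesian morphisms are fibrewise bijective, and being a morphism of
Lie algebroids can be tested after composition with them (`LieAlgebroid.exists_hom_of_local`).
Hence morphisms glue. For objects, the fibre of the glued Lie algebroid at a point is the fibre of
one of the given Lie algebroids at a chosen point over it. Smoothness of sections, the anchor and
the bracket are local, so they are transferred from the given Lie algebroids (`GlueData.glue`).

*From descent data to gluing data.* Neither base category has all fibre products, so a descent
datum is not given by isomorphisms over double overlaps. It is used through its action on arrows:
an arrow to an object of the datum is transported to an arrow to another one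
(`FibredStack.transport`). For families of open immersions, arrows from pullbacks to small open
subsets detect single vectors, and the transport becomes a family of linear isomorphisms of fibres
with the cocycle condition (`LAOver.TransportData.glueData`). The base categories enter through two
properties: `LAOver.IsLocalBase` (fibre products with open immersions exist locally) and
`LAOver.HasOpenCovers` (covering sieves are those which contain a covering family of open
immersions). The étale topology has the second property since étale maps are open immersions
locally on their domain. It therefore has the same covering sieves as the open cover topology.
-/

universe w

/-! ### Vector fields along smooth maps -/

namespace Man

open Bundle

variable {X Y Z : Man.{u}}

instance (X : Man.{u}) : IsManifold (𝓡 X.dim) (minSmoothness ℝ 2) X := by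
  rw [minSmoothness_of_isRCLikeNormedField]; infer_instance

instance (X : Man.{u}) : IsManifold (𝓡 X.dim) (minSmoothness ℝ 3) X := by
  rw [minSmoothness_of_isRCLikeNormedField]; infer_instance

/-- Smoothness near `z` of a family `v` of tangent vectors of `X` along a map `g` to `X`. -/
def VecAt (g : Z → X) (v : ∀ z, TangentSpace (𝓡 X.dim) (g z)) (z : Z) : Prop :=
  ContMDiffAt (𝓡 Z.dim) (𝓡 X.dim).tangent ∞
    (fun z ↦ (⟨g z, v z⟩ : TangentBundle (𝓡 X.dim) X)) z

/-- The coordinates of tangent vectors at `x` in the trivialisation of the tangent bundle defined by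
the chart at `x₀`. -/
noncomputable def tc (x₀ x : X) : TangentSpace (𝓡 X.dim) x →L[ℝ] EuclideanSpace ℝ (Fin X.dim) :=
  (trivializationAt (EuclideanSpace ℝ (Fin X.dim)) (TangentSpace (𝓡 X.dim))
      x₀).continuousLinearMapAt
    ℝ x

/-- The inverse of `Man.tc`. -/
noncomputable def tcs (x₀ x : X) : EuclideanSpace ℝ (Fin X.dim) →L[ℝ] TangentSpace (𝓡 X.dim) x :=
  (trivializationAt (EuclideanSpace ℝ (Fin X.dim)) (TangentSpace (𝓡 X.dim)) x₀).symmL ℝ x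

/-- The domain of the trivialisation of the tangent bundle defined by the chart at `x₀`. -/
def tdom (x₀ : X) : Set X :=
  (trivializationAt (EuclideanSpace ℝ (Fin X.dim)) (TangentSpace (𝓡 X.dim)) x₀).baseSet

theorem isOpen_tdom (x₀ : X) : IsOpen (tdom x₀) := Trivialization.open_baseSet _

theorem mem_tdom (x₀ : X) : x₀ ∈ tdom x₀ := mem_baseSet_trivializationAt _ _ x₀

theorem tc_tcs {x₀ x : X} (hx : x ∈ tdom x₀) (v : EuclideanSpace ℝ (Fin X.dim)) :
    tc x₀ x (tcs x₀ x v) = v := Trivialization.continuousLinearMapAt_symmL _ hx v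

theorem tcs_tc {x₀ x : X} (hx : x ∈ tdom x₀) (v : TangentSpace (𝓡 X.dim) x) :
    tcs x₀ x (tc x₀ x v) = v := Trivialization.symmL_continuousLinearMapAt _ hx v

theorem vecAt_iff {g : Z → X} {v : ∀ z, TangentSpace (𝓡 X.dim) (g z)} {z : Z} {x₀ : X}
    (hz : g z ∈ tdom x₀) : VecAt g v z ↔ ContMDiffAt (𝓡 Z.dim) (𝓡 X.dim) ∞ g z ∧
      SmoothAt (fun z ↦ tc x₀ (g z) (v z)) z := by
  unfold VecAt
  have hz' : (⟨g z, v z⟩ : TangentBundle (𝓡 X.dim) X) ∈ (trivializationAt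
      (EuclideanSpace ℝ (Fin X.dim)) (TangentSpace (𝓡 X.dim)) x₀).source :=
    (Trivialization.mem_source _).2 hz
  rw [Trivialization.contMDiffAt_iff (e := trivializationAt (EuclideanSpace ℝ (Fin X.dim))
    (TangentSpace (𝓡 X.dim)) x₀) (f := fun z ↦ (⟨g z, v z⟩ : TangentBundle (𝓡 X.dim) X)) hz']
  refine and_congr_right fun hg ↦ Filter.EventuallyEq.contMDiffAt_iff ?_
  filter_upwards [hg.continuousAt.preimage_mem_nhds ((isOpen_tdom x₀).mem_nhds hz)] with y hy
  exact (Trivialization.continuousLinearMapAt_apply_of_mem (R := ℝ) _ hy _).symm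

theorem VecAt.smoothAt_base {g : Z → X} {v : ∀ z, TangentSpace (𝓡 X.dim) (g z)} {z : Z}
    (h : VecAt g v z) : ContMDiffAt (𝓡 Z.dim) (𝓡 X.dim) ∞ g z :=
  ((vecAt_iff (mem_tdom (g z))).1 h).1

theorem VecAt.congr {g : Z → X} {v w : ∀ z, TangentSpace (𝓡 X.dim) (g z)} {z : Z}
    (h : VecAt g v z) (hvw : ∀ᶠ y in 𝓝 z, w y = v y) : VecAt g w z :=
  ContMDiffAt.congr_of_eventuallyEq h (hvw.mono fun y hy ↦ by
    change (⟨g y, w y⟩ : TangentBundle (𝓡 X.dim) X) = ⟨g y, v y⟩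
    rw [hy])

theorem VecAt.add {g : Z → X} {v w : ∀ z, TangentSpace (𝓡 X.dim) (g z)} {z : Z}
    (hv : VecAt g v z) (hw : VecAt g w z) : VecAt g (fun z ↦ v z + w z) z := by
  rw [vecAt_iff (mem_tdom (g z))] at *
  refine ⟨hv.1, (hv.2.add hw.2).congr_of_eventuallyEq (.of_forall fun y ↦ ?_)⟩
  exact map_add (tc (g z) (g y)) _ _

theorem VecAt.sub {g : Z → X} {v w : ∀ z, TangentSpace (𝓡 X.dim) (g z)} {z : Z}
    (hv : VecAt g v z) (hw : VecAt g w z) : VecAt g (fun z ↦ v z - w z) z := by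
  rw [vecAt_iff (mem_tdom (g z))] at *
  refine ⟨hv.1, (hv.2.sub hw.2).congr_of_eventuallyEq (.of_forall fun y ↦ ?_)⟩
  exact map_sub (tc (g z) (g y)) _ _

theorem VecAt.smul {g : Z → X} {v : ∀ z, TangentSpace (𝓡 X.dim) (g z)} {z : Z} {c : Z → ℝ}
    (hc : SmoothAt c z) (hv : VecAt g v z) : VecAt g (fun z ↦ c z • v z) z := by
  rw [vecAt_iff (mem_tdom (g z))] at *
  refine ⟨hv.1, (hc.smul hv.2).congr_of_eventuallyEq (.of_forall fun y ↦ ?_)⟩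
  exact map_smul (tc (g z) (g y)) _ _

theorem vecAt_zero {g : Z → X} {z : Z} (hg : ContMDiffAt (𝓡 Z.dim) (𝓡 X.dim) ∞ g z) :
    VecAt g (fun _ ↦ 0) z := by
  rw [vecAt_iff (mem_tdom (g z))]
  refine ⟨hg, (contMDiffAt_const (c := 0)).congr_of_eventuallyEq (.of_forall fun y ↦ ?_)⟩
  exact map_zero (tc (g z) (g y))

theorem VecAt.sum {ι : Type*} (s : Finset ι) {g : Z → X}
    {v : ι → ∀ z, TangentSpace (𝓡 X.dim) (g z)} {z : Z}
    (hg : ContMDiffAt (𝓡 Z.dim) (𝓡 X.dim) ∞ g z) (hv : ∀ i ∈ s, VecAt g (v i) z) :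
    VecAt g (fun z ↦ ∑ i ∈ s, v i z) z := by
  classical
  induction s using Finset.induction_on with
  | empty => simpa using vecAt_zero hg
  | insert i s hi ih =>
    simp only [Finset.sum_insert hi]
    exact (hv i (Finset.mem_insert_self i s)).add
      (ih fun j hj ↦ hv j (Finset.mem_insert_of_mem hj))

theorem VecAt.comp_hom {v : ∀ x, TangentSpace (𝓡 Y.dim) x} (f : X ⟶ Y) {x : X}
    (h : VecAt (fun y : Y ↦ y) v (f x)) : VecAt (fun x ↦ f x) (fun x ↦ v (f x)) x :=
  ContMDiffAt.comp x h (f.contMDiff x)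

theorem VecAt.comp {g : Z → X} {v : ∀ z, TangentSpace (𝓡 X.dim) (g z)} {W : Man.{u}} {k : W → Z}
    {w : W} (h : VecAt g v (k w)) (hk : ContMDiffAt (𝓡 W.dim) (𝓡 Z.dim) ∞ k w) :
    VecAt (fun w ↦ g (k w)) (fun w ↦ v (k w)) w :=
  ContMDiffAt.comp w h hk

theorem VecAt.dMap {g : Z → X} {v : ∀ z, TangentSpace (𝓡 X.dim) (g z)} {z : Z}
    (h : VecAt g v z) (f : X ⟶ Y) : VecAt (fun z ↦ f (g z)) (fun z ↦ dMap f (g z) (v z)) z :=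
  ContMDiffAt.comp (I' := (𝓡 X.dim).tangent) (g := tangentMap (𝓡 X.dim) (𝓡 Y.dim) f)
    (f := fun z ↦ (⟨g z, v z⟩ : TangentBundle (𝓡 X.dim) X)) z
    ((f.contMDiff.contMDiff_tangentMap (m := ∞) le_rfl) ⟨g z, v z⟩) h

theorem VecAt.smoothAt_dirDeriv {g : Z → X} {v : ∀ z, TangentSpace (𝓡 X.dim) (g z)} {z : Z}
    (hv : VecAt g v z) {h : X → ℝ} (hh : X.SmoothAt h (g z)) :
    SmoothAt (fun z ↦ X.dirDeriv h (g z) (v z)) z := by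
  obtain ⟨hg, hv⟩ := (vecAt_iff (mem_tdom (g z))).1 hv
  have key := ContMDiffAt.mfderiv_apply (m := ∞) (fun _ : X ↦ h) id g
    (fun z' ↦ tc (g z) (g z') (v z')) (n := ∞) (x₀ := z)
    (by exact ContMDiffAt.comp (g z, g z) hh contMDiffAt_snd) contMDiffAt_id hg hv le_rfl
  refine key.congr_of_eventuallyEq ?_
  filter_upwards [hg.continuousAt.preimage_mem_nhds ((isOpen_tdom (g z)).mem_nhds (mem_tdom (g z)))]
    with y hy
  refine (congrArg (X.dirDeriv h (g y)) (tcs_tc hy (v y)).symm).trans ?_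
  have e2 := TangentBundle.continuousLinearMapAt_model_space (𝕜 := ℝ) (h (g z)) (h (g y))
  exact (congrArg (fun L : ℝ →L[ℝ] ℝ ↦ L (X.dirDeriv h (g y) (tcs (g z) (g y)
    (tc (g z) (g y) (v y))))) e2).symm

/-! ### The Lie bracket of vector fields -/

open VectorField

theorem mlieBracket_smul {v w : ∀ x, TangentSpace (𝓡 X.dim) x} {h : X → ℝ} {x : X}
    (hh : MDifferentiableAt (𝓡 X.dim) 𝓘(ℝ, ℝ) h x)
    (hw : MDifferentiableAt (𝓡 X.dim) (𝓡 X.dim).tangent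
      (fun y ↦ (⟨y, w y⟩ : TangentBundle (𝓡 X.dim) X)) x) :
    mlieBracket (𝓡 X.dim) v (fun y ↦ h y • w y) x =
      X.dirDeriv h x (v x) • w x + h x • mlieBracket (𝓡 X.dim) v w x :=
  mlieBracket_smul_right hh hw

theorem VecAt.mdiff {g : Z → X} {v : ∀ z, TangentSpace (𝓡 X.dim) (g z)} {z : Z}
    (hv : VecAt g v z) : MDifferentiableAt (𝓡 Z.dim) (𝓡 X.dim).tangent
      (fun y ↦ (⟨g y, v y⟩ : TangentBundle (𝓡 X.dim) X)) z :=
  ContMDiffAt.mdifferentiableAt hv (by simp)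

theorem VecAt.eventually_mdiff {g : Z → X} {v : ∀ z, TangentSpace (𝓡 X.dim) (g z)} {z : Z}
    (hv : VecAt g v z) : ∀ᶠ z in 𝓝 z, MDifferentiableAt (𝓡 Z.dim) (𝓡 X.dim).tangent
      (fun y ↦ (⟨g y, v y⟩ : TangentBundle (𝓡 X.dim) X)) z := by
  have h1 := (contMDiffAt_iff_contMDiffAt_nhds (by simp)).1
    (ContMDiffAt.of_le hv (n := ∞) (m := 1) (by exact_mod_cast le_top))
  exact h1.mono fun y hy ↦ hy.mdifferentiableAt (by simp)

theorem SmoothAt.eventually_mdiff {V : Type*} [NormedAddCommGroup V] [NormedSpace ℝ V]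
    {h : X → V} {x : X} (hh : SmoothAt h x) :
    ∀ᶠ y in 𝓝 x, MDifferentiableAt (𝓡 X.dim) 𝓘(ℝ, V) h y := by
  have h1 := (contMDiffAt_iff_contMDiffAt_nhds (by simp)).1
    (ContMDiffAt.of_le hh (n := ∞) (m := 1) (by exact_mod_cast le_top))
  exact h1.mono fun y hy ↦ hy.mdifferentiableAt (by simp)

theorem VecAt.mlieBracket {v w : ∀ x, TangentSpace (𝓡 X.dim) x} {x : X}
    (hv : VecAt (fun y : X ↦ y) v x) (hw : VecAt (fun y : X ↦ y) w x) :
    VecAt (fun y : X ↦ y) (mlieBracket (𝓡 X.dim) v w) x :=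
  haveI : IsManifold (𝓡 X.dim) ((⊤ : ℕ∞) + 1) X := (inferInstance : IsManifold (𝓡 X.dim) ∞ X)
  ContMDiffAt.mlieBracket_vectorField (n := ⊤) (m := ⊤) hv hw (by
    rw [minSmoothness_of_isRCLikeNormedField]; exact le_rfl)

theorem mlieBracket_jacobi {u v w : ∀ x, TangentSpace (𝓡 X.dim) x} {x : X}
    (hu : VecAt (fun y : X ↦ y) u x) (hv : VecAt (fun y : X ↦ y) v x)
    (hw : VecAt (fun y : X ↦ y) w x) :
    VectorField.mlieBracket (𝓡 X.dim) u (VectorField.mlieBracket (𝓡 X.dim) v w) x =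
      VectorField.mlieBracket (𝓡 X.dim) (VectorField.mlieBracket (𝓡 X.dim) u v) w x +
        VectorField.mlieBracket (𝓡 X.dim) v (VectorField.mlieBracket (𝓡 X.dim) u w) x := by
  have h2 : minSmoothness ℝ 2 ≤ ∞ := by
    rw [minSmoothness_of_isRCLikeNormedField]; exact ENat.LEInfty.out
  exact leibniz_identity_mlieBracket_apply (ContMDiffAt.of_le hu h2) (ContMDiffAt.of_le hv h2)
    (ContMDiffAt.of_le hw h2)

/-- Smooth vector fields near a point take arbitrary values at this point. -/
theorem exists_vecAt (x : X) (u₀ : TangentSpace (𝓡 X.dim) x) :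
    ∃ u : ∀ y, TangentSpace (𝓡 X.dim) y, VecAt (fun y : X ↦ y) u x ∧ u x = u₀ := by
  refine ⟨fun y ↦ tcs x y (tc x x u₀), (vecAt_iff (mem_tdom x)).2 ⟨contMDiffAt_id, ?_⟩,
    tcs_tc (mem_tdom x) u₀⟩
  refine (contMDiffAt_const (c := tc x x u₀)).congr_of_eventuallyEq ?_
  filter_upwards [(isOpen_tdom x).mem_nhds (mem_tdom x)] with y hy
  exact tc_tcs hy _

/-- The Lie bracket of vector fields is the commutator of the derivations which they define. This
follows from the Jacobi identity for `v`, `w` and the multiples `h • u` of a third field `u`. -/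
theorem dirDeriv_mlieBracket {v w : ∀ x, TangentSpace (𝓡 X.dim) x} {x : X} {h : X → ℝ}
    (hv : VecAt (fun y : X ↦ y) v x) (hw : VecAt (fun y : X ↦ y) w x) (hh : X.SmoothAt h x) :
    X.dirDeriv h x (mlieBracket (𝓡 X.dim) v w x) =
      X.dirDeriv (fun y ↦ X.dirDeriv h y (w y)) x (v x) -
        X.dirDeriv (fun y ↦ X.dirDeriv h y (v y)) x (w x) := by
  -- A field `u` with `u x ≠ 0` is needed to conclude; there is none if the dimension is zero.
  by_cases h0 : ∀ u₀ : TangentSpace (𝓡 X.dim) x, u₀ = 0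
  · rw [h0 (mlieBracket (𝓡 X.dim) v w x), h0 (v x), h0 (w x)]
    simp only [map_zero, sub_zero]
  push Not at h0
  obtain ⟨u₀, hu₀⟩ := h0
  obtain ⟨u, hu, hux⟩ := exists_vecAt x u₀
  have key : ∀ {v w : ∀ x, TangentSpace (𝓡 X.dim) x}, VecAt (fun y : X ↦ y) v x →
      VecAt (fun y : X ↦ y) w x → mlieBracket (𝓡 X.dim) v (mlieBracket (𝓡 X.dim) w
        (fun y ↦ h y • u y)) x = X.dirDeriv (fun y ↦ X.dirDeriv h y (w y)) x (v x) • u x +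
        X.dirDeriv h x (w x) • mlieBracket (𝓡 X.dim) v u x +
        (X.dirDeriv h x (v x) • mlieBracket (𝓡 X.dim) w u x +
          h x • mlieBracket (𝓡 X.dim) v (mlieBracket (𝓡 X.dim) w u) x) := by
    intro v w hv hw
    have e1 : ∀ᶠ y in 𝓝 x, mlieBracket (𝓡 X.dim) w (fun y ↦ h y • u y) y =
        X.dirDeriv h y (w y) • u y + h y • mlieBracket (𝓡 X.dim) w u y := by
      filter_upwards [hh.eventually_mdiff, hu.eventually_mdiff] with y h1 h2
      exact mlieBracket_smul h1 h2
    have e2 := hw.smoothAt_dirDeriv hh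
    rw [Filter.EventuallyEq.mlieBracket_vectorField_eq (Filter.EventuallyEq.refl _ v) e1]
    have e3 := mlieBracket_add_right (V := v) (hu.smul e2).mdiff ((hw.mlieBracket hu).smul hh).mdiff
    refine e3.trans ?_
    rw [mlieBracket_smul e2.mdiff hu.mdiff, mlieBracket_smul hh.mdiff (hw.mlieBracket hu).mdiff]
  have hJ := mlieBracket_jacobi hv hw (hu.smul hh)
  have hJ' := mlieBracket_jacobi hv hw hu
  rw [key hv hw, key hw hv, mlieBracket_smul hh.mdiff hu.mdiff, hJ'] at hJ
  have h1 : (X.dirDeriv (fun y ↦ X.dirDeriv h y (w y)) x (v x) -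
        X.dirDeriv (fun y ↦ X.dirDeriv h y (v y)) x (w x) -
        X.dirDeriv h x (mlieBracket (𝓡 X.dim) v w x)) • u₀ = 0 := by
    rw [← hux, sub_smul, sub_smul]
    rw [← sub_eq_zero] at hJ
    refine Eq.trans ?_ hJ
    rw [smul_add]
    abel
  rcases smul_eq_zero.1 h1 with h1 | h1
  · exact (sub_eq_zero.1 h1).symm
  · exact absurd h1 hu₀

/-- Tangent vectors are determined by the derivatives of functions in their directions. -/
theorem tangent_ext {x : X} {u w : TangentSpace (𝓡 X.dim) x}
    (h : ∀ g : X → ℝ, X.SmoothAt g x → X.dirDeriv g x u = X.dirDeriv g x w) : u = w := by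
  have hs : SmoothAt (extChartAt (𝓡 X.dim) x) x := contMDiffAt_extChartAt
  obtain ⟨L, hL⟩ := isInvertible_mfderiv_extChartAt (I := 𝓡 X.dim)
    (mem_extChartAt_source (I := 𝓡 X.dim) x)
  refine L.injective (PiLp.ext fun k ↦ ?_)
  have hk : X.SmoothAt (fun y ↦ EuclideanSpace.proj (𝕜 := ℝ) k (extChartAt (𝓡 X.dim) x y)) x :=
    (EuclideanSpace.proj (𝕜 := ℝ) k : EuclideanSpace ℝ (Fin X.dim) →L[ℝ]
        ℝ).contMDiff.contMDiffAt.comp x hs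
  have e : ∀ z : TangentSpace (𝓡 X.dim) x, X.dirDeriv (fun y ↦ EuclideanSpace.proj (𝕜 := ℝ) k
      (extChartAt (𝓡 X.dim) x y)) x z = EuclideanSpace.proj (𝕜 := ℝ) k (L z) := by
    intro z
    have h1 := mfderiv_comp x ((EuclideanSpace.proj (𝕜 := ℝ) k :
      EuclideanSpace ℝ (Fin X.dim) →L[ℝ] ℝ).mdifferentiableAt (x := extChartAt (𝓡 X.dim) x x))
          hs.mdiff
    rw [ContinuousLinearMap.mfderiv_eq, ← hL] at h1
    exact congrArg (fun L : TangentSpace (𝓡 X.dim) x →L[ℝ] ℝ ↦ L z) h1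
  have h2 := h _ hk
  rw [e, e] at h2
  exact h2

theorem dirDeriv_comp_of_mdiff (f : X ⟶ Y) {h : Y → ℝ} {x : X}
    (hh : MDifferentiableAt (𝓡 Y.dim) 𝓘(ℝ, ℝ) h (f x)) (v : TangentSpace (𝓡 X.dim) x) :
    X.dirDeriv (fun y ↦ h (f y)) x v = Y.dirDeriv h (f x) (dMap f x v) := by
  have := mfderiv_comp x hh (mdifferentiableAt f x)
  exact congrArg (fun L : TangentSpace (𝓡 X.dim) x →L[ℝ] ℝ ↦ L v) this

/-- The derivative of a smooth map is compatible with Lie brackets, for vector fields on the source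
whose images decompose as combinations of vector fields on the target. -/
theorem dMap_mlieBracket {ι κ : Type} [Fintype ι] [Fintype κ] (f : X ⟶ Y) {x : X}
    {v w : ∀ x, TangentSpace (𝓡 X.dim) x}
    (hv : VecAt (fun y : X ↦ y) v x) (hw : VecAt (fun y : X ↦ y) w x)
    {a : ι → ∀ y, TangentSpace (𝓡 Y.dim) y} {b : κ → ∀ y, TangentSpace (𝓡 Y.dim) y}
    (ha : ∀ i, VecAt (fun y : Y ↦ y) (a i) (f x)) (hb : ∀ j, VecAt (fun y : Y ↦ y) (b j) (f x))
    {G : ι → X → ℝ} {H : κ → X → ℝ} (hG : ∀ i, X.SmoothAt (G i) x) (hH : ∀ j, X.SmoothAt (H j) x)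
    (hva : ∀ᶠ z in 𝓝 x, dMap f z (v z) = ∑ i, G i z • a i (f z))
    (hwb : ∀ᶠ z in 𝓝 x, dMap f z (w z) = ∑ j, H j z • b j (f z)) :
    dMap f x (mlieBracket (𝓡 X.dim) v w x) =
      ∑ i, ∑ j, (G i x * H j x) • mlieBracket (𝓡 Y.dim) (a i) (b j) (f x) +
        ∑ j, X.dirDeriv (H j) x (v x) • b j (f x) - ∑ i, X.dirDeriv (G i) x (w x) • a i (f x) := by
  refine tangent_ext fun h hh ↦ ?_
  have hhf : X.SmoothAt (fun z ↦ h (f z)) x := hh.comp_hom f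
  have e : ∀ {κ : Type} [Fintype κ] {w : ∀ x, TangentSpace (𝓡 X.dim) x}
      {b : κ → ∀ y, TangentSpace (𝓡 Y.dim) y} {H : κ → X → ℝ}
      (_ : ∀ᶠ z in 𝓝 x, dMap f z (w z) = ∑ j, H j z • b j (f z)),
      (fun z ↦ X.dirDeriv (fun z ↦ h (f z)) z (w z)) =ᶠ[𝓝 x]
        fun z ↦ ∑ j, H j z * Y.dirDeriv h (f z) (b j (f z)) := by
    intro κ _ w b H hwb
    filter_upwards [hwb, (f.contMDiff.continuous.tendsto x).eventually hh.eventually_mdiff]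
      with z h1 h2
    rw [dirDeriv_comp_of_mdiff f h2, h1, map_sum]
    simp only [map_smul, smul_eq_mul]
  have d : ∀ {κ : Type} [Fintype κ] {b : κ → ∀ y, TangentSpace (𝓡 Y.dim) y} {H : κ → X → ℝ}
      (_ : ∀ j, VecAt (fun y : Y ↦ y) (b j) (f x)) (_ : ∀ j, X.SmoothAt (H j) x)
      (u : TangentSpace (𝓡 X.dim) x),
      X.dirDeriv (fun z ↦ ∑ j, H j z * Y.dirDeriv h (f z) (b j (f z))) x u =
        ∑ j, (H j x * Y.dirDeriv (fun y ↦ Y.dirDeriv h y (b j y)) (f x) (dMap f x u) +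
          Y.dirDeriv h (f x) (b j (f x)) * X.dirDeriv (H j) x u) := by
    intro κ _ b H hb hH u
    have hs : ∀ j, Y.SmoothAt (fun y ↦ Y.dirDeriv h y (b j y)) (f x) :=
      fun j ↦ (hb j).smoothAt_dirDeriv hh
    rw [dirDeriv_sum _ fun j _ ↦ smoothAt_mul (hH j) ((hs j).comp_hom f)]
    refine Finset.sum_congr rfl fun j _ ↦ ?_
    rw [dirDeriv_mul (hH j) ((hs j).comp_hom f), dirDeriv_comp f (hs j)]
  rw [← dirDeriv_comp f hh, dirDeriv_mlieBracket hv hw hhf, dirDeriv_congr (e hwb),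
    dirDeriv_congr (e hva), d hb hH, d ha hG, hva.self_of_nhds, hwb.self_of_nhds]
  simp only [map_sub, map_add, map_sum, map_smul, smul_eq_mul,
    fun i j ↦ dirDeriv_mlieBracket (ha i) (hb j) hh]
  simp only [mul_sub, Finset.sum_sub_distrib, Finset.mul_sum, Finset.sum_add_distrib, ← mul_assoc]
  rw [Finset.sum_comm (s := Finset.univ (α := κ))]
  simp only [mul_comm (H _ x) (G _ x), mul_comm (Y.dirDeriv h (f x) _)]
  abel

end Man

/-! ### Smooth families of linear maps -/

namespace Man

variable {X Y Z : Man.{u}}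

theorem SmoothAt.clm_apply {V W : Type*} [NormedAddCommGroup V] [NormedSpace ℝ V]
    [NormedAddCommGroup W] [NormedSpace ℝ W] {F : Z → V →L[ℝ] W} {s : Z → V} {z : Z}
    (hF : SmoothAt F z) (hs : SmoothAt s z) : SmoothAt (fun y ↦ F y (s y)) z :=
  ContMDiffAt.clm_apply hF hs

section

variable {V W : Type*} [NormedAddCommGroup V] [NormedSpace ℝ V] [FiniteDimensional ℝ V]
  [NormedAddCommGroup W] [NormedSpace ℝ W]

/-- A family of linear maps between fixed vector spaces is smooth if its values on fixed vectors
are. -/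
theorem smoothAt_clm {F : Z → V →L[ℝ] W} {z : Z} (h : ∀ v, SmoothAt (fun y ↦ F y v) z) :
    SmoothAt F z := by
  let b := Module.finBasis ℝ V
  have e : F = fun y ↦ ∑ k, ContinuousLinearMap.smulRightL ℝ V W
      (LinearMap.toContinuousLinearMap (b.coord k)) (F y (b k)) := by
    funext y
    ext v
    conv_lhs => rw [← b.sum_repr v, map_sum]
    simp
  rw [e]
  refine ContMDiffAt.sum fun k _ ↦ ?_
  exact (ContinuousLinearMap.smulRightL ℝ V W
    (LinearMap.toContinuousLinearMap (b.coord k))).contMDiff.contMDiffAt.comp z (h (b k))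

theorem SmoothAt.ringInverse {F : Z → V →L[ℝ] V} {z : Z} (hF : SmoothAt F z)
    (h : IsUnit (F z)) : SmoothAt (fun y ↦ Ring.inverse (F y)) z := by
  have : CompleteSpace V := FiniteDimensional.complete ℝ V
  obtain ⟨L, hL⟩ := h
  have h1 : ContDiffAt ℝ ∞ (Ring.inverse : (V →L[ℝ] V) → V →L[ℝ] V) (F z) := by
    rw [← hL]; exact contDiffAt_ringInverse ℝ L
  exact h1.contMDiffAt.comp z hF

/-- Injective linear maps depending smoothly on a point reflect smoothness: locally they have left
inverses depending smoothly on the point. -/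
theorem SmoothAt.of_clm_apply [FiniteDimensional ℝ W] {F : Z → V →L[ℝ] W} {s : Z → V} {z : Z}
    (hF : SmoothAt F z) (hi : Function.Injective (F z)) (h : SmoothAt (fun y ↦ F y (s y)) z) :
    SmoothAt s z := by
  have : CompleteSpace V := FiniteDimensional.complete ℝ V
  obtain ⟨S', hS'⟩ := LinearMap.exists_leftInverse_of_injective (F z : V →ₗ[ℝ] W)
    (LinearMap.ker_eq_bot.2 hi)
  let S : W →L[ℝ] V := LinearMap.toContinuousLinearMap S'
  have hS : S.comp (F z) = 1 := ContinuousLinearMap.ext fun v ↦ LinearMap.congr_fun hS' v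
  have h1 : SmoothAt (fun y ↦ S.comp (F y)) z := smoothAt_clm fun v ↦
    S.contMDiff.contMDiffAt.comp z (hF.clm_apply (contMDiffAt_const (c := v)))
  have h2 : IsUnit (S.comp (F z)) := hS ▸ isUnit_one
  have h3 : ∀ᶠ y in 𝓝 z, IsUnit (S.comp (F y)) :=
    h1.continuousAt.eventually (Units.isOpen.mem_nhds h2)
  have h4 : SmoothAt (fun y ↦ Ring.inverse (S.comp (F y)) (S (F y (s y)))) z :=
    (h1.ringInverse h2).clm_apply (S.contMDiff.contMDiffAt.comp z h)
  refine h4.congr_of_eventuallyEq ?_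
  filter_upwards [h3] with y hy
  exact (congrArg (fun L : V →L[ℝ] V ↦ L (s y)) (Ring.inverse_mul_cancel _ hy)).symm

end

end Man

/-! ### Sections along smooth maps -/

namespace VBundle

variable {X Y Z : Man.{u}} (E : VBundle X)

/-- Smoothness near `z` of a section `a` of `E` along a map `g` to `X`. -/
def SecAt (g : Z → X) (a : ∀ z, E.Fiber (g z)) (z : Z) : Prop :=
  ContMDiffAt (𝓡 Z.dim) (𝓡 X.dim) ∞ g z ∧
    ∀ e ∈ E.atlas, g z ∈ e.baseSet → Man.SmoothAt (fun y ↦ e.coord (g y) (a y)) z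

variable {E}

theorem SecAt.of_mem {g : Z → X} {a : ∀ z, E.Fiber (g z)} {z : Z}
    (hg : ContMDiffAt (𝓡 Z.dim) (𝓡 X.dim) ∞ g z) {e : LocalTriv X E.Fiber} (he : e ∈ E.atlas)
    (hz : g z ∈ e.baseSet) (h : Man.SmoothAt (fun y ↦ e.coord (g y) (a y)) z) : E.SecAt g a z := by
  refine ⟨hg, fun e' he' hz' ↦ ?_⟩
  have h1 : Man.SmoothAt (fun y ↦ ∑ k, e.coord (g y) (a y) k •
      e'.coord (g y) (e.symm (g y) (Pi.single k 1))) z := by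
    refine ContMDiffAt.sum fun k _ ↦ ContMDiffAt.smul (contMDiffAt_pi_space.1 h k) ?_
    exact ((E.smooth_transition e he e' he' (Pi.single k 1)).contMDiffAt
      ((e.isOpen_baseSet.inter e'.isOpen_baseSet).mem_nhds ⟨hz, hz'⟩)).comp z hg
  refine h1.congr_of_eventuallyEq ?_
  filter_upwards [hg.continuousAt.preimage_mem_nhds (e.isOpen_baseSet.mem_nhds hz)] with y hy
  conv_lhs => rw [← e.symm_coord _ hy (a y), symm_eq_sum, map_sum]
  simp only [map_smul]

theorem SecAt.congr {g : Z → X} {a b : ∀ z, E.Fiber (g z)} {z : Z} (h : E.SecAt g a z)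
    (hab : ∀ᶠ y in 𝓝 z, b y = a y) : E.SecAt g b z :=
  ⟨h.1, fun e he hz ↦ (h.2 e he hz).congr_of_eventuallyEq (hab.mono fun y hy ↦ by
    change e.coord (g y) (b y) = e.coord (g y) (a y)
    rw [hy])⟩

theorem SecAt.add {g : Z → X} {a b : ∀ z, E.Fiber (g z)} {z : Z} (ha : E.SecAt g a z)
    (hb : E.SecAt g b z) : E.SecAt g (fun y ↦ a y + b y) z :=
  ⟨ha.1, fun e he hz ↦ ((ha.2 e he hz).add (hb.2 e he hz)).congr_of_eventuallyEq
    (.of_forall fun y ↦ map_add (e.coord (g y)) _ _)⟩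

theorem SecAt.smul {g : Z → X} {a : ∀ z, E.Fiber (g z)} {z : Z} {c : Z → ℝ}
    (hc : Man.SmoothAt c z) (ha : E.SecAt g a z) : E.SecAt g (fun y ↦ c y • a y) z :=
  ⟨ha.1, fun e he hz ↦ (hc.smul (ha.2 e he hz)).congr_of_eventuallyEq
    (.of_forall fun y ↦ map_smul (e.coord (g y)) _ _)⟩

theorem secAt_zero {g : Z → X} {z : Z} (hg : ContMDiffAt (𝓡 Z.dim) (𝓡 X.dim) ∞ g z) :
    E.SecAt g (fun _ ↦ 0) z :=
  ⟨hg, fun e _ _ ↦ (contMDiffAt_const (c := 0)).congr_of_eventuallyEq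
    (.of_forall fun y ↦ map_zero (e.coord (g y)))⟩

theorem SecAt.sum {ι : Type*} (s : Finset ι) {g : Z → X} {a : ι → ∀ z, E.Fiber (g z)} {z : Z}
    (hg : ContMDiffAt (𝓡 Z.dim) (𝓡 X.dim) ∞ g z) (ha : ∀ i ∈ s, E.SecAt g (a i) z) :
    E.SecAt g (fun y ↦ ∑ i ∈ s, a i y) z := by
  classical
  induction s using Finset.induction_on with
  | empty => simpa using secAt_zero hg
  | insert i s hi ih =>
    simp only [Finset.sum_insert hi]
    exact (ha i (Finset.mem_insert_self i s)).add
      (ih fun j hj ↦ ha j (Finset.mem_insert_of_mem hj))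

theorem SecAt.comp {g : Z → X} {a : ∀ z, E.Fiber (g z)} {W : Man.{u}} {k : W → Z} {w : W}
    (h : E.SecAt g a (k w)) (hk : ContMDiffAt (𝓡 W.dim) (𝓡 Z.dim) ∞ k w) :
    E.SecAt (fun w ↦ g (k w)) (fun w ↦ a (k w)) w :=
  ⟨h.1.comp w hk, fun e he hz ↦ (h.2 e he hz).comp w hk⟩

theorem secAt_of_mem_Γ {U : TopologicalSpace.Opens X} (σ : E.Γ U) {x : X} (hx : x ∈ U) :
    E.SecAt (fun y : X ↦ y) (fun y ↦ σ y) x :=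
  ⟨contMDiffAt_id, fun e he hz ↦ σ.2.1 e he x hx hz⟩

theorem secAt_symm {e : LocalTriv X E.Fiber} (he : e ∈ E.atlas) {x : X} (hx : x ∈ e.baseSet)
    (v : Fin e.rank → ℝ) : E.SecAt (fun y : X ↦ y) (fun y ↦ e.symm y v) x :=
  .of_mem contMDiffAt_id he hx ((contMDiffAt_const (c := v)).congr_of_eventuallyEq (by
    filter_upwards [e.isOpen_baseSet.mem_nhds hx] with y hy using e.coord_symm y hy v))

end VBundle

/-- Let `φ x` and `ρ x` be jointly injective linear maps on the fibres of a family with local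
trivialisation `e`, which are smooth on the frame of `e`. Then the coordinates of a section of the
family are smooth if its images by `φ` and `ρ` are. -/
theorem LocalTriv.smoothAt_coord {X Y Z : Man.{u}} {F : X → Type u} [∀ x, AddCommGroup (F x)]
    [∀ x, Module ℝ (F x)] (e : LocalTriv X F) {B : VBundle Y} {f : X ⟶ Y}
    (φ : ∀ x, F x →ₗ[ℝ] B.Fiber (f x)) (ρ : ∀ x, F x →ₗ[ℝ] TangentSpace (𝓡 X.dim) x)
    {g : Z → X} {a : ∀ z, F (g z)} {z : Z} (hz : g z ∈ e.baseSet)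
    (inj : ∀ a : F (g z), φ (g z) a = 0 → ρ (g z) a = 0 → a = 0)
    (hφ : ∀ v, B.SecAt (fun y ↦ f y) (fun y ↦ φ y (e.symm y v)) (g z))
    (hρ : ∀ v, Man.VecAt (fun y : X ↦ y) (fun y ↦ ρ y (e.symm y v)) (g z))
    (h : B.SecAt (fun y ↦ f (g y)) (fun y ↦ φ (g y) (a y)) z)
    (h' : Man.VecAt g (fun y ↦ ρ (g y) (a y)) z) :
    Man.SmoothAt (fun y ↦ e.coord (g y) (a y)) z := by
  have hg := h'.smoothAt_base
  obtain ⟨e', he', hz'⟩ := B.exists_mem_baseSet (f (g z))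
  -- `M y` is the pair `(φ, ρ)` on the fibre at `g y`, in local coordinates.
  let M : Z → (Fin e.rank → ℝ) →L[ℝ] (Fin e'.rank → ℝ) × EuclideanSpace ℝ (Fin X.dim) := fun y ↦
    LinearMap.toContinuousLinearMap (((e'.coord (f (g y))).comp ((φ (g y)).comp
      (e.symm (g y)))).prod ((Man.tc (g z) (g y)).toLinearMap.comp
        ((ρ (g y)).comp (e.symm (g y)))))
  have hM : Man.SmoothAt M z := Man.smoothAt_clm fun v ↦
    (((hφ v).comp hg).2 e' he' hz').prodMk_space
      ((Man.vecAt_iff (Man.mem_tdom (g z))).1 ((hρ v).comp hg)).2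
  refine hM.of_clm_apply ((injective_iff_map_eq_zero (M z)).2 fun v hv ↦ ?_) ?_
  · have h1 : e'.coord (f (g z)) (φ (g z) (e.symm (g z) v)) = 0 := congrArg Prod.fst hv
    have h2 : Man.tc (g z) (g z) (ρ (g z) (e.symm (g z) v)) = 0 := congrArg Prod.snd hv
    have h3 := inj _
      (by rw [← e'.symm_coord _ hz' (φ (g z) (e.symm (g z) v)), h1, map_zero])
      (by rw [← Man.tcs_tc (Man.mem_tdom (g z)) (ρ (g z) (e.symm (g z) v)), h2, map_zero])
    rw [← e.coord_symm _ hz v, h3, map_zero]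
  · refine ((h.2 e' he' hz').prodMk_space
      ((Man.vecAt_iff (Man.mem_tdom (g z))).1 h').2).congr_of_eventuallyEq ?_
    filter_upwards [hg.continuousAt.preimage_mem_nhds (e.isOpen_baseSet.mem_nhds hz)] with y hy
    have h1 : e.symm (g y) (e.coord (g y) (a y)) = a y := e.symm_coord _ hy _
    exact Prod.ext (congrArg (fun a ↦ e'.coord (f (g y)) (φ (g y) a)) h1)
      (congrArg (fun a ↦ Man.tc (g z) (g y) (ρ (g y) a)) h1)

namespace LieAlgebroid

variable {X Y Z : Man.{u}} {A : LieAlgebroid X} {B : LieAlgebroid Y}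

theorem vecAt_anchor_symm (A : LieAlgebroid X) {e : LocalTriv X A.Fiber} (he : e ∈ A.atlas) {x : X}
    (hx : x ∈ e.baseSet) (v : Fin e.rank → ℝ) :
    Man.VecAt (fun y : X ↦ y) (fun y ↦ A.anchor y (e.symm y v)) x :=
  (A.smooth_anchor e he v).contMDiffAt (e.isOpen_baseSet.mem_nhds hx)

theorem _root_.VBundle.SecAt.anchor {g : Z → X} {a : ∀ z, A.Fiber (g z)} {z : Z}
    (h : A.SecAt g a z) : Man.VecAt g (fun y ↦ A.anchor (g y) (a y)) z := by
  obtain ⟨e, he, hz⟩ := A.exists_mem_baseSet (g z)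
  have h1 : Man.VecAt g (fun y ↦ ∑ k, e.coord (g y) (a y) k •
      A.anchor (g y) (e.symm (g y) (Pi.single k 1))) z :=
    .sum _ h.1 fun k _ ↦ .smul (contMDiffAt_pi_space.1 (h.2 e he hz) k)
      ((A.vecAt_anchor_symm he hz (Pi.single k 1)).comp h.1)
  refine h1.congr ?_
  filter_upwards [h.1.continuousAt.preimage_mem_nhds (e.isOpen_baseSet.mem_nhds hz)] with y hy
  conv_lhs => rw [← e.symm_coord _ hy (a y), VBundle.symm_eq_sum, map_sum]
  simp only [map_smul]

theorem Hom.secAt {f : X ⟶ Y} (φ : Hom A B f) {g : Z → X} {a : ∀ z, A.Fiber (g z)} {z : Z}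
    (h : A.SecAt g a z) : B.SecAt (fun y ↦ f (g y)) (fun y ↦ φ.toFun (g y) (a y)) z := by
  obtain ⟨e, he, hz⟩ := A.exists_mem_baseSet (g z)
  have hf : ContMDiffAt (𝓡 Z.dim) (𝓡 Y.dim) ∞ (fun y ↦ f (g y)) z :=
    (f.contMDiff (g z)).comp z h.1
  have h1 : B.SecAt (fun y ↦ f (g y)) (fun y ↦ ∑ k, e.coord (g y) (a y) k •
      φ.toFun (g y) (e.symm (g y) (Pi.single k 1))) z :=
    .sum _ hf fun k _ ↦ .smul (contMDiffAt_pi_space.1 (h.2 e he hz) k)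
      ⟨hf, fun e' he' hz' ↦ ContMDiffAt.comp z (φ.smoothAt_symm he he' hz hz' _) h.1⟩
  refine h1.congr ?_
  filter_upwards [h.1.continuousAt.preimage_mem_nhds (e.isOpen_baseSet.mem_nhds hz)] with y hy
  conv_lhs => rw [← e.symm_coord _ hy (a y), VBundle.symm_eq_sum, map_sum]
  simp only [map_smul]

/-! ### Cartesian morphisms of Lie algebroids -/

/-- A morphism `φ : A → B` over `f : X → Y` identifies the fibre of `A` at `x` with the fibre
product of the fibre of `B` at `f x` and the tangent space of `X` at `x` over the tangent space of
`Y` at `f x`. -/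
structure Hom.IsCart {f : X ⟶ Y} (φ : Hom A B f) : Prop where
  inj : ∀ (x : X) (a : A.Fiber x), φ.toFun x a = 0 → A.anchor x a = 0 → a = 0
  surj : ∀ (x : X) (b : B.Fiber (f x)) (v : TangentSpace (𝓡 X.dim) x),
    B.anchor (f x) b = Man.dMap f x v → ∃ a : A.Fiber x, φ.toFun x a = b ∧ A.anchor x a = v

namespace Hom.IsCart

variable {f : X ⟶ Y} {φ : Hom A B f}

theorem ext (hφ : φ.IsCart) {x : X} {a a' : A.Fiber x} (h : φ.toFun x a = φ.toFun x a')
    (h' : A.anchor x a = A.anchor x a') : a = a' :=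
  sub_eq_zero.1 (hφ.inj x _ (by rw [map_sub, h, sub_self]) (by rw [map_sub, h', sub_self]))

/-- A section of the domain of a cartesian morphism is smooth if its image and its anchor are. -/
theorem secAt (hφ : φ.IsCart) {g : Z → X} {a : ∀ z, A.Fiber (g z)} {z : Z}
    (h : B.SecAt (fun y ↦ f (g y)) (fun y ↦ φ.toFun (g y) (a y)) z)
    (h' : Man.VecAt g (fun y ↦ A.anchor (g y) (a y)) z) : A.SecAt g a z := by
  obtain ⟨e, he, hz⟩ := A.exists_mem_baseSet (g z)
  exact .of_mem h'.smoothAt_base he hz (e.smoothAt_coord φ.toFun A.anchor hz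
    (fun a h h' ↦ hφ.inj (g z) a h h') (fun v ↦ φ.secAt (VBundle.secAt_symm he hz v))
    (fun v ↦ (VBundle.secAt_symm he hz v).anchor) h h')

end Hom.IsCart

/-- The expression by which morphisms transform brackets is compatible with anchors. -/
theorem anchor_bracketFormula (B : LieAlgebroid Y) (f : X ⟶ Y) {x : X}
    {v w : ∀ x, TangentSpace (𝓡 X.dim) x}
    (hv : Man.VecAt (fun y : X ↦ y) v x) (hw : Man.VecAt (fun y : X ↦ y) w x)
    {V : TopologicalSpace.Opens Y} (hV : f x ∈ V) {m n : ℕ} {g : Fin m → X → ℝ}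
    {ξ' : Fin m → B.Γ V} {h : Fin n → X → ℝ} {ν' : Fin n → B.Γ V}
    (hg : ∀ i, X.SmoothAt (g i) x) (hh : ∀ j, X.SmoothAt (h j) x)
    (hvξ : ∀ᶠ z in 𝓝 x, Man.dMap f z (v z) = ∑ i, g i z • B.anchor (f z) (ξ' i (f z)))
    (hwν : ∀ᶠ z in 𝓝 x, Man.dMap f z (w z) = ∑ j, h j z • B.anchor (f z) (ν' j (f z))) :
    B.anchor (f x) (B.bracketFormula f x (v x) (w x) g ξ' h ν') =
      Man.dMap f x (VectorField.mlieBracket (𝓡 X.dim) v w x) := by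
  rw [Man.dMap_mlieBracket f hv hw (fun i ↦ (VBundle.secAt_of_mem_Γ (ξ' i) hV).anchor)
    (fun j ↦ (VBundle.secAt_of_mem_Γ (ν' j) hV).anchor) hg hh hvξ hwν]
  unfold bracketFormula
  simp only [map_sub, map_add, map_sum, map_smul, fun i j ↦ B.anchor_bracket V (ξ' i) (ν' j) _ hV]

/-- A cartesian morphism has the unique lifting property: the lift is determined fibrewise, and its
compatibility with the brackets can be checked after the anchor and after the cartesian morphism. -/
theorem Hom.IsCart.existsUnique_lift {f : X ⟶ Y} {φ : Hom A B f} (hφ : φ.IsCart)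
    {C : LieAlgebroid Z} {g : Z ⟶ X} (ψ : Hom C B (g ≫ f)) : ∃! χ : Hom C A g, χ.comp φ = ψ := by
  have hex : ∀ (z : Z) (c : C.Fiber z), ∃ a : A.Fiber (g z), φ.toFun (g z) a = ψ.toFun z c ∧
      A.anchor (g z) a = Man.dMap g z (C.anchor z c) := fun z c ↦
    hφ.surj (g z) (ψ.toFun z c) _ ((ψ.anchor_comm z c).trans (Man.dMap_comp g f z _))
  choose χ hχ hχ' using hex
  let L : ∀ z, C.Fiber z →ₗ[ℝ] A.Fiber (g z) := fun z ↦
    { toFun := χ z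
      map_add' := fun c d ↦ hφ.ext (by rw [map_add, hχ, hχ, hχ]; exact map_add (ψ.toFun z) _ _)
        (by rw [map_add, hχ', hχ', hχ', map_add, map_add])
      map_smul' := fun r c ↦ hφ.ext (by rw [map_smul, hχ, hχ]; exact map_smul (ψ.toFun z) _ _)
        (by rw [map_smul, hχ', hχ', map_smul, map_smul]; rfl) }
  have hL : ∀ z c, φ.toFun (g z) (L z c) = ψ.toFun z c := hχ
  have hL' : ∀ z c, A.anchor (g z) (L z c) = Man.dMap g z (C.anchor z c) := hχ'
  have hsec : ∀ {c : ∀ z, C.Fiber z} {z : Z}, C.SecAt (fun y : Z ↦ y) c z →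
      A.SecAt (fun y ↦ g y) (fun y ↦ L y (c y)) z := fun {c z} hc ↦ by
    refine hφ.secAt ((ψ.secAt hc).congr (.of_forall fun y ↦ hL y _)) ?_
    exact (hc.anchor.dMap g).congr (.of_forall fun y ↦ hL' y _)
  let H : Hom C A g :=
    { toFun := L
      smooth := fun e he e' he' v z hz ↦
        ((hsec (VBundle.secAt_symm he hz.1 v)).2 e' he' hz.2).contMDiffWithinAt
      anchor_comm := hL'
      map_bracket := fun U ξ ν z hU ↦ by
        obtain ⟨e, he, hz⟩ := A.exists_mem_baseSet (g z)
        obtain ⟨e', he', hz'⟩ := B.exists_mem_baseSet (f (g z))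
        -- It suffices to treat the decompositions of `L ∘ ξ` and `L ∘ ν` in the frame `b` of `A`.
        refine map_bracket_of_frame L hL' ξ ν z he hz ?_
        let b := VBundle.frame he
        have hc : ∀ (σ : C.Γ U) k, Z.SmoothAt (fun y ↦ e.coord (g y) (L y (σ y)) k) z :=
          fun σ k ↦ contMDiffAt_pi_space.1 ((hsec (VBundle.secAt_of_mem_Γ σ hU)).2 e he hz) k
        have hd : ∀ (σ : C.Γ U), ∀ᶠ y in 𝓝 z, L y (σ y) =
            ∑ k, e.coord (g y) (L y (σ y)) k • b k (g y) := fun σ ↦ by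
          filter_upwards [(e.isOpen_baseSet.preimage g.contMDiff.continuous).mem_nhds hz] with y hy
          exact VBundle.eq_sum_frame he hy _
        have hv : ∀ (σ : C.Γ U), ∀ᶠ y in 𝓝 z, Man.dMap g y (C.anchor y (σ y)) =
            ∑ k, e.coord (g y) (L y (σ y)) k • A.anchor (g y) (b k (g y)) := fun σ ↦ by
          filter_upwards [hd σ] with y hy
          rw [← hL']
          conv_lhs => rw [hy]
          rw [map_sum]
          simp only [map_smul]
        have hb : ∀ (σ : A.Γ ⟨e.baseSet, e.isOpen_baseSet⟩), ∀ᶠ x in 𝓝 (g z), φ.toFun x (σ x) =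
            ∑ k, e'.coord (f x) (φ.toFun x (σ x)) k • VBundle.frame he' k (f x) := fun σ ↦ by
          filter_upwards [(e'.isOpen_baseSet.preimage f.contMDiff.continuous).mem_nhds hz']
              with x hx
          exact VBundle.eq_sum_frame he' hx _
        have hbs : ∀ (σ : A.Γ ⟨e.baseSet, e.isOpen_baseSet⟩) k,
            X.SmoothAt (fun x ↦ e'.coord (f x) (φ.toFun x (σ x)) k) (g z) :=
          fun σ k ↦ φ.smoothAt_apply he' hz' hz σ k
        refine hφ.ext ?_ ?_
        -- After `φ`, both sides are the bracket formula of `ψ` in the frame of `B`.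
        · refine (hL z _).trans ?_
          have key := bracketFormula_trans A B g f z (C.anchor z (ξ z)) (C.anchor z (ν z))
            (φ.toFun (g z)) (fun k y ↦ e.coord (g y) (L y (ξ y)) k) b
            (fun k y ↦ e.coord (g y) (L y (ν y)) k) b
            (fun i k x ↦ e'.coord (f x) (φ.toFun x (b i x)) k) (VBundle.frame he')
            (fun i k x ↦ e'.coord (f x) (φ.toFun x (b i x)) k) (VBundle.frame he')
            (hc ξ) (hc ν) (fun i k ↦ hbs (b i) k) (fun i k ↦ hbs (b i) k)
            (hv ξ).self_of_nhds (hv ν).self_of_nhds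
            (fun i ↦ (hb (b i)).self_of_nhds) (fun i ↦ (hb (b i)).self_of_nhds)
            (fun i j ↦ φ.map_bracket _ (b i) (b j) (g z) hz _ hz' _ _ _ _ _ _
              (hbs (b i)) (hbs (b j)) (hb (b i)) (hb (b j)))
          refine Eq.trans ?_ key.symm
          have hψ : ∀ σ : C.Γ U, ∀ᶠ y in 𝓝 z, ψ.toFun y (σ y) =
              ∑ k, (∑ i, e.coord (g y) (L y (σ y)) i * e'.coord (f (g y)) (φ.toFun (g y)
                (b i (g y))) k) • VBundle.frame he' k (f (g y)) := fun σ ↦ by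
            filter_upwards [hd σ, (e'.isOpen_baseSet.preimage (g ≫ f).contMDiff.continuous).mem_nhds
              hz'] with y hy hy'
            refine (hL y _).symm.trans ?_
            refine (VBundle.eq_sum_frame he' hy' _).trans (Finset.sum_congr rfl fun k _ ↦ ?_)
            congr 1
            conv_lhs => rw [hy, map_sum, map_sum, Finset.sum_apply]
            simp only [map_smul, Pi.smul_apply, smul_eq_mul]
            rfl
          exact ψ.map_bracket U ξ ν z hU _ hz' _ _ _ _ _ _
            (fun k ↦ Man.smoothAt_sum _ fun i _ ↦ Man.smoothAt_mul (hc ξ i)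
              ((hbs (b i) k).comp_hom g))
            (fun k ↦ Man.smoothAt_sum _ fun i _ ↦ Man.smoothAt_mul (hc ν i)
              ((hbs (b i) k).comp_hom g)) (hψ ξ) (hψ ν)
        · rw [hL', C.anchor_bracket U ξ ν z hU]
          exact (A.anchor_bracketFormula g (VBundle.secAt_of_mem_Γ ξ hU).anchor
            (VBundle.secAt_of_mem_Γ ν hU).anchor hz (hc ξ) (hc ν) (hv ξ) (hv ν)).symm }
  refine ⟨H, Hom.ext (funext fun z ↦ LinearMap.ext fun c ↦ hL z c), fun χ' h ↦ ?_⟩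
  refine Hom.ext (funext fun z ↦ LinearMap.ext fun c ↦ hφ.ext ?_ ?_)
  · rw [← h] at hL
    exact (hL z c).symm
  · exact (χ'.anchor_comm z c).trans (hL' z c).symm

end LieAlgebroid

namespace LA

theorem existsUnique_lift {P Q R : LA.{u}} {φ : P ⟶ Q} (hφ : φ.algHom.IsCart) (ψ : R ⟶ Q)
    (g : R.base ⟶ P.base) (h : ψ.base = g ≫ φ.base) : ∃! χ : R ⟶ P, χ.base = g ∧ χ ≫ φ = ψ := by
  obtain ⟨k, ψ⟩ := ψ
  obtain rfl : k = g ≫ φ.base := h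
  obtain ⟨χ, hχ, hu⟩ := hφ.existsUnique_lift ψ
  refine ⟨⟨g, χ⟩, ⟨rfl, congrArg (LA.Hom.mk _) hχ⟩, ?_⟩
  rintro ⟨g', χ'⟩ ⟨rfl, h2⟩
  have h3 : χ'.comp φ.algHom = ψ := eq_of_heq (LA.Hom.mk.inj h2).2
  rw [hu χ' h3]

/-- The map of total spaces defined by a morphism of Lie algebroids. -/
def Hom.tot {P Q : LA.{u}} (φ : P ⟶ Q) (a : Σ x, P.alg.Fiber x) : Σ y, Q.alg.Fiber y :=
  ⟨φ.base a.1, φ.algHom.toFun a.1 a.2⟩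

theorem hom_ext {P Q : LA.{u}} {φ ψ : P ⟶ Q} (h : ∀ a, Hom.tot φ a = Hom.tot ψ a) : φ = ψ := by
  obtain ⟨f, φ⟩ := φ
  obtain ⟨g, ψ⟩ := ψ
  obtain rfl : f = g := Man.hom_ext fun x ↦ congrArg Sigma.fst (h ⟨x, 0⟩)
  congr 1
  exact LieAlgebroid.Hom.ext (funext fun x ↦ LinearMap.ext fun a ↦
    eq_of_heq (Sigma.mk.inj (h ⟨x, a⟩)).2)

end LA

/-! ### The vector bundle underlying the pullback along a submersion -/

/-- A surjective linear map is the first component of a bijective one. -/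
theorem exists_prod_bijective {V W : Type*} [AddCommGroup V] [Module ℝ V] [FiniteDimensional ℝ V]
    [AddCommGroup W] [Module ℝ W] (M : V →ₗ[ℝ] W) (hM : Function.Surjective M) :
    ∃ (k : ℕ) (P : V →ₗ[ℝ] (Fin k → ℝ)), Function.Bijective (M.prod P) := by
  obtain ⟨p, hp⟩ := LinearMap.exists_leftInverse_of_injective M.ker.subtype
    (LinearMap.ker_eq_bot.2 Subtype.val_injective)
  let b := (Module.finBasis ℝ M.ker).equivFun
  refine ⟨_, b.toLinearMap.comp p, (injective_iff_map_eq_zero _).2 fun v hv ↦ ?_, fun ⟨w, k⟩ ↦ ?_⟩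
  · have h1 : M v = 0 := congrArg Prod.fst hv
    have h2 : b (p v) = 0 := congrArg Prod.snd hv
    have h3 : p v = ⟨v, h1⟩ := LinearMap.congr_fun hp ⟨v, h1⟩
    rw [LinearEquiv.map_eq_zero_iff, h3] at h2
    exact congrArg Subtype.val h2
  · obtain ⟨v, rfl⟩ := hM w
    have h3 : p (b.symm k - p v : M.ker) = b.symm k - p v :=
      LinearMap.congr_fun hp (b.symm k - p v)
    refine ⟨v + (b.symm k - p v : M.ker), Prod.ext ?_ ?_⟩
    · change M (v + (b.symm k - p v : M.ker)) = M v
      rw [map_add, LinearMap.mem_ker.1 (b.symm k - p v : M.ker).2, add_zero]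
    · change b (p (v + (b.symm k - p v : M.ker))) = k
      rw [map_add, h3, add_sub_cancel, LinearEquiv.apply_symm_apply]

namespace LieAlgebroid

variable {X Y Z : Man.{u}}

/-- The fibre at `x` of the pullback of `B` along `f`: the pairs of a vector of `B` at `f x` and a
tangent vector at `x` with the same image in the tangent space at `f x`. -/
noncomputable def pullFiber (B : LieAlgebroid Y) (f : X ⟶ Y) (x : X) :
    Submodule ℝ (B.Fiber (f x) × TangentSpace (𝓡 X.dim) x) :=
  LinearMap.eqLocus ((B.anchor (f x)).comp (LinearMap.fst ℝ _ _))
    ((Man.dMap f x).toLinearMap.comp (LinearMap.snd ℝ _ _))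

variable {B : LieAlgebroid Y} {f : X ⟶ Y}

theorem pullFiber_eq {x : X} (a : pullFiber B f x) :
    B.anchor (f x) a.1.1 = Man.dMap f x a.1.2 := a.2

theorem pullFiber_ext {x : X} {a b : pullFiber B f x} (h : a.1.1 = b.1.1) (h' : a.1.2 = b.1.2) :
    a = b := Subtype.ext (Prod.ext h h')

/-- The projection of the pullback to `B`. -/
noncomputable def pullFst (B : LieAlgebroid Y) (f : X ⟶ Y) (x : X) : pullFiber B f x →ₗ[ℝ] B.Fiber
    (f x) :=
  (LinearMap.fst ℝ _ _).comp (pullFiber B f x).subtype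

/-- The anchor of the pullback. -/
noncomputable def pullSnd (B : LieAlgebroid Y) (f : X ⟶ Y) (x : X) :
    pullFiber B f x →ₗ[ℝ] TangentSpace (𝓡 X.dim) x :=
  (LinearMap.snd ℝ _ _).comp (pullFiber B f x).subtype

/-- The local trivialisations of the pullback whose frames are smooth. -/
def pullAtlas (B : LieAlgebroid Y) (f : X ⟶ Y) :
    Set (LocalTriv X fun x ↦ pullFiber B f x) :=
  { t | ∀ v, ∀ x ∈ t.baseSet, B.SecAt (fun y ↦ f y) (fun y ↦ pullFst B f y (t.symm y v)) x ∧
    Man.VecAt (fun y : X ↦ y) (fun y ↦ pullSnd B f y (t.symm y v)) x }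

theorem smoothAt_pull_coord {t : LocalTriv X fun x ↦ pullFiber B f x} (ht : t ∈ pullAtlas B f)
    {g : Z → X} {a : ∀ z, pullFiber B f (g z)} {z : Z} (hz : g z ∈ t.baseSet)
    (h : B.SecAt (fun y ↦ f (g y)) (fun y ↦ pullFst B f (g y) (a y)) z)
    (h' : Man.VecAt g (fun y ↦ pullSnd B f (g y) (a y)) z) :
    Man.SmoothAt (fun y ↦ t.coord (g y) (a y)) z :=
  t.smoothAt_coord (pullFst B f) (pullSnd B f) hz (fun _ h h' ↦ pullFiber_ext h h')
    (fun v ↦ (ht v _ hz).1) (fun v ↦ (ht v _ hz).2) h h'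

open Classical in
/-- Near a point, the pullback is the kernel of a surjective linear map `M x` between fixed vector
spaces, and is identified with the kernel at this point by a fixed linear map `P`, such that `M x`
and `P` are jointly bijective. -/
theorem exists_pullTriv (B : LieAlgebroid Y) (f : X ⟶ Y) (x₀ : X)
    (hf : Function.Surjective (Man.dMap f x₀)) : ∃ t ∈ pullAtlas B f, x₀ ∈ t.baseSet := by
  obtain ⟨e, he, hx₀⟩ := B.exists_mem_baseSet (f x₀)
  let V := (Fin e.rank → ℝ) × EuclideanSpace ℝ (Fin X.dim)
  let D : Set X := {x | f x ∈ e.baseSet ∧ f x ∈ Man.tdom (f x₀) ∧ x ∈ Man.tdom x₀}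
  have hD : IsOpen D := (e.isOpen_baseSet.preimage f.contMDiff.continuous).inter
    (((Man.isOpen_tdom (f x₀)).preimage f.contMDiff.continuous).inter (Man.isOpen_tdom x₀))
  have hx₀D : x₀ ∈ D := ⟨hx₀, Man.mem_tdom _, Man.mem_tdom _⟩
  let M' : ∀ x, V →ₗ[ℝ] TangentSpace (𝓡 Y.dim) (f x) := fun x ↦
    (B.anchor (f x)).comp ((e.symm (f x)).comp (LinearMap.fst ℝ _ _)) -
      (Man.dMap f x).toLinearMap.comp ((Man.tcs x₀ x).toLinearMap.comp (LinearMap.snd ℝ _ _))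
  -- `M x` is the difference of the two maps to the tangent space at `f x`, in local coordinates.
  let M : X → V →L[ℝ] EuclideanSpace ℝ (Fin Y.dim) := fun x ↦
    LinearMap.toContinuousLinearMap ((Man.tc (f x₀) (f x)).toLinearMap.comp (M' x))
  have hM : ∀ x ∈ D, Man.SmoothAt M x := fun x hx ↦ Man.smoothAt_clm fun v ↦ by
    have h1 : Man.VecAt (fun y ↦ f y) (fun y ↦ B.anchor (f y) (e.symm (f y) v.1)) x :=
      (B.vecAt_anchor_symm he hx.1 v.1).comp_hom f
    have h2 : Man.VecAt (fun y : X ↦ y) (fun y ↦ Man.tcs x₀ y v.2) x :=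
      (Man.vecAt_iff hx.2.2).2 ⟨contMDiffAt_id, (contMDiffAt_const (c := v.2)).congr_of_eventuallyEq
        (by filter_upwards [(Man.isOpen_tdom x₀).mem_nhds hx.2.2] with y hy using Man.tc_tcs hy _)⟩
    exact ((Man.vecAt_iff hx.2.1).1 (h1.sub (h2.dMap f))).2
  have hMs : Function.Surjective (M x₀) := fun w ↦ by
    obtain ⟨v, hv⟩ := hf (Man.tcs (f x₀) (f x₀) w)
    refine ⟨(0, -Man.tc x₀ x₀ v), ?_⟩
    change Man.tc (f x₀) (f x₀) (B.anchor (f x₀) (e.symm (f x₀) 0) -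
      Man.dMap f x₀ (Man.tcs x₀ x₀ (-Man.tc x₀ x₀ v))) = w
    rw [map_neg, Man.tcs_tc (Man.mem_tdom _), map_zero, map_zero, map_neg, hv, zero_sub, neg_neg,
      Man.tc_tcs (Man.mem_tdom _)]
  obtain ⟨k, P, hP⟩ := exists_prod_bijective (M x₀).toLinearMap hMs
  let Φ : (EuclideanSpace ℝ (Fin Y.dim) × (Fin k → ℝ)) →L[ℝ] V :=
    LinearMap.toContinuousLinearMap (LinearEquiv.ofBijective _ hP).symm.toLinearMap
  have hΦ : Function.Injective Φ := (LinearEquiv.ofBijective _ hP).symm.injective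
  let P' : V →L[ℝ] (Fin k → ℝ) := LinearMap.toContinuousLinearMap P
  -- `G x` is the map `(M x, P)` followed by the inverse of `(M x₀, P)`; it is invertible near `x₀`.
  let G : X → V →L[ℝ] V := fun x ↦ Φ.comp ((M x).prod P')
  have hG : ∀ x ∈ D, Man.SmoothAt G x := fun x hx ↦ Man.smoothAt_clm fun v ↦
    Φ.contMDiff.contMDiffAt.comp x (((hM x hx).clm_apply (contMDiffAt_const (c := v))).prodMk_space
      (contMDiffAt_const (c := P' v)))
  have hG₀ : G x₀ = 1 := ContinuousLinearMap.ext fun v ↦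
    (LinearEquiv.ofBijective _ hP).symm_apply_apply v
  let N : Set X := {x | x ∈ D ∧ IsUnit (G x)}
  have hN : IsOpen N := isOpen_iff_mem_nhds.2 fun x hx ↦ Filter.inter_mem (hD.mem_nhds hx.1)
    ((hG x hx.1).continuousAt.eventually (Units.isOpen.mem_nhds hx.2))
  have hx₀N : x₀ ∈ N := ⟨hx₀D, hG₀ ▸ isUnit_one⟩
  let s : X → (Fin k → ℝ) →ₗ[ℝ] V := fun x ↦
    (Ring.inverse (G x)).toLinearMap.comp (Φ.toLinearMap.comp (LinearMap.inr ℝ _ _))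
  have hs : ∀ x ∈ N, ∀ v, (M x) (s x v) = 0 ∧ P (s x v) = v := fun x hx v ↦ by
    have h1 : G x (s x v) = Φ (0, v) :=
      congrArg (fun L : V →L[ℝ] V ↦ L (Φ (0, v))) (Ring.mul_inverse_cancel _ hx.2)
    have h2 := hΦ h1
    exact ⟨congrArg Prod.fst h2, congrArg Prod.snd h2⟩
  have hs' : ∀ x ∈ N, ∀ v, M' x (s x v) = 0 := fun x hx v ↦ by
    have h1 : Man.tc (f x₀) (f x) (M' x (s x v)) = 0 := (hs x hx v).1
    rw [← Man.tcs_tc hx.1.2.1 (M' x (s x v)), h1, map_zero]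
  let c : ∀ x, pullFiber B f x →ₗ[ℝ] V := fun x ↦
    ((e.coord (f x)).comp (pullFst B f x)).prod ((Man.tc x₀ x).toLinearMap.comp (pullSnd B f x))
  let d : ∀ x, V →ₗ[ℝ] B.Fiber (f x) × TangentSpace (𝓡 X.dim) x := fun x ↦
    (e.symm (f x)).prodMap (Man.tcs x₀ x).toLinearMap
  have hdc : ∀ x ∈ D, ∀ a, d x (c x a) = a.1 := fun x hx a ↦
    Prod.ext (e.symm_coord _ hx.1 _) (Man.tcs_tc hx.2.2 _)
  have hcd : ∀ x ∈ D, ∀ (a : pullFiber B f x) v, a.1 = d x v → c x a = v := fun x hx a v h ↦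
    Prod.ext ((congrArg (e.coord (f x)) (congrArg Prod.fst h)).trans (e.coord_symm _ hx.1 _))
      ((congrArg (Man.tc x₀ x) (congrArg Prod.snd h)).trans (Man.tc_tcs hx.2.2 _))
  have hd : ∀ x ∈ N, ∀ v, d x (s x v) ∈ pullFiber B f x := fun x hx v ↦
    sub_eq_zero.1 (hs' x hx v)
  let t : LocalTriv X fun x ↦ pullFiber B f x :=
    { baseSet := N
      isOpen_baseSet := hN
      rank := k
      coord := fun x ↦ P.comp (c x)
      symm := fun x ↦ if hx : x ∈ N then ((d x).comp (s x)).codRestrict _ (hd x hx) else 0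
      symm_coord := fun x hx a ↦ by
        rw [dif_pos hx]
        refine Subtype.ext ((congrArg (d x) ?_).trans (hdc x hx.1 a))
        have h0 : M x (c x a) = 0 := by
          have h1 : M' x (c x a) = 0 := by
            refine sub_eq_zero.2 ?_
            have h2 := pullFiber_eq a
            rw [← hdc x hx.1 a] at h2
            exact h2
          change Man.tc (f x₀) (f x) (M' x (c x a)) = 0
          rw [h1, map_zero]
        have h3 : G x (c x a) = Φ (0, P (c x a)) := congrArg Φ (Prod.ext h0 rfl)
        change Ring.inverse (G x) (Φ (0, P (c x a))) = c x a
        rw [← h3]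
        exact congrArg (fun L : V →L[ℝ] V ↦ L (c x a)) (Ring.inverse_mul_cancel _ hx.2)
      coord_symm := fun x hx v ↦ by
        rw [dif_pos hx]
        exact (congrArg P (hcd x hx.1 _ (s x v) rfl)).trans (hs x hx v).2 }
  refine ⟨t, fun v x hx ↦ ?_, hx₀N⟩
  have hsv : Man.SmoothAt (fun y ↦ s y v) x :=
    ((hG x hx.1).ringInverse hx.2).clm_apply (contMDiffAt_const (c := Φ (0, v)))
  have hN' := hN.mem_nhds hx
  have hev : ∀ y ∈ N, (t.symm y v).1 = d y (s y v) := fun y hy ↦ by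
    have h1 : t.symm y = ((d y).comp (s y)).codRestrict _ (hd y hy) := dif_pos hy
    rw [h1]
    rfl
  constructor
  · refine .of_mem (f.contMDiff x) he hx.1.1 ((ContMDiffAt.comp x
      (ContinuousLinearMap.fst ℝ _ _).contMDiff.contMDiffAt hsv).congr_of_eventuallyEq ?_)
    filter_upwards [hN'] with y hy
    exact (congrArg (e.coord (f y)) (congrArg Prod.fst (hev y hy))).trans
      (e.coord_symm _ hy.1.1 _)
  · refine (Man.vecAt_iff hx.1.2.2).2 ⟨contMDiffAt_id, (ContMDiffAt.comp x
      (ContinuousLinearMap.snd ℝ _ _).contMDiff.contMDiffAt hsv).congr_of_eventuallyEq ?_⟩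
    filter_upwards [hN'] with y hy
    exact (congrArg (Man.tc x₀ y) (congrArg Prod.snd (hev y hy))).trans
      (Man.tc_tcs hy.1.2.2 _)

/-- The vector bundle underlying the pullback of a Lie algebroid along a submersion. -/
noncomputable def pullBundle (B : LieAlgebroid Y) (f : X ⟶ Y) (hf : Man.submersion f) : VBundle
    X where
  Fiber x := pullFiber B f x
  atlas := pullAtlas B f
  exists_mem_baseSet x := exists_pullTriv B f x (hf x)
  smooth_transition t ht t' ht' v x hx := by
    have h := smoothAt_pull_coord ht' (g := fun y : X ↦ y) (a := fun y ↦ t.symm y v) hx.2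
      (ht v x hx.1).1 (ht v x hx.1).2
    exact h.contMDiffWithinAt

/-- A section of the pullback is smooth if and only if its two components are. -/
theorem secAt_pullBundle_iff {hf : Man.submersion f} {g : Z → X} {a : ∀ z, pullFiber B f (g z)}
    {z : Z} : (pullBundle B f hf).SecAt g a z ↔
      B.SecAt (fun y ↦ f (g y)) (fun y ↦ pullFst B f (g y) (a y)) z ∧
      Man.VecAt g (fun y ↦ pullSnd B f (g y) (a y)) z := by
  constructor
  · intro h
    obtain ⟨t, ht, hz⟩ : ∃ t ∈ pullAtlas B f, g z ∈ t.baseSet :=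
      (pullBundle B f hf).exists_mem_baseSet (g z)
    have hfg : ContMDiffAt (𝓡 Z.dim) (𝓡 Y.dim) ∞ (fun y ↦ f (g y)) z :=
      (f.contMDiff (g z)).comp z h.1
    have hev : ∀ᶠ y in 𝓝 z, a y = ∑ k, t.coord (g y) (a y) k • t.symm (g y) (Pi.single k 1) := by
      filter_upwards [h.1.continuousAt.preimage_mem_nhds (t.isOpen_baseSet.mem_nhds hz)] with y hy
      conv_lhs => rw [← t.symm_coord _ hy (a y)]
      exact VBundle.symm_eq_sum (E := pullBundle B f hf) t _ _
    have hc : ∀ k, Man.SmoothAt (fun y ↦ t.coord (g y) (a y) k) z :=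
      fun k ↦ contMDiffAt_pi_space.1 (h.2 t ht hz) k
    constructor
    · refine (VBundle.SecAt.sum Finset.univ hfg fun k _ ↦ VBundle.SecAt.smul (hc k)
        ((ht (Pi.single k 1) _ hz).1.comp h.1)).congr ?_
      filter_upwards [hev] with y hy
      conv_lhs => rw [hy, map_sum]
      simp only [map_smul]
    · refine (Man.VecAt.sum Finset.univ h.1 fun k _ ↦ Man.VecAt.smul (hc k)
        ((ht (Pi.single k 1) _ hz).2.comp h.1)).congr ?_
      filter_upwards [hev] with y hy
      conv_lhs => rw [hy, map_sum]
      simp only [map_smul]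
  · rintro ⟨h, h'⟩
    exact ⟨h'.smoothAt_base, fun t ht hz ↦ smoothAt_pull_coord ht hz h h'⟩

end LieAlgebroid

/-! ### The bracket of the pullback along a submersion -/

namespace Man

theorem dirDeriv_const {X : Man.{u}} (c : ℝ) (x : X) (v : TangentSpace (𝓡 X.dim) x) :
    X.dirDeriv (fun _ ↦ c) x v = 0 := by
  have : mfderiv (𝓡 X.dim) 𝓘(ℝ, ℝ) (fun _ : X ↦ c) x = 0 := mfderiv_const
  exact congrArg (fun L : TangentSpace (𝓡 X.dim) x →L[ℝ] ℝ ↦ L v) this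

theorem dirDeriv_add {X : Man.{u}} {f g : X → ℝ} {x : X} (hf : SmoothAt f x) (hg : SmoothAt g x)
    (v : TangentSpace (𝓡 X.dim) x) : X.dirDeriv (fun y ↦ f y + g y) x v =
      X.dirDeriv f x v + X.dirDeriv g x v := by
  have := (hf.mdiff.hasMFDerivAt.add hg.mdiff.hasMFDerivAt).mfderiv
  exact congrArg (fun L : TangentSpace (𝓡 X.dim) x →L[ℝ] ℝ ↦ L v) this

end Man

namespace LieAlgebroid

variable {X Y : Man.{u}} (B : LieAlgebroid Y) (f : X ⟶ Y)

section

variable {B f} {x : X} {V : TopologicalSpace.Opens Y} {m n : ℕ}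

theorem bracketFormula_skew (u w : TangentSpace (𝓡 X.dim) x) (g : Fin m → X → ℝ)
    (ξ' : Fin m → B.Γ V) (h : Fin n → X → ℝ) (ν' : Fin n → B.Γ V) :
    B.bracketFormula f x u w g ξ' h ν' = -B.bracketFormula f x w u h ν' g ξ' := by
  unfold bracketFormula
  have h1 : ∀ i j, B.bracket V (ξ' i) (ν' j) (f x) = -B.bracket V (ν' j) (ξ' i) (f x) :=
    fun i j ↦ congrArg (fun σ : B.Γ V ↦ σ (f x)) (B.bracket_skew (ξ' i) (ν' j))
  simp only [h1, smul_neg, Finset.sum_neg_distrib]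
  rw [Finset.sum_comm]
  simp only [mul_comm (h _ x)]
  abel

theorem bracketFormula_add_right (u w w' : TangentSpace (𝓡 X.dim) x) (g : Fin m → X → ℝ)
    (ξ' : Fin m → B.Γ V) {h h' : Fin n → X → ℝ} (ν' : Fin n → B.Γ V)
    (hh : ∀ j, X.SmoothAt (h j) x) (hh' : ∀ j, X.SmoothAt (h' j) x) :
    B.bracketFormula f x u (w + w') g ξ' (fun j y ↦ h j y + h' j y) ν' =
      B.bracketFormula f x u w g ξ' h ν' + B.bracketFormula f x u w' g ξ' h' ν' := by
  unfold bracketFormula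
  simp only [fun j ↦ Man.dirDeriv_add (hh j) (hh' j), map_add, mul_add, add_smul,
    Finset.sum_add_distrib]
  abel

theorem bracketFormula_smul_right (u w : TangentSpace (𝓡 X.dim) x) (g : Fin m → X → ℝ)
    (ξ' : Fin m → B.Γ V) {h : Fin n → X → ℝ} {c : X → ℝ} (ν' : Fin n → B.Γ V)
    (hc : X.SmoothAt c x) (hh : ∀ j, X.SmoothAt (h j) x) :
    B.bracketFormula f x u (c x • w) g ξ' (fun j y ↦ c y * h j y) ν' =
      X.dirDeriv c x u • ∑ j, h j x • ν' j (f x) + c x • B.bracketFormula f x u w g ξ' h ν' := by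
  unfold bracketFormula
  simp only [fun j ↦ Man.dirDeriv_mul hc (hh j), map_smul, smul_add, smul_sub, Finset.smul_sum,
    smul_smul, add_smul, Finset.sum_add_distrib, smul_eq_mul, mul_left_comm _ (c x),
    mul_comm (h _ x) (X.dirDeriv c x u)]
  abel

theorem bracketFormula_secAt {v w : ∀ x : X, TangentSpace (𝓡 X.dim) x}
    (hv : Man.VecAt (fun y : X ↦ y) v x) (hw : Man.VecAt (fun y : X ↦ y) w x) (hV : f x ∈ V)
    {g : Fin m → X → ℝ} (ξ' : Fin m → B.Γ V) {h : Fin n → X → ℝ} (ν' : Fin n → B.Γ V)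
    (hg : ∀ i, X.SmoothAt (g i) x) (hh : ∀ j, X.SmoothAt (h j) x) :
    B.SecAt (fun y ↦ f y) (fun y ↦ B.bracketFormula f y (v y) (w y) g ξ' h ν') x := by
  have hf := f.contMDiff x
  have hs : ∀ σ : B.Γ V, B.SecAt (fun y ↦ f y) (fun y ↦ σ (f y)) x := fun σ ↦
    (VBundle.secAt_of_mem_Γ σ hV).comp hf
  have h1 : B.SecAt (fun y ↦ f y)
      (fun y ↦ ∑ i, ∑ j, (g i y * h j y) • B.bracket V (ξ' i) (ν' j) (f y)) x :=
    .sum _ hf fun i _ ↦ .sum _ hf fun j _ ↦ .smul (Man.smoothAt_mul (hg i) (hh j)) (hs _)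
  have h2 : ∀ {r : ℕ} {v : ∀ x : X, TangentSpace (𝓡 X.dim) x} {h : Fin r → X → ℝ}
      (ν' : Fin r → B.Γ V), Man.VecAt (fun y : X ↦ y) v x → (∀ j, X.SmoothAt (h j) x) →
      B.SecAt (fun y ↦ f y) (fun y ↦ ∑ j, X.dirDeriv (h j) y (v y) • ν' j (f y)) x :=
    fun ν' hv hh ↦ .sum _ hf fun j _ ↦ .smul (hv.smoothAt_dirDeriv (hh j)) (hs _)
  refine ((h1.add (h2 ν' hv hh)).add (.smul (contMDiffAt_const (c := (-1 : ℝ)))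
    (h2 ξ' hw hg))).congr (.of_forall fun y ↦ ?_)
  unfold bracketFormula
  simp only [neg_smul, one_smul, sub_eq_add_neg]

end

/-- The bracket of sections `a` and `b` of `B` along `f`, given vector fields `v` and `w` which lift
their anchors. -/
noncomputable def lieAlong (v w : ∀ x : X, TangentSpace (𝓡 X.dim) x) (a b : ∀ x, B.Fiber (f x))
    (z : X) : B.Fiber (f z) :=
  B.bracketFormula f z (v z) (w z)
    (fun k y ↦ (B.exists_mem_baseSet (f z)).choose.coord (f y) (a y) k)
    (VBundle.frame (B.exists_mem_baseSet (f z)).choose_spec.1)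
    (fun k y ↦ (B.exists_mem_baseSet (f z)).choose.coord (f y) (b y) k)
    (VBundle.frame (B.exists_mem_baseSet (f z)).choose_spec.1)

variable {B f}

/-- The bracket of sections along `f` can be computed from any decompositions of the sections as
combinations of sections of `B`. -/
theorem lieAlong_eq {v w : ∀ x : X, TangentSpace (𝓡 X.dim) x} {a b : ∀ x, B.Fiber (f x)} {z : X}
    {V : TopologicalSpace.Opens Y} (hV : f z ∈ V) {m n : ℕ} {g : Fin m → X → ℝ}
    {ξ' : Fin m → B.Γ V} {h : Fin n → X → ℝ} {ν' : Fin n → B.Γ V}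
    (hg : ∀ i, X.SmoothAt (g i) z) (hh : ∀ j, X.SmoothAt (h j) z)
    (ha : ∀ᶠ y in 𝓝 z, a y = ∑ i, g i y • ξ' i (f y))
    (hb : ∀ᶠ y in 𝓝 z, b y = ∑ j, h j y • ν' j (f y))
    (hv : B.anchor (f z) (a z) = Man.dMap f z (v z))
    (hw : B.anchor (f z) (b z) = Man.dMap f z (w z)) :
    B.lieAlong f v w a b z = B.bracketFormula f z (v z) (w z) g ξ' h ν' := by
  obtain ⟨he, hx⟩ := (B.exists_mem_baseSet (f z)).choose_spec
  let e := (B.exists_mem_baseSet (f z)).choose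
  have key := bracketFormula_trans B B f (𝟙 Y) z (v z) (w z)
    LinearMap.id g ξ' h ν' (fun i k y ↦ e.coord y (ξ' i y) k) (VBundle.frame he)
    (fun i k y ↦ e.coord y (ν' i y) k) (VBundle.frame he) hg hh
    (fun i k ↦ VBundle.coord_smoothAt he hx hV (ξ' i) k)
    (fun i k ↦ VBundle.coord_smoothAt he hx hV (ν' i) k)
    (by rw [← hv, ha.self_of_nhds, map_sum]; simp only [map_smul])
    (by rw [← hw, hb.self_of_nhds, map_sum]; simp only [map_smul])
    (fun i ↦ VBundle.eq_sum_frame he hx (ξ' i (f z)))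
    (fun i ↦ VBundle.eq_sum_frame he hx (ν' i (f z)))
    (fun i j ↦ B.bracket_eq_frame he hx hV (ξ' i) (ν' j))
  refine Eq.trans ?_ key.symm
  refine bracketFormula_congr B f z _ _ _ _ (fun k ↦ ?_) (fun k ↦ ?_)
  · filter_upwards [ha] with y hy
    rw [hy, map_sum, Finset.sum_apply]
    simp only [map_smul, Pi.smul_apply, smul_eq_mul]
    rfl
  · filter_upwards [hb] with y hy
    rw [hy, map_sum, Finset.sum_apply]
    simp only [map_smul, Pi.smul_apply, smul_eq_mul]
    rfl

/-- Smoothness at `z` of a section of the pullback, in terms of its two components. -/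
def PullSecAt (σ : ∀ y, pullFiber B f y) (z : X) : Prop :=
  B.SecAt (fun y ↦ f y) (fun y ↦ (σ y).1.1) z ∧ Man.VecAt (fun y : X ↦ y) (fun y ↦ (σ y).1.2) z

theorem PullSecAt.congr {σ τ : ∀ y, pullFiber B f y} {z : X} (h : PullSecAt σ z)
    (hτ : ∀ᶠ y in 𝓝 z, τ y = σ y) : PullSecAt τ z :=
  ⟨h.1.congr (hτ.mono fun y hy ↦ by rw [hy]), h.2.congr (hτ.mono fun y hy ↦ by rw [hy])⟩

theorem PullSecAt.add {σ τ : ∀ y, pullFiber B f y} {z : X} (h : PullSecAt σ z)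
    (h' : PullSecAt τ z) : PullSecAt (fun y ↦ σ y + τ y) z :=
  ⟨h.1.add h'.1, h.2.add h'.2⟩

theorem PullSecAt.smul {σ : ∀ y, pullFiber B f y} {c : X → ℝ} {z : X} (hc : X.SmoothAt c z)
    (h : PullSecAt σ z) : PullSecAt (fun y ↦ c y • σ y) z :=
  ⟨h.1.smul hc, h.2.smul hc⟩

theorem exists_coord {a : ∀ x, B.Fiber (f x)} {z : X} {e : LocalTriv Y B.Fiber} (he : e ∈ B.atlas)
    (hz : f z ∈ e.baseSet) (ha : B.SecAt (fun y ↦ f y) a z) :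
    (∀ k, X.SmoothAt (fun y ↦ e.coord (f y) (a y) k) z) ∧
      ∀ᶠ y in 𝓝 z, a y = ∑ k, e.coord (f y) (a y) k • VBundle.frame he k (f y) := by
  refine ⟨fun k ↦ contMDiffAt_pi_space.1 (ha.2 e he hz) k, ?_⟩
  filter_upwards [(e.isOpen_baseSet.preimage f.contMDiff.continuous).mem_nhds hz] with y hy
  exact VBundle.eq_sum_frame he hy (a y)

theorem lieAlong_eq_frame {σ τ : ∀ y, pullFiber B f y} {z : X} (hσ : PullSecAt σ z)
    (hτ : PullSecAt τ z) {e : LocalTriv Y B.Fiber} (he : e ∈ B.atlas) (hz : f z ∈ e.baseSet) :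
    B.lieAlong f (fun y ↦ (σ y).1.2) (fun y ↦ (τ y).1.2) (fun y ↦ (σ y).1.1)
      (fun y ↦ (τ y).1.1) z = B.bracketFormula f z (σ z).1.2 (τ z).1.2
      (fun k y ↦ e.coord (f y) (σ y).1.1 k) (VBundle.frame he)
      (fun k y ↦ e.coord (f y) (τ y).1.1 k) (VBundle.frame he) := by
  obtain ⟨h1, h2⟩ := exists_coord he hz hσ.1
  obtain ⟨h3, h4⟩ := exists_coord he hz hτ.1
  exact lieAlong_eq (V := ⟨e.baseSet, e.isOpen_baseSet⟩) hz h1 h3 h2 h4 (σ z).2 (τ z).2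

open Classical in
/-- The bracket of two sections of the pullback at a point. The value is irrelevant if they are not
smooth there. -/
noncomputable def pullBr (σ τ : ∀ y, pullFiber B f y) (z : X) : pullFiber B f z :=
  if h : PullSecAt σ z ∧ PullSecAt τ z then
    ⟨(B.lieAlong f (fun y ↦ (σ y).1.2) (fun y ↦ (τ y).1.2) (fun y ↦ (σ y).1.1)
      (fun y ↦ (τ y).1.1) z,
      VectorField.mlieBracket (𝓡 X.dim) (fun y ↦ (σ y).1.2) (fun y ↦ (τ y).1.2) z), by
      obtain ⟨e, he, hz⟩ := B.exists_mem_baseSet (f z)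
      obtain ⟨h1, h2⟩ := exists_coord he hz h.1.1
      obtain ⟨h3, h4⟩ := exists_coord he hz h.2.1
      refine (congrArg (B.anchor (f z)) (lieAlong_eq_frame h.1 h.2 he hz)).trans ?_
      refine anchor_bracketFormula (V := ⟨e.baseSet, e.isOpen_baseSet⟩) B f h.1.2 h.2.2 hz h1 h3
        ?_ ?_
      · filter_upwards [h2] with y hy
        refine (pullFiber_eq (σ y)).symm.trans ?_
        conv_lhs => rw [hy, map_sum]
        simp only [map_smul]
      · filter_upwards [h4] with y hy
        refine (pullFiber_eq (τ y)).symm.trans ?_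
        conv_lhs => rw [hy, map_sum]
        simp only [map_smul]⟩
  else 0

section

variable {σ τ ρ : ∀ y, pullFiber B f y} {z : X}

theorem pullBr_snd (hσ : PullSecAt σ z) (hτ : PullSecAt τ z) : (pullBr σ τ z).1.2 =
    VectorField.mlieBracket (𝓡 X.dim) (fun y ↦ (σ y).1.2) (fun y ↦ (τ y).1.2) z := by
  unfold pullBr
  rw [dif_pos ⟨hσ, hτ⟩]

theorem pullBr_fst (hσ : PullSecAt σ z) (hτ : PullSecAt τ z) : (pullBr σ τ z).1.1 =
    B.lieAlong f (fun y ↦ (σ y).1.2) (fun y ↦ (τ y).1.2) (fun y ↦ (σ y).1.1)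
      (fun y ↦ (τ y).1.1) z := by
  unfold pullBr
  rw [dif_pos ⟨hσ, hτ⟩]

theorem pullBr_skew (hσ : PullSecAt σ z) (hτ : PullSecAt τ z) :
    pullBr σ τ z = -pullBr τ σ z := by
  refine pullFiber_ext ?_ ?_
  · change _ = -(pullBr τ σ z).1.1
    rw [pullBr_fst hσ hτ, pullBr_fst hτ hσ]
    exact bracketFormula_skew _ _ _ _ _ _
  · change _ = -(pullBr τ σ z).1.2
    rw [pullBr_snd hσ hτ, pullBr_snd hτ hσ, VectorField.mlieBracket_swap]
    rfl

theorem pullBr_self (hσ : PullSecAt σ z) : pullBr σ σ z = 0 := by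
  have h := pullBr_skew hσ hσ
  have h2 : (2 : ℝ) • pullBr σ σ z = 0 := by
    rw [two_smul]
    nth_rewrite 1 [h]
    exact neg_add_cancel _
  exact (smul_eq_zero.1 h2).resolve_left two_ne_zero

theorem pullBr_add (hσ : PullSecAt σ z) (hτ : PullSecAt τ z) (hρ : PullSecAt ρ z) :
    pullBr σ (fun y ↦ τ y + ρ y) z = pullBr σ τ z + pullBr σ ρ z := by
  refine pullFiber_ext ?_ ?_
  · change _ = (pullBr σ τ z).1.1 + (pullBr σ ρ z).1.1
    rw [pullBr_fst hσ (hτ.add hρ), pullBr_fst hσ hτ, pullBr_fst hσ hρ]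
    obtain ⟨he, hz⟩ := (B.exists_mem_baseSet (f z)).choose_spec
    refine Eq.trans ?_ (bracketFormula_add_right _ _ _ _ _ _ (exists_coord he hz hτ.1).1
      (exists_coord he hz hρ.1).1)
    refine bracketFormula_congr B f z _ _ _ _ (fun k ↦ .refl _ _) (fun k ↦ .of_forall fun y ↦ ?_)
    exact congrFun (map_add ((B.exists_mem_baseSet (f z)).choose.coord (f y)) (τ y).1.1 (ρ y).1.1) k
  · change _ = (pullBr σ τ z).1.2 + (pullBr σ ρ z).1.2
    rw [pullBr_snd hσ (hτ.add hρ), pullBr_snd hσ hτ, pullBr_snd hσ hρ]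
    exact VectorField.mlieBracket_add_right hτ.2.mdiff hρ.2.mdiff

theorem pullBr_smul {c : X → ℝ} (hc : X.SmoothAt c z) (hσ : PullSecAt σ z) (hτ : PullSecAt τ z) :
    pullBr σ (fun y ↦ c y • τ y) z =
      X.dirDeriv c z (σ z).1.2 • τ z + c z • pullBr σ τ z := by
  refine pullFiber_ext ?_ ?_
  · change _ = X.dirDeriv c z (σ z).1.2 • (τ z).1.1 + c z • (pullBr σ τ z).1.1
    rw [pullBr_fst hσ (hτ.smul hc), pullBr_fst hσ hτ]
    obtain ⟨he, hz⟩ := (B.exists_mem_baseSet (f z)).choose_spec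
    obtain ⟨h1, h2⟩ := exists_coord he hz hτ.1
    rw [h2.self_of_nhds]
    refine Eq.trans ?_ (bracketFormula_smul_right _ _ _ _ _ hc h1)
    refine bracketFormula_congr B f z _ _ _ _ (fun k ↦ .refl _ _) (fun k ↦ .of_forall fun y ↦ ?_)
    exact congrFun (map_smul ((B.exists_mem_baseSet (f z)).choose.coord (f y)) (c y) (τ y).1.1) k
  · change _ = X.dirDeriv c z (σ z).1.2 • (τ z).1.2 + c z • (pullBr σ τ z).1.2
    rw [pullBr_snd hσ (hτ.smul hc), pullBr_snd hσ hτ]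
    exact Man.mlieBracket_smul hc.mdiff hτ.2.mdiff

theorem pullBr_const_smul (c : ℝ) (hσ : PullSecAt σ z) (hτ : PullSecAt τ z) :
    pullBr σ (fun y ↦ c • τ y) z = c • pullBr σ τ z := by
  rw [pullBr_smul contMDiffAt_const hσ hτ, Man.dirDeriv_const, zero_smul, zero_add]

theorem pullBr_congr {σ' τ' : ∀ y, pullFiber B f y} (hσ : PullSecAt σ z) (hτ : PullSecAt τ z)
    (h : ∀ᶠ y in 𝓝 z, σ' y = σ y) (h' : ∀ᶠ y in 𝓝 z, τ' y = τ y) :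
    pullBr σ' τ' z = pullBr σ τ z := by
  refine pullFiber_ext ?_ ?_
  · rw [pullBr_fst (hσ.congr h) (hτ.congr h'), pullBr_fst hσ hτ]
    unfold lieAlong
    dsimp only
    rw [h.self_of_nhds, h'.self_of_nhds]
    refine bracketFormula_congr B f z _ _ _ _ (fun k ↦ ?_) (fun k ↦ ?_)
    · filter_upwards [h] with y hy
      rw [hy]
    · filter_upwards [h'] with y hy
      rw [hy]
  · rw [pullBr_snd (hσ.congr h) (hτ.congr h'), pullBr_snd hσ hτ]
    refine Filter.EventuallyEq.mlieBracket_vectorField_eq ?_ ?_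
    · filter_upwards [h] with y hy
      rw [hy]
    · filter_upwards [h'] with y hy
      rw [hy]

theorem pullSecAt_pullBr (hσ : ∀ᶠ y in 𝓝 z, PullSecAt σ y) (hτ : ∀ᶠ y in 𝓝 z, PullSecAt τ y) :
    PullSecAt (pullBr σ τ) z := by
  have hσ' := hσ.self_of_nhds
  have hτ' := hτ.self_of_nhds
  constructor
  · obtain ⟨e, he, hz⟩ := B.exists_mem_baseSet (f z)
    refine (bracketFormula_secAt (V := ⟨e.baseSet, e.isOpen_baseSet⟩) hσ'.2 hτ'.2 hz
      (VBundle.frame he) (VBundle.frame he) (exists_coord he hz hσ'.1).1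
      (exists_coord he hz hτ'.1).1).congr ?_
    filter_upwards [hσ, hτ, (e.isOpen_baseSet.preimage f.contMDiff.continuous).mem_nhds hz]
      with y h1 h2 h3
    exact (pullBr_fst h1 h2).trans (lieAlong_eq_frame h1 h2 he h3)
  · refine (hσ'.2.mlieBracket hτ'.2).congr ?_
    filter_upwards [hσ, hτ] with y h1 h2
    exact pullBr_snd h1 h2

/-- The first component of the bracket of sections of the pullback which project to sections of
`B`. -/
theorem pullBr_fst_of_eq (hσ : PullSecAt σ z) (hτ : PullSecAt τ z) {V : TopologicalSpace.Opens Y}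
    (hV : f z ∈ V) {α β : B.Γ V} (h : ∀ᶠ y in 𝓝 z, (σ y).1.1 = α (f y))
    (h' : ∀ᶠ y in 𝓝 z, (τ y).1.1 = β (f y)) :
    (pullBr σ τ z).1.1 = B.bracket V α β (f z) := by
  rw [pullBr_fst hσ hτ, lieAlong_eq (m := 1) (n := 1) hV (g := fun _ _ ↦ 1) (h := fun _ _ ↦ 1)
    (ξ' := fun _ ↦ α) (ν' := fun _ ↦ β) (fun _ ↦ contMDiffAt_const) (fun _ ↦ contMDiffAt_const)
    (by simpa using h) (by simpa using h') (pullFiber_eq (σ z)) (pullFiber_eq (τ z))]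
  unfold bracketFormula
  simp [Man.dirDeriv_const]

end

end LieAlgebroid

/-! ### The Jacobi identity -/

namespace VBundle

variable {X : Man.{u}} {E : VBundle X} {W : TopologicalSpace.Opens X}

/-- A skew-symmetric bracket which satisfies the Leibniz rule and is compatible with the anchor
satisfies the Jacobi identity as soon as it does so on sections which generate all sections over the
functions: the Jacobiator is skew-symmetric and linear over the functions. -/
theorem jacobi_of_generators {anchor : ∀ x, E.Fiber x →ₗ[ℝ] TangentSpace (𝓡 X.dim) x}
    (hanchor : ∀ (σ : E.Γ W), ∀ x ∈ W, Man.VecAt (fun y : X ↦ y) (fun y ↦ anchor y (σ y)) x)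
    (br : E.Γ W →ₗ[ℝ] E.Γ W →ₗ[ℝ] E.Γ W) (skew : ∀ ξ ν, br ξ ν = -br ν ξ)
    (anchor_br : ∀ ξ ν, ∀ x ∈ W, anchor x (br ξ ν x) =
      VectorField.mlieBracket (𝓡 X.dim) (fun y ↦ anchor y (ξ y)) (fun y ↦ anchor y (ν y)) x)
    (leibniz : ∀ (ξ ν : E.Γ W) (h : X → ℝ) (hh : ∀ x ∈ W, X.SmoothAt h x), ∀ x ∈ W,
      br ξ (smul h hh ν) x = X.dirDeriv h x (anchor x (ξ x)) • ν x + h x • br ξ ν x)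
    (P : E.Γ W → Prop)
    (hP : ∀ ξ ν ζ, P ξ → P ν → P ζ → br ξ (br ν ζ) = br (br ξ ν) ζ + br ν (br ξ ζ))
    (gen : ∀ σ, ∃ (n : ℕ) (a : Fin n → X → ℝ) (ha : ∀ k, ∀ x ∈ W, X.SmoothAt (a k) x)
      (s : Fin n → E.Γ W) (κ : E.Γ W), (∀ k, P (s k)) ∧ P κ ∧
        σ = ∑ k, smul (a k) (ha k) (s k) + κ) (ξ ν ζ : E.Γ W) :
    br ξ (br ν ζ) = br (br ξ ν) ζ + br ν (br ξ ζ) := by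
  let J : E.Γ W → E.Γ W → E.Γ W →ₗ[ℝ] E.Γ W := fun ξ ν ↦
    (br ξ).comp (br ν) - br (br ξ ν) - (br ν).comp (br ξ)
  have hJ : ∀ ξ ν ζ, J ξ ν ζ = br ξ (br ν ζ) - br (br ξ ν) ζ - br ν (br ξ ζ) := fun _ _ _ ↦ rfl
  have hD : ∀ (ξ : E.Γ W) {h : X → ℝ}, (∀ x ∈ W, X.SmoothAt h x) → ∀ x ∈ W,
      X.SmoothAt (fun y ↦ X.dirDeriv h y (anchor y (ξ y))) x := fun ξ h hh x hx ↦
    (hanchor ξ x hx).smoothAt_dirDeriv (hh x hx)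
  have leibniz' : ∀ (ξ ν : E.Γ W) (h : X → ℝ) (hh : ∀ x ∈ W, X.SmoothAt h x),
      br ξ (smul h hh ν) = smul _ (hD ξ hh) ν + smul h hh (br ξ ν) := fun ξ ν h hh ↦
    section_ext fun x hx ↦ leibniz ξ ν h hh x hx
  have smul_J : ∀ ξ ν ζ (h : X → ℝ) (hh : ∀ x ∈ W, X.SmoothAt h x), J ξ ν ζ = 0 →
      J ξ ν (smul h hh ζ) = 0 := by
    intro ξ ν ζ h hh h0
    refine section_ext fun x hx ↦ ?_
    have h1 : ∀ ξ ν : E.Γ W, br ξ (br ν (smul h hh ζ)) x =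
        X.dirDeriv (fun y ↦ X.dirDeriv h y (anchor y (ν y))) x (anchor x (ξ x)) • ζ x +
          X.dirDeriv h x (anchor x (ν x)) • br ξ ζ x +
          (X.dirDeriv h x (anchor x (ξ x)) • br ν ζ x + h x • br ξ (br ν ζ) x) := by
      intro ξ ν
      rw [leibniz', map_add]
      exact congrArg₂ (· + ·) (leibniz ξ ζ _ (hD ν hh) x hx) (leibniz ξ (br ν ζ) h hh x hx)
    have h2 := congrArg (fun σ : E.Γ W ↦ σ x) h0
    change br ξ (br ν ζ) x - br (br ξ ν) ζ x - br ν (br ξ ζ) x = 0 at h2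
    change br ξ (br ν (smul h hh ζ)) x - br (br ξ ν) (smul h hh ζ) x -
      br ν (br ξ (smul h hh ζ)) x = 0
    rw [h1, h1, leibniz _ _ _ _ _ hx, anchor_br _ _ _ hx,
      Man.dirDeriv_mlieBracket (hanchor ξ x hx) (hanchor ν x hx) (hh x hx)]
    have h3 : h x • (br ξ (br ν ζ) x - br (br ξ ν) ζ x - br ν (br ξ ζ) x) = 0 := by
      rw [h2, smul_zero]
    rw [smul_sub, smul_sub] at h3
    rw [sub_smul, ← h3]
    abel
  have J_of_P : ∀ ξ ν, (∀ ζ, P ζ → J ξ ν ζ = 0) → ∀ ζ, J ξ ν ζ = 0 := by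
    intro ξ ν h ζ
    obtain ⟨n, a, ha, s, κ, hs, hκ, rfl⟩ := gen ζ
    rw [map_add, map_sum, h κ hκ, add_zero]
    exact Finset.sum_eq_zero fun k _ ↦ smul_J _ _ _ _ _ (h _ (hs k))
  have swap₁ : ∀ ξ ν ζ, J ξ ν ζ = 0 → J ν ξ ζ = 0 := by
    intro ξ ν ζ h
    rw [hJ] at h ⊢
    rw [skew ν ξ, map_neg, LinearMap.neg_apply, ← neg_eq_zero, ← h]
    abel
  have swap₂ : ∀ ξ ν ζ, J ξ ν ζ = 0 → J ξ ζ ν = 0 := by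
    intro ξ ν ζ h
    rw [hJ] at h ⊢
    rw [skew ζ ν, skew (br ξ ζ) ν, skew ζ (br ξ ν), map_neg, ← neg_eq_zero, ← h]
    abel
  have h1 : ∀ ξ ν, P ξ → P ν → ∀ ζ, J ξ ν ζ = 0 := fun ξ ν hξ hν ↦ J_of_P ξ ν fun ζ hζ ↦ by
    rw [hJ, hP ξ ν ζ hξ hν hζ]
    abel
  have h2 : ∀ ξ, P ξ → ∀ ν ζ, J ξ ν ζ = 0 := fun ξ hξ ν ↦ J_of_P ξ ν fun ζ hζ ↦
    swap₂ _ _ _ (h1 ξ ζ hξ hζ ν)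
  have h3 : J ξ ν ζ = 0 := J_of_P ξ ν (fun ζ hζ ↦
    swap₂ _ _ _ (swap₁ _ _ _ (h2 ζ hζ ξ ν))) ζ
  rw [hJ, sub_sub, sub_eq_zero] at h3
  exact h3

end VBundle

namespace Man

/-- Smooth vector fields along a submersion lift locally. -/
theorem exists_lift {X Y : Man.{u}} (f : X ⟶ Y) (x₀ : X)
    (hf : Function.Surjective (dMap f x₀)) : ∃ N : Set X, IsOpen N ∧ x₀ ∈ N ∧
      ∃ L : ∀ x, TangentSpace (𝓡 Y.dim) (f x) →L[ℝ] TangentSpace (𝓡 X.dim) x, ∀ x ∈ N,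
        (∀ v, dMap f x (L x v) = v) ∧ ∀ v : ∀ x, TangentSpace (𝓡 Y.dim) (f x),
          VecAt (fun y ↦ f y) v x → VecAt (fun y : X ↦ y) (fun y ↦ L y (v y)) x := by
  let D : Set X := {x | f x ∈ tdom (f x₀) ∧ x ∈ tdom x₀}
  have hD : IsOpen D := ((isOpen_tdom (f x₀)).preimage f.contMDiff.continuous).inter
    (isOpen_tdom x₀)
  let M : X → EuclideanSpace ℝ (Fin X.dim) →L[ℝ] EuclideanSpace ℝ (Fin Y.dim) := fun x ↦
    (tc (f x₀) (f x)).comp ((dMap f x).comp (tcs x₀ x))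
  have htcs : ∀ x ∈ D, ∀ {s : X → EuclideanSpace ℝ (Fin X.dim)}, SmoothAt s x →
      VecAt (fun y : X ↦ y) (fun y ↦ tcs x₀ y (s y)) x := fun x hx s hs ↦
    (vecAt_iff hx.2).2 ⟨contMDiffAt_id, hs.congr_of_eventuallyEq
      (by filter_upwards [(isOpen_tdom x₀).mem_nhds hx.2] with y hy using tc_tcs hy _)⟩
  have hM : ∀ x ∈ D, SmoothAt M x := fun x hx ↦ smoothAt_clm fun v ↦
    ((vecAt_iff hx.1).1 ((htcs x hx (contMDiffAt_const (c := v))).dMap f)).2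
  have hMs : Function.Surjective (M x₀) := fun w ↦ by
    obtain ⟨v, hv⟩ := hf (tcs (f x₀) (f x₀) w)
    refine ⟨tc x₀ x₀ v, ?_⟩
    change tc (f x₀) (f x₀) (dMap f x₀ (tcs x₀ x₀ (tc x₀ x₀ v))) = w
    rw [tcs_tc (mem_tdom _), hv, tc_tcs (mem_tdom _)]
  obtain ⟨R', hR'⟩ := LinearMap.exists_rightInverse_of_surjective (M x₀).toLinearMap
    (LinearMap.range_eq_top.2 hMs)
  let R := LinearMap.toContinuousLinearMap R'
  let G : X → EuclideanSpace ℝ (Fin Y.dim) →L[ℝ] EuclideanSpace ℝ (Fin Y.dim) :=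
    fun x ↦ (M x).comp R
  have hG : ∀ x ∈ D, SmoothAt G x := fun x hx ↦ smoothAt_clm fun v ↦
    (hM x hx).clm_apply (contMDiffAt_const (c := R v))
  have hG₀ : G x₀ = 1 := ContinuousLinearMap.ext fun v ↦ LinearMap.congr_fun hR' v
  let N : Set X := {x | x ∈ D ∧ IsUnit (G x)}
  have hN : IsOpen N := isOpen_iff_mem_nhds.2 fun x hx ↦ Filter.inter_mem (hD.mem_nhds hx.1)
    ((hG x hx.1).continuousAt.eventually (Units.isOpen.mem_nhds hx.2))
  refine ⟨N, hN, ⟨⟨mem_tdom _, mem_tdom _⟩, hG₀ ▸ isUnit_one⟩, fun x ↦ (tcs x₀ x).comp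
    (R.comp ((Ring.inverse (G x)).comp (tc (f x₀) (f x)))), fun x hx ↦ ⟨fun v ↦ ?_, fun v hv ↦ ?_⟩⟩
  · have h1 : G x (Ring.inverse (G x) (tc (f x₀) (f x) v)) = tc (f x₀) (f x) v :=
      congrArg (fun L : EuclideanSpace ℝ (Fin Y.dim) →L[ℝ] EuclideanSpace ℝ (Fin Y.dim) ↦
        L (tc (f x₀) (f x) v)) (Ring.mul_inverse_cancel _ hx.2)
    refine (tcs_tc hx.1.1 _).symm.trans (Eq.trans ?_ (tcs_tc hx.1.1 v))
    exact congrArg (tcs (f x₀) (f x)) h1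
  · refine htcs x hx.1 (R.contMDiff.contMDiffAt.comp x ?_)
    exact ((hG x hx.1).ringInverse hx.2).clm_apply ((vecAt_iff hx.1.1).1 hv).2

end Man

/-! ### The pullback along a submersion -/

namespace LieAlgebroid

variable {X Y : Man.{u}} {B : LieAlgebroid Y} {f : X ⟶ Y} {hf : Man.submersion f}
  {U : TopologicalSpace.Opens X}

theorem pullSecAt_of_mem (σ : (pullBundle B f hf).Γ U) {x : X} (hx : x ∈ U) :
    PullSecAt (B := B) (f := f) σ.1 x :=
  secAt_pullBundle_iff.1 (VBundle.secAt_of_mem_Γ σ hx)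

theorem eventually_pullSecAt (σ : (pullBundle B f hf).Γ U) {x : X} (hx : x ∈ U) :
    ∀ᶠ y in 𝓝 x, PullSecAt (B := B) (f := f) σ.1 y := by
  filter_upwards [U.isOpen.mem_nhds hx] with y hy using pullSecAt_of_mem σ hy

/-- The section of the pullback over `U` with given values. -/
noncomputable def pullSection (hf : Man.submersion f) (U : TopologicalSpace.Opens X)
    (σ : ∀ y, pullFiber B f y) (hσ : ∀ x ∈ U, PullSecAt σ x) : (pullBundle B f hf).Γ U :=
  VBundle.sectionOn (E := pullBundle B f hf) U σ fun e he x hx hx' ↦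
    ((secAt_pullBundle_iff (hf := hf)).2 (hσ x hx)).2 e he hx'

theorem pullSection_apply {σ : ∀ y, pullFiber B f y} {hσ : ∀ x ∈ U, PullSecAt σ x} {x : X}
    (hx : x ∈ U) : (pullSection hf U σ hσ).1 x = σ x := VBundle.sectionOn_apply hx

/-- The bracket of sections of the pullback. -/
noncomputable def pullBracket (σ τ : (pullBundle B f hf).Γ U) : (pullBundle B f hf).Γ U :=
  pullSection hf U (pullBr (B := B) (f := f) σ.1 τ.1) fun _ hx ↦
    pullSecAt_pullBr (eventually_pullSecAt σ hx) (eventually_pullSecAt τ hx)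

theorem pullBracket_apply (σ τ : (pullBundle B f hf).Γ U) {x : X} (hx : x ∈ U) :
    (pullBracket σ τ).1 x = pullBr (B := B) (f := f) σ.1 τ.1 x := pullSection_apply hx

theorem pullBracket_skew (σ τ : (pullBundle B f hf).Γ U) :
    pullBracket σ τ = -pullBracket τ σ := by
  refine VBundle.section_ext fun x hx ↦ (pullBracket_apply σ τ hx).trans ?_
  refine (pullBr_skew (pullSecAt_of_mem σ hx) (pullSecAt_of_mem τ hx)).trans ?_
  exact congrArg Neg.neg (pullBracket_apply τ σ hx).symm

theorem pullBracket_add (σ τ ρ : (pullBundle B f hf).Γ U) :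
    pullBracket σ (τ + ρ) = pullBracket σ τ + pullBracket σ ρ := by
  refine VBundle.section_ext fun x hx ↦ (pullBracket_apply _ _ hx).trans ?_
  refine (pullBr_add (pullSecAt_of_mem σ hx) (pullSecAt_of_mem τ hx)
    (pullSecAt_of_mem ρ hx)).trans ?_
  exact (congrArg₂ (· + ·) (pullBracket_apply σ τ hx) (pullBracket_apply σ ρ hx)).symm

theorem pullBracket_smul (c : ℝ) (σ τ : (pullBundle B f hf).Γ U) :
    pullBracket σ (c • τ) = c • pullBracket σ τ := by
  refine VBundle.section_ext fun x hx ↦ (pullBracket_apply _ _ hx).trans ?_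
  refine (pullBr_const_smul c (pullSecAt_of_mem σ hx) (pullSecAt_of_mem τ hx)).trans ?_
  exact (congrArg (c • ·) (pullBracket_apply σ τ hx)).symm

/-- The bracket of sections of the pullback, as a bilinear map. -/
noncomputable def pullBracketₗ (B : LieAlgebroid Y) (f : X ⟶ Y) (hf : Man.submersion f)
    (U : TopologicalSpace.Opens X) : (pullBundle B f hf).Γ U →ₗ[ℝ] (pullBundle B f hf).Γ U →ₗ[ℝ]
      (pullBundle B f hf).Γ U :=
  LinearMap.mk₂ ℝ pullBracket
    (fun σ τ ρ ↦ by
      rw [pullBracket_skew, pullBracket_add, pullBracket_skew σ, pullBracket_skew τ, neg_add])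
    (fun c σ τ ↦ by
      rw [pullBracket_skew, pullBracket_smul, pullBracket_skew σ, smul_neg])
    pullBracket_add pullBracket_smul

theorem pullBracket_leibniz (σ τ : (pullBundle B f hf).Γ U) (h : X → ℝ)
    (hh : ∀ x ∈ U, X.SmoothAt h x) {x : X} (hx : x ∈ U) :
    (pullBracket σ (VBundle.smul h hh τ)).1 x =
      X.dirDeriv h x (pullSnd B f x (σ.1 x)) • τ.1 x + h x • (pullBracket σ τ).1 x := by
  refine (pullBracket_apply _ _ hx).trans ?_
  refine (pullBr_smul (hh x hx) (pullSecAt_of_mem σ hx) (pullSecAt_of_mem τ hx)).trans ?_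
  exact congrArg (fun b ↦ X.dirDeriv h x (pullSnd B f x (σ.1 x)) • τ.1 x + h x • b)
    (pullBracket_apply σ τ hx).symm

theorem pullBracket_snd (σ τ : (pullBundle B f hf).Γ U) {x : X} (hx : x ∈ U) :
    pullSnd B f x ((pullBracket σ τ).1 x) = VectorField.mlieBracket (𝓡 X.dim)
      (fun y ↦ pullSnd B f y (σ.1 y)) (fun y ↦ pullSnd B f y (τ.1 y)) x := by
  refine (congrArg (pullSnd B f x) (pullBracket_apply σ τ hx)).trans ?_
  exact pullBr_snd (pullSecAt_of_mem σ hx) (pullSecAt_of_mem τ hx)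

theorem pullBracket_fst (σ τ : (pullBundle B f hf).Γ U) {V : TopologicalSpace.Opens Y}
    (hUV : ∀ x ∈ U, f x ∈ V) {α β : B.Γ V} (h : ∀ x ∈ U, pullFst B f x (σ.1 x) = α (f x))
    (h' : ∀ x ∈ U, pullFst B f x (τ.1 x) = β (f x)) {x : X} (hx : x ∈ U) :
    pullFst B f x ((pullBracket σ τ).1 x) = B.bracket V α β (f x) := by
  refine (congrArg (pullFst B f x) (pullBracket_apply σ τ hx)).trans ?_
  refine pullBr_fst_of_eq (pullSecAt_of_mem σ hx) (pullSecAt_of_mem τ hx) (hUV x hx) ?_ ?_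
  · filter_upwards [U.isOpen.mem_nhds hx] with y hy using h y hy
  · filter_upwards [U.isOpen.mem_nhds hx] with y hy using h' y hy

theorem pullBracket_res {V : TopologicalSpace.Opens X} (h : V ≤ U)
    (σ τ : (pullBundle B f hf).Γ U) :
    pullBracket (VBundle.res h σ) (VBundle.res h τ) = VBundle.res h (pullBracket σ τ) := by
  refine VBundle.section_ext fun x hx ↦ ?_
  refine (pullBracket_apply _ _ hx).trans (Eq.trans ?_ (VBundle.res_apply hx).symm)
  refine Eq.trans ?_ (pullBracket_apply σ τ (h hx)).symm
  refine pullBr_congr (pullSecAt_of_mem σ (h hx)) (pullSecAt_of_mem τ (h hx)) ?_ ?_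
  · filter_upwards [V.isOpen.mem_nhds hx] with y hy using VBundle.res_apply hy
  · filter_upwards [V.isOpen.mem_nhds hx] with y hy using VBundle.res_apply hy

open Classical in
/-- The Jacobi identity near a point. It suffices to check it on the sections of the pullback which
project to sections of `B`; they generate all sections because the frames of `B` lift. -/
theorem exists_pullBracket_jacobi (B : LieAlgebroid Y) (f : X ⟶ Y) (hf : Man.submersion f)
    (x₀ : X) :
    ∃ N : Set X, IsOpen N ∧ x₀ ∈ N ∧ ∀ W : TopologicalSpace.Opens X, (W : Set X) ⊆ N →
      ∀ ξ ν ζ : (pullBundle B f hf).Γ W, pullBracket ξ (pullBracket ν ζ) =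
        pullBracket (pullBracket ξ ν) ζ + pullBracket ν (pullBracket ξ ζ) := by
  obtain ⟨e, he, hx₀⟩ := B.exists_mem_baseSet (f x₀)
  obtain ⟨N, hN, hx₀N, L, hL⟩ := Man.exists_lift f x₀ (hf x₀)
  let V : TopologicalSpace.Opens Y := ⟨e.baseSet, e.isOpen_baseSet⟩
  refine ⟨N ∩ f ⁻¹' e.baseSet, hN.inter (e.isOpen_baseSet.preimage f.contMDiff.continuous),
    ⟨hx₀N, hx₀⟩, fun W hW ξ ν ζ ↦ ?_⟩
  have hWV : ∀ x ∈ W, f x ∈ V := fun x hx ↦ (hW hx).2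
  refine VBundle.jacobi_of_generators (E := pullBundle B f hf) (anchor := pullSnd B f)
    (fun σ x hx ↦ (pullSecAt_of_mem σ hx).2) (pullBracketₗ B f hf W) pullBracket_skew
    (fun ξ ν x hx ↦ pullBracket_snd ξ ν hx)
    (fun ξ ν h hh x hx ↦ pullBracket_leibniz ξ ν h hh hx)
    (fun σ ↦ ∃ α : B.Γ V, ∀ x ∈ W, pullFst B f x (σ.1 x) = α (f x)) ?_ ?_ ξ ν ζ
  · rintro ξ ν ζ ⟨α, hα⟩ ⟨β, hβ⟩ ⟨γ, hγ⟩
    refine VBundle.section_ext fun x hx ↦ pullFiber_ext ?_ ?_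
    · have h1 := fun x hx ↦ pullBracket_fst ξ ν hWV hα hβ (x := x) hx
      have h2 := fun x hx ↦ pullBracket_fst ν ζ hWV hβ hγ (x := x) hx
      have h3 := fun x hx ↦ pullBracket_fst ξ ζ hWV hα hγ (x := x) hx
      refine (pullBracket_fst ξ _ hWV hα h2 hx).trans ?_
      rw [B.jacobi]
      exact (congrArg₂ (· + ·) (pullBracket_fst _ ζ hWV h1 hγ hx)
        (pullBracket_fst ν _ hWV hβ h3 hx)).symm
    · have h1 : ∀ (ξ ν ζ : (pullBundle B f hf).Γ W), pullSnd B f x ((pullBracket ξ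
          (pullBracket ν ζ)).1 x) = VectorField.mlieBracket (𝓡 X.dim)
              (fun y ↦ pullSnd B f y (ξ.1 y))
            (VectorField.mlieBracket (𝓡 X.dim) (fun y ↦ pullSnd B f y (ν.1 y))
              (fun y ↦ pullSnd B f y (ζ.1 y))) x := fun ξ ν ζ ↦ by
        refine (pullBracket_snd _ _ hx).trans
          (Filter.EventuallyEq.mlieBracket_vectorField_eq (.refl _ _) ?_)
        filter_upwards [W.isOpen.mem_nhds hx] with y hy using pullBracket_snd ν ζ hy
      have h2 : pullSnd B f x ((pullBracket (pullBracket ξ ν) ζ).1 x) =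
          VectorField.mlieBracket (𝓡 X.dim) (VectorField.mlieBracket (𝓡 X.dim)
            (fun y ↦ pullSnd B f y (ξ.1 y)) (fun y ↦ pullSnd B f y (ν.1 y)))
              (fun y ↦ pullSnd B f y (ζ.1 y)) x := by
        refine (pullBracket_snd _ _ hx).trans
          (Filter.EventuallyEq.mlieBracket_vectorField_eq ?_ (.refl _ _))
        filter_upwards [W.isOpen.mem_nhds hx] with y hy using pullBracket_snd ξ ν hy
      refine (h1 ξ ν ζ).trans ?_
      refine (Man.mlieBracket_jacobi (pullSecAt_of_mem ξ hx).2 (pullSecAt_of_mem ν hx).2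
        (pullSecAt_of_mem ζ hx).2).trans ?_
      exact (congrArg₂ (· + ·) h2 (h1 ν ξ ζ)).symm
  · intro σ
    let s₀ : Fin e.rank → ∀ x, pullFiber B f x := fun k x ↦
      if hx : x ∈ N then ⟨(VBundle.frame he k (f x), L x
          (B.anchor (f x) (VBundle.frame he k (f x)))),
        ((hL x hx).1 _).symm⟩ else 0
    have hs₀ : ∀ k, ∀ x ∈ N, (s₀ k x).1 =
        (VBundle.frame he k (f x), L x (B.anchor (f x) (VBundle.frame he k (f x)))) := fun k x hx ↦
      congrArg Subtype.val (dif_pos hx)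
    let s : Fin e.rank → (pullBundle B f hf).Γ W := fun k ↦ pullSection hf W (s₀ k) fun x hx ↦ by
      have h1 := (VBundle.secAt_of_mem_Γ (VBundle.frame he k) (hWV x hx)).comp (f.contMDiff x)
      have hN' := hN.mem_nhds (hW hx).1
      exact ⟨h1.congr (by filter_upwards [hN'] with y hy using congrArg Prod.fst (hs₀ k y hy)),
        ((hL x (hW hx).1).2 _ h1.anchor).congr (by
          filter_upwards [hN'] with y hy using congrArg Prod.snd (hs₀ k y hy))⟩
    have hs : ∀ k, ∀ x ∈ W, pullFst B f x ((s k).1 x) = VBundle.frame he k (f x) := fun k x hx ↦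
      (congrArg (pullFst B f x) (pullSection_apply hx)).trans
        (congrArg Prod.fst (hs₀ k x (hW hx).1))
    have ha : ∀ k, ∀ x ∈ W, X.SmoothAt (fun y ↦ e.coord (f y) (pullFst B f y (σ.1 y)) k) x :=
      fun k x hx ↦ (exists_coord he (hWV x hx) (pullSecAt_of_mem σ hx).1).1 k
    refine ⟨e.rank, _, ha, s, σ - ∑ k, VBundle.smul _ (ha k) (s k), fun k ↦
      ⟨VBundle.frame he k, hs k⟩, ⟨0, fun x hx ↦ ?_⟩, (add_sub_cancel _ _).symm⟩
    have h1 : (σ - ∑ k, VBundle.smul _ (ha k) (s k)).1 x = σ.1 x -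
        ∑ k, e.coord (f x) (pullFst B f x (σ.1 x)) k • (s k).1 x :=
      congrArg (σ.1 x - ·) (VBundle.sum_apply _ _ _)
    refine (congrArg (pullFst B f x) h1).trans ?_
    refine (map_sub (pullFst B f x) _ _).trans (sub_eq_zero.2 ?_)
    refine Eq.trans ?_ (map_sum (pullFst B f x) _ _).symm
    refine (VBundle.eq_sum_frame he (hWV x hx) _).trans (Finset.sum_congr rfl fun k _ ↦ ?_)
    exact ((map_smul (pullFst B f x) _ _).trans (congrArg _ (hs k x hx))).symm

/-- The pullback of a Lie algebroid along a submersion: its fibre product with the tangent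
bundle. -/
noncomputable def pullback (B : LieAlgebroid Y) (f : X ⟶ Y) (hf : Man.submersion f) :
    LieAlgebroid X where
  toVBundle := pullBundle B f hf
  anchor := pullSnd B f
  smooth_anchor t ht v x hx := (ht v x hx).2.contMDiffWithinAt
  bracket := pullBracketₗ B f hf
  bracket_res h σ τ := pullBracket_res h σ τ
  bracket_self U σ := VBundle.section_ext fun x hx ↦
    (pullBracket_apply σ σ hx).trans (pullBr_self (pullSecAt_of_mem σ hx))
  jacobi U σ τ ρ := by
    refine VBundle.section_ext fun x hx ↦ ?_
    obtain ⟨N, hN, hxN, h⟩ := exists_pullBracket_jacobi B f hf x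
    let W : TopologicalSpace.Opens X := U ⊓ ⟨N, hN⟩
    have hWU : W ≤ U := inf_le_left
    have hxW : x ∈ W := ⟨hx, hxN⟩
    have h1 := congrArg (fun σ : (pullBundle B f hf).Γ W ↦ σ.1 x) (h W (fun y hy ↦ hy.2)
      (VBundle.res hWU σ) (VBundle.res hWU τ) (VBundle.res hWU ρ))
    simp only [pullBracket_res] at h1
    refine ((VBundle.res_apply hxW).symm.trans h1).trans ?_
    exact congrArg₂ (fun a b : pullFiber B f x ↦ a + b)
      (VBundle.res_apply (σ := pullBracket (pullBracket σ τ) ρ) hxW)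
      (VBundle.res_apply (σ := pullBracket τ (pullBracket σ ρ)) hxW)
  anchor_bracket U σ τ x hx := pullBracket_snd σ τ hx
  leibniz U σ τ h hh x hx := pullBracket_leibniz σ τ h hh hx

/-- The projection from the pullback. -/
noncomputable def pullbackHom (B : LieAlgebroid Y) (f : X ⟶ Y) (hf : Man.submersion f) :
    Hom (B.pullback f hf) B f where
  toFun := pullFst B f
  smooth t ht e' he' v x hx := ((ht v x hx.1).1.2 e' he' hx.2).contMDiffWithinAt
  anchor_comm x a := pullFiber_eq a
  map_bracket U ξ ν x hU V hV m n g ξ' h ν' hg hh hξ hν := by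
    refine (congrArg (pullFst B f x) (pullBracket_apply ξ ν hU)).trans ?_
    refine (pullBr_fst (pullSecAt_of_mem ξ hU) (pullSecAt_of_mem ν hU)).trans ?_
    exact lieAlong_eq hV hg hh hξ hν (pullFiber_eq (B := B) (f := f) (ξ.1 x))
      (pullFiber_eq (B := B) (f := f) (ν.1 x))

theorem isCart_pullbackHom (B : LieAlgebroid Y) (f : X ⟶ Y) (hf : Man.submersion f) :
    (B.pullbackHom f hf).IsCart where
  inj _ _ h h' := pullFiber_ext h h'
  surj _ b v h := ⟨⟨(b, v), h⟩, rfl, rfl⟩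

end LieAlgebroid

/-! ### Étale maps -/

namespace Man

variable {X Y Z : Man.{u}} {f : X ⟶ Y}

theorem IsEtale.exists_localInverse (hf : IsEtale f) (x : X) :
    ∃ (N : Set Y) (s : Y → X), IsOpen N ∧ f x ∈ N ∧ s (f x) = x ∧
      ∀ y ∈ N, f (s y) = y ∧ ContMDiffAt (𝓡 Y.dim) (𝓡 X.dim) ∞ s y ∧
        ∀ᶠ x' in 𝓝 (s y), s (f x') = x' := by
  have h := hf x
  refine ⟨h.localInverse.source, h.localInverse, h.localInverse_open_source,
    h.localInverse_mem_source, h.localInverse_left_inv h.localInverse_mem_target,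
    fun y hy ↦ ⟨h.localInverse_right_inv hy, h.contmdiffOn_localInverse.contMDiffAt
      (h.localInverse_open_source.mem_nhds hy), ?_⟩⟩
  filter_upwards [h.localInverse.open_target.mem_nhds (h.localInverse.map_source hy)] with x' hx'
  exact h.localInverse_left_inv hx'

theorem IsEtale.dMap_bijective (hf : IsEtale f) (x : X) : Function.Bijective (dMap f x) := by
  have h := (hf x).mfderivToContinuousLinearEquiv_coe (by simp)
  have h2 : dMap f x = ((hf x).mfderivToContinuousLinearEquiv (by simp) :
    TangentSpace (𝓡 X.dim) x →L[ℝ] TangentSpace (𝓡 Y.dim) (f x)) := h.symm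
  rw [h2]
  exact ((hf x).mfderivToContinuousLinearEquiv (by simp)).bijective

theorem IsEtale.submersion (hf : IsEtale f) : Man.submersion f := fun x ↦ (hf.dMap_bijective x).2

theorem IsEtale.comp (hf : IsEtale f) {g : Y ⟶ Z} (hg : IsEtale g) : IsEtale (f ≫ g) :=
  fun x ↦ IsLocalDiffeomorphAt.comp (K := 𝓡 Z.dim) (P := Z.carrier) (hf x) (hg (f x))

/-- Smoothness can be checked after an étale map. -/
theorem IsEtale.contMDiffAt_iff (hf : IsEtale f) {E H M : Type*} [NormedAddCommGroup E]
    [NormedSpace ℝ E] [TopologicalSpace H] {I : ModelWithCorners ℝ E H} [TopologicalSpace M]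
    [ChartedSpace H M] {h : Y → M} {x : X} :
    ContMDiffAt (𝓡 X.dim) I ∞ (fun y ↦ h (f y)) x ↔ ContMDiffAt (𝓡 Y.dim) I ∞ h (f x) := by
  refine ⟨fun hh ↦ ?_, fun hh ↦ hh.comp x (f.contMDiff x)⟩
  obtain ⟨N, s, hN, hx, hs, hsN⟩ := hf.exists_localInverse x
  have h1 : ContMDiffAt (𝓡 Y.dim) I ∞ (fun y ↦ h (f (s y))) (f x) :=
    ContMDiffAt.comp (g := fun x ↦ h (f x)) (f x) (by rw [hs]; exact hh) (hsN _ hx).2.1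
  refine h1.congr_of_eventuallyEq ?_
  filter_upwards [hN.mem_nhds hx] with y hy
  rw [(hsN y hy).1]

theorem IsEtale.vecAt_iff (hf : IsEtale f) {v : ∀ y, TangentSpace (𝓡 Y.dim) y} {x : X} :
    VecAt (fun x ↦ f x) (fun x ↦ v (f x)) x ↔ VecAt (fun y : Y ↦ y) v (f x) :=
  hf.contMDiffAt_iff (h := fun y ↦ (⟨y, v y⟩ : TangentBundle (𝓡 Y.dim) Y))

/-- A vector field is smooth if its image by the derivative of an étale map is. -/
theorem IsEtale.vecAt_of_dMap (hf : IsEtale f) {v : ∀ x, TangentSpace (𝓡 X.dim) x} {x : X}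
    (h : VecAt (fun x ↦ f x) (fun x ↦ dMap f x (v x)) x) : VecAt (fun x : X ↦ x) v x := by
  obtain ⟨N, hN, hx, L, hL⟩ := exists_lift f x (hf.submersion x)
  refine ((hL x hx).2 _ h).congr ?_
  filter_upwards [hN.mem_nhds hx] with y hy
  exact (hf.dMap_bijective y).1 ((hL y hy).1 _).symm

theorem IsEtale.secAt_iff (hf : IsEtale f) {E : VBundle Y} {a : ∀ y, E.Fiber y} {x : X} :
    E.SecAt (fun x ↦ f x) (fun x ↦ a (f x)) x ↔ E.SecAt (fun y : Y ↦ y) a (f x) := by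
  refine and_congr ?_ (forall_congr' fun e ↦ forall_congr' fun _ ↦ forall_congr' fun _ ↦ ?_)
  · exact iff_of_true (f.contMDiff x) contMDiffAt_id
  · exact hf.contMDiffAt_iff (h := fun y ↦ e.coord y (a y))

theorem IsEtale.eventually (hf : IsEtale f) {p : Y → Prop} {x : X} :
    (∀ᶠ x' in 𝓝 x, p (f x')) ↔ ∀ᶠ y in 𝓝 (f x), p y := by
  refine ⟨fun h ↦ ?_, fun h ↦ (f.contMDiff.continuous.tendsto x).eventually h⟩
  obtain ⟨N, s, hN, hx, hs, hsN⟩ := hf.exists_localInverse x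
  have h1 : ∀ᶠ y in 𝓝 (f x), p (f (s y)) :=
    (hsN _ hx).2.1.continuousAt.eventually (by rw [hs]; exact h)
  filter_upwards [h1, hN.mem_nhds hx] with y h2 hy
  rwa [(hsN y hy).1] at h2

end Man

/-! ### Cartesian morphisms over étale maps -/

namespace LieAlgebroid

variable {X Y Z : Man.{u}} {A : LieAlgebroid X} {B : LieAlgebroid Y} {C : LieAlgebroid Z}
  {f : X ⟶ Y} {φ : Hom A B f}

theorem Hom.IsCart.bijective (hφ : φ.IsCart) (hf : Man.IsEtale f) (x : X) :
    Function.Bijective (φ.toFun x) := by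
  refine ⟨(injective_iff_map_eq_zero _).2 fun a ha ↦ hφ.inj x a ha
    ((hf.dMap_bijective x).1 ?_), fun b ↦ ?_⟩
  · rw [← φ.anchor_comm, ha, map_zero, map_zero]
  · obtain ⟨v, hv⟩ := (hf.dMap_bijective x).2 (B.anchor (f x) b)
    obtain ⟨a, ha, -⟩ := hφ.surj x b v hv.symm
    exact ⟨a, ha⟩

theorem Hom.isCart_of_bijective (hf : Man.IsEtale f)
    (h : ∀ x, Function.Bijective (φ.toFun x)) : φ.IsCart where
  inj x a ha _ := (h x).1 (ha.trans (map_zero _).symm)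
  surj x b v hv := by
    obtain ⟨a, rfl⟩ := (h x).2 b
    exact ⟨a, rfl, (hf.dMap_bijective x).1 ((φ.anchor_comm x a).symm.trans hv)⟩

/-- Over an étale map, a section of the domain of a cartesian morphism is smooth if its image is. -/
theorem Hom.IsCart.secAt_of_etale (hφ : φ.IsCart) (hf : Man.IsEtale f) {a : ∀ x, A.Fiber x} {x : X}
    (h : B.SecAt (fun x ↦ f x) (fun x ↦ φ.toFun x (a x)) x) : A.SecAt (fun x : X ↦ x) a x :=
  hφ.secAt h (hf.vecAt_of_dMap (h.anchor.congr (.of_forall fun y ↦ (φ.anchor_comm y (a y)).symm)))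

/-- The preimage of an open subset. -/
def _root_.Man.preim (f : X ⟶ Y) (V : TopologicalSpace.Opens Y) : TopologicalSpace.Opens X :=
  ⟨f ⁻¹' V, V.isOpen.preimage f.contMDiff.continuous⟩

/-- The pullback of sections by a cartesian morphism over an étale map. -/
theorem Hom.IsCart.exists_pullSec (hφ : φ.IsCart) (hf : Man.IsEtale f)
    {V : TopologicalSpace.Opens Y} (σ : B.Γ V) :
    ∃ τ : A.Γ (Man.preim f V), ∀ x, φ.toFun x (τ x) = σ (f x) := by
  choose τ hτ using fun x ↦ (hφ.bijective hf x).2 (σ (f x))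
  refine ⟨⟨τ, fun e he x hx hx' ↦ ?_, fun x hx ↦ ?_⟩, hτ⟩
  · exact (hφ.secAt_of_etale hf ((hf.secAt_iff.2 (VBundle.secAt_of_mem_Γ σ hx)).congr
      (.of_forall hτ))).2 e he hx'
  · refine (hφ.bijective hf x).1 ((hτ x).trans ?_)
    rw [map_zero]
    exact σ.2.2 _ hx

/-- Morphisms of Lie algebroids preserve brackets of related sections. -/
theorem Hom.map_bracket_of_eq (φ : Hom A B f) {U : TopologicalSpace.Opens X}
    {V : TopologicalSpace.Opens Y} {ξ ν : A.Γ U} {ξ' ν' : B.Γ V} {x : X} (hU : x ∈ U)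
    (hV : f x ∈ V) (h : ∀ᶠ y in 𝓝 x, φ.toFun y (ξ y) = ξ' (f y))
    (h' : ∀ᶠ y in 𝓝 x, φ.toFun y (ν y) = ν' (f y)) :
    φ.toFun x (A.bracket U ξ ν x) = B.bracket V ξ' ν' (f x) := by
  rw [φ.map_bracket U ξ ν x hU V hV 1 1 (fun _ _ ↦ 1) (fun _ ↦ ξ') (fun _ _ ↦ 1) (fun _ ↦ ν')
    (fun _ ↦ contMDiffAt_const) (fun _ ↦ contMDiffAt_const) (by simpa using h) (by simpa using h')]
  unfold bracketFormula
  simp [Man.dirDeriv_const]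

/-- Being a morphism of Lie algebroids can be checked locally, after cartesian morphisms over étale
maps. -/
theorem exists_hom_of_local (f : X ⟶ Y) (φ : ∀ x, A.Fiber x →ₗ[ℝ] B.Fiber (f x))
    (h : ∀ x : X, ∃ (Z : Man.{u}) (C : LieAlgebroid Z) (g : Z ⟶ X) (α : Hom C A g)
      (θ : Hom C B (g ≫ f)) (z : Z), Man.IsEtale g ∧ α.IsCart ∧ g z = x ∧
        ∀ z c, θ.toFun z c = φ (g z) (α.toFun z c)) :
    ∃ H : Hom A B f, H.toFun = φ := by
  have anchor_comm : ∀ x v, B.anchor (f x) (φ x v) = Man.dMap f x (A.anchor x v) := by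
    intro x v
    obtain ⟨Z, C, g, α, θ, z, hg, hα, rfl, hθ⟩ := h x
    obtain ⟨c, rfl⟩ := (hα.bijective hg z).2 v
    rw [← hθ, α.anchor_comm]
    exact (θ.anchor_comm z c).trans (Man.dMap_comp g f z _)
  refine ⟨⟨φ, fun e he e' he' v x hx ↦ ?_, anchor_comm, ?_⟩, rfl⟩
  · obtain ⟨Z, C, g, α, θ, z, hg, hα, rfl, hθ⟩ := h x
    refine (hg.contMDiffAt_iff.1 ?_).contMDiffWithinAt
    choose c hc using fun z ↦ (hα.bijective hg z).2 (e.symm (g z) v)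
    have h1 : C.SecAt (fun z : Z ↦ z) c z := hα.secAt_of_etale hg
      ((hg.secAt_iff.2 (VBundle.secAt_symm he hx.1 v)).congr (.of_forall hc))
    refine ((θ.secAt h1).2 e' he' hx.2).congr_of_eventuallyEq (.of_forall fun z ↦ ?_)
    exact congrArg (e'.coord (f (g z))) ((congrArg (φ (g z)) (hc z).symm).trans (hθ z _).symm)
  · intro U ξ ν x hU V hV m n a ξ' b ν' ha hb hξ hν
    obtain ⟨Z, C, g, α, θ, z, hg, hα, rfl, hθ⟩ := h x
    obtain ⟨ξ₁, hξ₁⟩ := hα.exists_pullSec hg ξ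
    obtain ⟨ν₁, hν₁⟩ := hα.exists_pullSec hg ν
    have h1 := α.map_bracket_of_eq (x := z) (ξ := ξ₁) (ν := ν₁) hU hU (.of_forall hξ₁)
      (.of_forall hν₁)
    have h2 := θ.map_bracket _ ξ₁ ν₁ z hU V hV m n (fun i z ↦ a i (g z)) ξ' (fun i z ↦ b i (g z)) ν'
      (fun i ↦ (ha i).comp_hom g) (fun j ↦ (hb j).comp_hom g)
      (by filter_upwards [hg.eventually.2 hξ] with y hy
          rw [hθ, hξ₁]; exact hy)
      (by filter_upwards [hg.eventually.2 hν] with y hy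
          rw [hθ, hν₁]; exact hy)
    rw [hθ, h1] at h2
    refine h2.trans ?_
    unfold bracketFormula
    simp only [fun i ↦ Man.dirDeriv_comp g (ha i), fun i ↦ Man.dirDeriv_comp g (hb i),
      ← α.anchor_comm, hξ₁, hν₁]
    rfl

end LieAlgebroid

/-! ### Gluing Lie algebroids -/

/-- The local trivialisation of the pullback of a family along a smooth map. -/
def LocalTriv.comap {X Y : Man.{u}} {F : Y → Type u} [∀ y, AddCommGroup (F y)]
    [∀ y, Module ℝ (F y)] (e : LocalTriv Y F) (f : X ⟶ Y) : LocalTriv X fun x ↦ F (f x) where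
  baseSet := f ⁻¹' e.baseSet
  isOpen_baseSet := e.isOpen_baseSet.preimage f.contMDiff.continuous
  rank := e.rank
  coord x := e.coord (f x)
  symm x := e.symm (f x)
  symm_coord x hx := e.symm_coord (f x) hx
  coord_symm x hx := e.coord_symm (f x) hx

/-- Lie algebroids `P i` over manifolds `Y i` which cover `T` by étale maps `f i`, together with
linear isomorphisms `t` of their fibres over the same point of `T` which satisfy the cocycle
condition and come locally from cartesian morphisms of Lie algebroids. -/
structure GlueData (T : Man.{u}) (ι : Type w) where
  Y : ι → Man.{u}
  P : ∀ i, LieAlgebroid (Y i)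
  f : ∀ i, Y i ⟶ T
  etale : ∀ i, Man.IsEtale (f i)
  surj : ∀ x, ∃ i, ∃ y, f i y = x
  t : ∀ {i j} {y : Y i} {y' : Y j}, f i y = f j y' → ((P i).Fiber y ≃ₗ[ℝ] (P j).Fiber y')
  t_trans : ∀ {i j k} {y : Y i} {y' : Y j} {y'' : Y k} (h : f i y = f j y') (h' : f j y' = f k y'')
    (a : (P i).Fiber y), t h' (t h a) = t (h.trans h') a
  exists_local : ∀ {i j} {y : Y i} {y' : Y j}, f i y = f j y' → ∃ (Z : Man.{u})
    (C : LieAlgebroid Z) (g : Z ⟶ Y i) (g' : Z ⟶ Y j) (φ : C.Hom (P i) g) (φ' : C.Hom (P j) g')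
    (z : Z), Man.IsEtale g ∧ Man.IsEtale g' ∧ φ.IsCart ∧ φ'.IsCart ∧ g z = y ∧ g' z = y' ∧
      g ≫ f i = g' ≫ f j ∧
      ∀ (z : Z) (h : f i (g z) = f j (g' z)) c, t h (φ.toFun z c) = φ'.toFun z c

namespace GlueData

variable {T : Man.{u}} {ι : Type w} (G : GlueData T ι)

/-- The fibre at `x` of the glued Lie algebroid: the fibre of one of the given ones at a chosen
point over `x`. -/
noncomputable def E (x : T) : Type u := (G.P (G.surj x).choose).Fiber (G.surj x).choose_spec.choose

noncomputable instance (x : T) : AddCommGroup (G.E x) :=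
  inferInstanceAs (AddCommGroup ((G.P (G.surj x).choose).Fiber (G.surj x).choose_spec.choose))

noncomputable instance (x : T) : Module ℝ (G.E x) :=
  inferInstanceAs (Module ℝ ((G.P (G.surj x).choose).Fiber (G.surj x).choose_spec.choose))

variable {G}

/-- The identification of the fibres of the given Lie algebroids with those of the glued one. -/
noncomputable def μ {i : ι} {y : G.Y i} {x : T} (h : G.f i y = x) :
    (G.P i).Fiber y ≃ₗ[ℝ] G.E x :=
  G.t (h.trans (G.surj x).choose_spec.choose_spec.symm)

theorem μ_t {i j : ι} {y : G.Y i} {y' : G.Y j} {x : T} (h : G.f i y = x) (h' : G.f j y' = x)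
    (h'' : G.f i y = G.f j y') (a : (G.P i).Fiber y) : μ h' (G.t h'' a) = μ h a :=
  G.t_trans _ _ a

/-- The section of `P i` defined by a section of the glued bundle. -/
noncomputable def loc (i : ι) (σ : ∀ x, G.E x) (y : G.Y i) : (G.P i).Fiber y :=
  (μ (G := G) rfl).symm (σ (G.f i y))

theorem μ_loc {i : ι} {y : G.Y i} {x : T} (h : G.f i y = x) (σ : ∀ x, G.E x) :
    μ h (loc i σ y) = σ x := by
  subst h
  exact LinearEquiv.apply_symm_apply _ _

theorem t_loc {i j : ι} {y : G.Y i} {y' : G.Y j} (h : G.f i y = G.f j y') (σ : ∀ x, G.E x) :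
    G.t h (loc i σ y) = loc j σ y' :=
  (μ (G := G) (y := y') rfl).injective (by rw [μ_t h, μ_loc, μ_loc])

theorem eq_of_loc_eq {σ τ : ∀ x, G.E x} {i : ι} {y : G.Y i} (h : loc i σ y = loc i τ y) :
    σ (G.f i y) = τ (G.f i y) :=
  (μ (G := G) (y := y) rfl).symm.injective h

theorem loc_congr {σ τ : ∀ x, G.E x} {i : ι} {y : G.Y i} (h : σ (G.f i y) = τ (G.f i y)) :
    loc i σ y = loc i τ y :=
  congrArg (μ (G := G) (y := y) rfl).symm h

/-- The local existence of cartesian morphisms which realise `t`, together with the induced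
lifts of the sections of the glued bundle. -/
theorem exists_lift {i j : ι} {y : G.Y i} {y' : G.Y j} (h : G.f i y = G.f j y') :
    ∃ (Z : Man.{u}) (C : LieAlgebroid Z) (g : Z ⟶ G.Y i) (g' : Z ⟶ G.Y j)
      (φ : C.Hom (G.P i) g) (φ' : C.Hom (G.P j) g') (z : Z), Man.IsEtale g ∧ Man.IsEtale g' ∧
      φ.IsCart ∧ φ'.IsCart ∧ g z = y ∧ g' z = y' ∧ (∀ z, G.f i (g z) = G.f j (g' z)) ∧
      (∀ (z : Z) (h : G.f i (g z) = G.f j (g' z)) c, G.t h (φ.toFun z c) = φ'.toFun z c) ∧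
      ∀ σ : ∀ x, G.E x, ∃ c : ∀ z, C.Fiber z, ∀ z, φ.toFun z (c z) = loc i σ (g z) ∧
        φ'.toFun z (c z) = loc j σ (g' z) := by
  obtain ⟨Z, C, g, g', φ, φ', z, hg, hg', hφ, hφ', hz, hz', hgg, ht⟩ := G.exists_local h
  have hgg' : ∀ z, G.f i (g z) = G.f j (g' z) := fun z ↦
    congrArg (fun k : Z ⟶ T ↦ k z) hgg
  refine ⟨Z, C, g, g', φ, φ', z, hg, hg', hφ, hφ', hz, hz', hgg', ht, fun σ ↦ ?_⟩
  choose c hc using fun z ↦ (hφ.bijective hg z).2 (loc i σ (g z))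
  exact ⟨c, fun z ↦ ⟨hc z, by rw [← ht z (hgg' z), hc, t_loc]⟩⟩

theorem secAt_loc {σ : ∀ x, G.E x} {i j : ι} {y : G.Y i} {y' : G.Y j} (h : G.f i y = G.f j y')
    (hσ : (G.P i).SecAt (fun y : G.Y i ↦ y) (loc i σ) y) :
    (G.P j).SecAt (fun y : G.Y j ↦ y) (loc j σ) y' := by
  obtain ⟨Z, C, g, g', φ, φ', z, hg, hg', hφ, hφ', rfl, rfl, -, -, hc⟩ := exists_lift h
  obtain ⟨c, hc⟩ := hc σ
  refine hg'.secAt_iff.1 ?_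
  refine (φ'.secAt (g := fun z : Z ↦ z) (hφ.secAt_of_etale hg ((hg.secAt_iff.2 hσ).congr
    (.of_forall fun z ↦ (hc z).1)))).congr (.of_forall fun z ↦ (hc z).2.symm)

variable (G) in
/-- Smoothness at `x` of a section of the glued bundle: the corresponding sections of the `P i` are
smooth over `x`. -/
def GSecAt (σ : ∀ x, G.E x) (x : T) : Prop :=
  ∀ (i : ι) (y : G.Y i), G.f i y = x → (G.P i).SecAt (fun y : G.Y i ↦ y) (loc i σ) y

variable (G) in
/-- The local trivialisations of the glued bundle whose frames are smooth. -/
def glueAtlas : Set (LocalTriv T G.E) :=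
  { e | ∀ x ∈ e.baseSet, ∀ v, G.GSecAt (fun x ↦ e.symm x v) x }

/-- This is `LocalTriv.smoothAt_coord` for the inverse of `μ`, which is injective by itself, so that
the second family of maps is zero. -/
theorem smoothAt_coord_μ {e : LocalTriv T G.E} (he : e ∈ G.glueAtlas) {i : ι}
    {a : ∀ y, (G.P i).Fiber y} {y : G.Y i} (hy : G.f i y ∈ e.baseSet)
    (ha : (G.P i).SecAt (fun y : G.Y i ↦ y) a y) :
    (G.Y i).SmoothAt (fun y ↦ e.coord (G.f i y) (μ (G := G) rfl (a y))) y :=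
  (e.comap (G.f i)).smoothAt_coord (B := (G.P i).toVBundle) (f := 𝟙 _)
    (fun y ↦ (μ (G := G) (y := y) rfl).symm.toLinearMap) (fun _ ↦ 0) (g := fun y : G.Y i ↦ y)
    (a := fun y ↦ μ (G := G) rfl (a y)) hy (fun _ ha _ ↦ (LinearEquiv.map_eq_zero_iff _).1 ha)
    (fun v ↦ he _ hy v i y rfl) (fun _ ↦ Man.vecAt_zero contMDiffAt_id)
    (ha.congr (.of_forall fun _ ↦ LinearEquiv.symm_apply_apply _ _))
    (Man.vecAt_zero contMDiffAt_id)

theorem smoothAt_coord {e : LocalTriv T G.E} (he : e ∈ G.glueAtlas) {σ : ∀ x, G.E x} {x : T}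
    (hx : x ∈ e.baseSet) (hσ : G.GSecAt σ x) : T.SmoothAt (fun y ↦ e.coord y (σ y)) x := by
  obtain ⟨i, y, rfl⟩ := G.surj x
  refine (G.etale i).contMDiffAt_iff.1 ((smoothAt_coord_μ he hx
    (hσ i y rfl)).congr_of_eventuallyEq (.of_forall fun y ↦ ?_))
  exact congrArg (e.coord (G.f i y)) (μ_loc rfl σ).symm

theorem gSecAt_of_coord {e : LocalTriv T G.E} (he : e ∈ G.glueAtlas) {σ : ∀ x, G.E x} {x : T}
    (hx : x ∈ e.baseSet) (hσ : T.SmoothAt (fun y ↦ e.coord y (σ y)) x) : G.GSecAt σ x := by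
  rintro i y rfl
  have h1 : (G.P i).SecAt (fun y : G.Y i ↦ y) (fun y ↦ ∑ k, e.coord (G.f i y) (σ (G.f i y)) k •
      loc i (fun x ↦ e.symm x (Pi.single k 1)) y) y :=
    .sum _ contMDiffAt_id fun k _ ↦ .smul
      ((contMDiffAt_pi_space.1 hσ k).comp y ((G.f i).contMDiff y)) (he _ hx _ i y rfl)
  refine h1.congr ?_
  filter_upwards [(e.isOpen_baseSet.preimage (G.f i).contMDiff.continuous).mem_nhds hx] with y hy
  change (μ (G := G) rfl).symm (σ (G.f i y)) = _
  conv_lhs => rw [← e.symm_coord _ hy (σ (G.f i y)), pi_eq_sum_univ' (e.coord _ _), map_sum,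
      map_sum]
  simp only [map_smul]
  rfl

open Classical in
/-- The trivialisations of the given Lie algebroids, transferred along local inverses of the maps
`f i`. -/
theorem exists_glueTriv (x : T) : ∃ e ∈ G.glueAtlas, x ∈ e.baseSet := by
  obtain ⟨i, y, rfl⟩ := G.surj x
  obtain ⟨N, s, hN, hy, hs, hsN⟩ := (G.etale i).exists_localInverse y
  obtain ⟨e, he, hye⟩ := (G.P i).exists_mem_baseSet y
  let N' : Set T := {x | x ∈ N ∧ s x ∈ e.baseSet}
  have hN' : IsOpen N' := isOpen_iff_mem_nhds.2 fun x hx ↦ Filter.inter_mem (hN.mem_nhds hx.1)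
    ((hsN x hx.1).2.1.continuousAt.preimage_mem_nhds (e.isOpen_baseSet.mem_nhds hx.2))
  let t : LocalTriv T G.E :=
    { baseSet := N'
      isOpen_baseSet := hN'
      rank := e.rank
      coord := fun x ↦ if h : x ∈ N' then
        (e.coord (s x)).comp (μ (G := G) (hsN x h.1).1).symm.toLinearMap else 0
      symm := fun x ↦ if h : x ∈ N' then
        (μ (G := G) (hsN x h.1).1).toLinearMap.comp (e.symm (s x)) else 0
      symm_coord := fun x hx a ↦ by
        rw [dif_pos hx, dif_pos hx]
        change μ (G := G) _ (e.symm (s x) (e.coord (s x) ((μ (G := G) _).symm a))) = a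
        rw [e.symm_coord _ hx.2, LinearEquiv.apply_symm_apply]
      coord_symm := fun x hx v ↦ by
        rw [dif_pos hx, dif_pos hx]
        change e.coord (s x) ((μ (G := G) _).symm (μ (G := G) _ (e.symm (s x) v))) = v
        rw [LinearEquiv.symm_apply_apply, e.coord_symm _ hx.2] }
  have hy' : G.f i y ∈ N' := ⟨hy, by rw [hs]; exact hye⟩
  refine ⟨t, fun x hx v j y' hxy ↦ ?_, hy'⟩
  obtain ⟨hsx, -, hev⟩ := hsN x hx.1
  refine secAt_loc (i := i) (y := s x) (hsx.trans hxy.symm)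
    ((VBundle.secAt_symm he hx.2 v).congr ?_)
  filter_upwards [hev, ((hN'.preimage (G.f i).contMDiff.continuous).mem_nhds
    (show G.f i (s x) ∈ N' by rw [hsx]; exact hx))] with z hz hz'
  refine (μ (G := G) (y := z) rfl).injective ((μ_loc rfl _).trans ?_)
  have h1 : t.symm (G.f i z) v = μ (G := G) (hsN _ hz'.1).1 (e.symm (s (G.f i z)) v) :=
    congrArg (fun L : (Fin e.rank → ℝ) →ₗ[ℝ] G.E (G.f i z) ↦ L v) (dif_pos hz')
  refine h1.trans ?_
  have h2 : ∀ (z' : G.Y i) (h : G.f i z' = G.f i z), z' = z →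
      μ (G := G) h (e.symm z' v) = μ (G := G) rfl (e.symm z v) := by
    rintro z' h rfl
    rfl
  exact h2 _ _ hz

variable (G) in
/-- The glued vector bundle. -/
noncomputable def bundle : VBundle T where
  Fiber := G.E
  atlas := G.glueAtlas
  exists_mem_baseSet := exists_glueTriv
  smooth_transition _ he _ he' v x hx := (smoothAt_coord he' hx.2 (he x hx.1 v)).contMDiffWithinAt

theorem secAt_bundle_iff {σ : ∀ x, G.E x} {x : T} :
    G.bundle.SecAt (fun x : T ↦ x) σ x ↔ G.GSecAt σ x := by
  refine ⟨fun h ↦ ?_, fun h ↦ ⟨contMDiffAt_id, fun e he hx ↦ smoothAt_coord he hx h⟩⟩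
  obtain ⟨e, he, hx⟩ := exists_glueTriv (G := G) x
  exact gSecAt_of_coord he hx (h.2 e he hx)

variable {U : TopologicalSpace.Opens T}

/-- The section of `P i` defined by a section of the glued bundle. -/
noncomputable def locΓ (i : ι) : G.bundle.Γ U →ₗ[ℝ] (G.P i).Γ (Man.preim (G.f i) U) where
  toFun σ := ⟨loc (G := G) i σ.1, fun e he y hy hye ↦
    ((secAt_bundle_iff.1 (VBundle.secAt_of_mem_Γ σ hy)) i y rfl).2 e he hye, fun _ hy ↦
      (congrArg (μ (G := G) rfl).symm (σ.2.2 _ hy)).trans (map_zero _)⟩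
  map_add' σ τ := Subtype.ext (funext fun _ ↦ map_add (μ (G := G) rfl).symm (σ.1 _) (τ.1 _))
  map_smul' c σ := Subtype.ext (funext fun _ ↦ map_smul (μ (G := G) rfl).symm c (σ.1 _))

theorem locΓ_apply (i : ι) (σ : G.bundle.Γ U) (y : G.Y i) :
    (locΓ i σ).1 y = loc (G := G) i σ.1 y := rfl

theorem ext_locΓ {σ τ : G.bundle.Γ U} (h : ∀ i, locΓ i σ = locΓ i τ) : σ = τ := by
  refine VBundle.section_ext fun x _ ↦ ?_
  obtain ⟨i, y, rfl⟩ := G.surj x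
  exact eq_of_loc_eq (G := G) (congrArg (fun σ : (G.P i).Γ _ ↦ σ.1 y) (h i))

/-- Compatible sections of the given Lie algebroids glue. -/
theorem exists_glue_section (β : ∀ i, (G.P i).Γ (Man.preim (G.f i) U))
    (hβ : ∀ i j (y : G.Y i) (y' : G.Y j) (h : G.f i y = G.f j y'), G.f i y ∈ U →
      G.t h ((β i).1 y) = (β j).1 y') : ∃ σ : G.bundle.Γ U, ∀ i, locΓ i σ = β i := by
  choose i y hy using G.surj
  let σ : ∀ x, G.E x := fun x ↦ μ (G := G) (hy x) ((β (i x)).1 (y x))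
  have hσ : ∀ j (y' : G.Y j), G.f j y' ∈ U → loc j σ y' = (β j).1 y' := fun j y' hU ↦ by
    refine (μ (G := G) (y := y') rfl).injective ((μ_loc rfl _).trans ?_)
    have h1 : G.f (i (G.f j y')) (y (G.f j y')) = G.f j y' := hy _
    rw [← hβ _ _ _ _ h1 (by rw [h1]; exact hU), μ_t h1]
  refine ⟨VBundle.sectionOn (E := G.bundle) U σ fun e he x hU hx ↦
    ((secAt_bundle_iff (σ := σ)).2 fun j y' hx' ↦ ?_).2 e he hx, fun j ↦
      VBundle.section_ext fun y' hU ↦ ?_⟩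
  · have hU' : y' ∈ Man.preim (G.f j) U := by
      change G.f j y' ∈ U
      rwa [hx']
    refine (VBundle.secAt_of_mem_Γ (β j) hU').congr ?_
    filter_upwards [(Man.preim (G.f j) U).isOpen.mem_nhds hU'] with z hz using hσ j z hz
  · exact (loc_congr (G := G) (VBundle.sectionOn_apply (x := G.f j y') hU)).trans (hσ j y' hU)

/-- The bracket of sections of the glued bundle, computed in one of the given Lie algebroids, does
not depend on which one. -/
theorem t_bracket {i j : ι} {y : G.Y i} {y' : G.Y j} (h : G.f i y = G.f j y')
    (hU : G.f i y ∈ U) (σ τ : G.bundle.Γ U) :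
    G.t h ((G.P i).bracket _ (locΓ i σ) (locΓ i τ) y) =
      (G.P j).bracket _ (locΓ j σ) (locΓ j τ) y' := by
  obtain ⟨Z, C, g, g', φ, φ', z, hg, hg', hφ, hφ', rfl, rfl, hgg, ht, hc⟩ := exists_lift h
  obtain ⟨σ₁, hσ₁⟩ := hφ.exists_pullSec hg (locΓ i σ)
  obtain ⟨τ₁, hτ₁⟩ := hφ.exists_pullSec hg (locΓ i τ)
  have h1 : ∀ (σ : G.bundle.Γ U) (σ₁ : C.Γ (Man.preim g (Man.preim (G.f i) U))),
      (∀ x, φ.toFun x (σ₁ x) = locΓ i σ (g x)) → ∀ z, φ'.toFun z (σ₁ z) = locΓ j σ (g' z) :=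
    fun σ σ₁ hσ₁ z ↦ by
      rw [← ht z (hgg z), hσ₁]
      exact t_loc (G := G) _ _
  have hU' : g' z ∈ Man.preim (G.f j) U := by
    change G.f j (g' z) ∈ U
    rwa [← h]
  rw [← φ.map_bracket_of_eq (U := Man.preim g (Man.preim (G.f i) U)) (x := z) hU hU
      (.of_forall hσ₁) (.of_forall hτ₁), ht, ← φ'.map_bracket_of_eq
      (U := Man.preim g (Man.preim (G.f i) U)) (x := z) hU hU' (.of_forall (h1 σ σ₁ hσ₁))
      (.of_forall (h1 τ τ₁ hτ₁))]

theorem exists_bracket (σ τ : G.bundle.Γ U) : ∃ ρ : G.bundle.Γ U, ∀ i,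
    locΓ i ρ = (G.P i).bracket _ (locΓ i σ) (locΓ i τ) :=
  exists_glue_section _ fun _ _ _ _ h hU ↦ t_bracket h hU σ τ

/-- The bracket of two sections of the glued bundle. -/
noncomputable def br (σ τ : G.bundle.Γ U) : G.bundle.Γ U := (exists_bracket σ τ).choose

theorem locΓ_br (i : ι) (σ τ : G.bundle.Γ U) :
    locΓ i (br σ τ) = (G.P i).bracket _ (locΓ i σ) (locΓ i τ) :=
  (exists_bracket σ τ).choose_spec i

/-- The bracket of sections of the glued bundle, as a bilinear map. -/
noncomputable def bracket (U : TopologicalSpace.Opens T) :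
    G.bundle.Γ U →ₗ[ℝ] G.bundle.Γ U →ₗ[ℝ] G.bundle.Γ U :=
  LinearMap.mk₂ ℝ br
    (fun σ τ ρ ↦ ext_locΓ fun i ↦ by
      simp only [map_add, locΓ_br, LinearMap.add_apply])
    (fun c σ τ ↦ ext_locΓ fun i ↦ by
      simp only [map_smul, locΓ_br, LinearMap.smul_apply])
    (fun σ τ ρ ↦ ext_locΓ fun i ↦ by simp only [map_add, locΓ_br])
    (fun c σ τ ↦ ext_locΓ fun i ↦ by simp only [map_smul, locΓ_br])

theorem locΓ_bracket (i : ι) (σ τ : G.bundle.Γ U) :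
    locΓ i (bracket U σ τ) = (G.P i).bracket _ (locΓ i σ) (locΓ i τ) :=
  locΓ_br i σ τ

/-! The anchor of the glued bundle is defined by the derivatives of the maps `f i`. Tangent spaces
of `T` at different points are the same vector space, which makes it possible to state the
compatibility over the same point of `T`. -/

/-- The anchors of the given Lie algebroids correspond under `t`. -/
theorem anchor_t {i j : ι} {y : G.Y i} {y' : G.Y j} (h : G.f i y = G.f j y')
    (a : (G.P i).Fiber y) :
    (show EuclideanSpace ℝ (Fin T.dim) from Man.dMap (G.f i) y ((G.P i).anchor y a)) =
      (show EuclideanSpace ℝ (Fin T.dim) from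
        Man.dMap (G.f j) y' ((G.P j).anchor y' (G.t h a))) := by
  obtain ⟨Z, C, g, g', φ, φ', z, hg, hg', hφ, hφ', rfl, rfl, hgg, ht⟩ := G.exists_local h
  obtain ⟨c, rfl⟩ := (hφ.bijective hg z).2 a
  rw [ht z h, φ.anchor_comm, φ'.anchor_comm]
  have h1 := congrArg (fun k : Z ⟶ T ↦
    (show EuclideanSpace ℝ (Fin T.dim) from Man.dMap k z (C.anchor z c))) hgg
  exact (Man.dMap_comp g (G.f i) z _).symm.trans (h1.trans (Man.dMap_comp g' (G.f j) z _))

variable (G) in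
/-- The anchor of the glued bundle. -/
noncomputable def anchor (x : T) : G.E x →ₗ[ℝ] TangentSpace (𝓡 T.dim) x :=
  (show (G.P (G.surj x).choose).Fiber (G.surj x).choose_spec.choose →ₗ[ℝ]
    EuclideanSpace ℝ (Fin T.dim) from (Man.dMap (G.f (G.surj x).choose) _).toLinearMap.comp
      ((G.P (G.surj x).choose).anchor (G.surj x).choose_spec.choose))

theorem anchor_μ {i : ι} (y : G.Y i) (a : (G.P i).Fiber y) :
    G.anchor (G.f i y) (μ rfl a) = Man.dMap (G.f i) y ((G.P i).anchor y a) :=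
  (anchor_t _ a).symm

theorem anchor_eq {i : ι} (σ : ∀ x, G.E x) (y : G.Y i) :
    G.anchor (G.f i y) (σ (G.f i y)) = Man.dMap (G.f i) y ((G.P i).anchor y (loc i σ y)) := by
  rw [← anchor_μ, μ_loc]

theorem vecAt_anchor {σ : ∀ x, G.E x} {x : T} (h : G.GSecAt σ x) :
    Man.VecAt (fun x : T ↦ x) (fun x ↦ G.anchor x (σ x)) x := by
  obtain ⟨i, y, rfl⟩ := G.surj x
  exact (G.etale i).vecAt_iff.1 (((h i y rfl).anchor.dMap (G.f i)).congr
    (.of_forall fun y ↦ anchor_eq σ y))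

theorem gSecAt_of_mem (σ : G.bundle.Γ U) {x : T} (hx : x ∈ U) : G.GSecAt σ.1 x :=
  secAt_bundle_iff.1 (VBundle.secAt_of_mem_Γ σ hx)

variable (G) in
/-- The glued Lie algebroid. -/
noncomputable def glue : LieAlgebroid T where
  toVBundle := G.bundle
  anchor := G.anchor
  smooth_anchor e he v x hx := (vecAt_anchor (he x hx v)).contMDiffWithinAt
  bracket := bracket
  bracket_res {U V} h σ τ := by
    have hV : ∀ i, Man.preim (G.f i) V ≤ Man.preim (G.f i) U := fun i y hy ↦ h hy
    have h1 : ∀ i (σ : G.bundle.Γ U), locΓ i (VBundle.res h σ) = VBundle.res (hV i) (locΓ i σ) :=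
      fun i σ ↦ VBundle.section_ext fun y hy ↦
        (loc_congr (G := G) (VBundle.res_apply (x := G.f i y) hy)).trans
          (VBundle.res_apply (σ := locΓ i σ) hy).symm
    refine ext_locΓ fun i ↦ ?_
    rw [locΓ_bracket, h1, h1, h1, locΓ_bracket, (G.P i).bracket_res]
  bracket_self U σ := ext_locΓ fun i ↦ by
    rw [locΓ_bracket, (G.P i).bracket_self, map_zero]
  jacobi U σ τ ρ := ext_locΓ fun i ↦ by
    simp only [map_add, locΓ_bracket]
    exact (G.P i).jacobi _ _ _ _
  anchor_bracket U σ τ x hx := by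
    obtain ⟨i, y, rfl⟩ := G.surj x
    refine (anchor_eq _ y).trans ?_
    rw [← locΓ_apply, locΓ_bracket, (G.P i).anchor_bracket _ _ _ _ hx]
    have h1 : ∀ σ : G.bundle.Γ U, Man.VecAt (fun y : G.Y i ↦ y)
        (fun y ↦ (G.P i).anchor y (locΓ i σ y)) y := fun σ ↦ (gSecAt_of_mem σ hx i y rfl).anchor
    rw [Man.dMap_mlieBracket (ι := Unit) (κ := Unit) (G.f i) (h1 σ) (h1 τ)
      (a := fun _ x ↦ G.anchor x (σ.1 x)) (b := fun _ x ↦ G.anchor x (τ.1 x))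
      (fun _ ↦ vecAt_anchor (gSecAt_of_mem σ hx)) (fun _ ↦ vecAt_anchor (gSecAt_of_mem τ hx))
      (G := fun _ _ ↦ 1) (H := fun _ _ ↦ 1) (fun _ ↦ contMDiffAt_const)
      (fun _ ↦ contMDiffAt_const)
      (.of_forall fun y ↦ by
        rw [Fintype.sum_unique, one_smul]; exact (anchor_eq σ.1 y).symm)
      (.of_forall fun y ↦ by
        rw [Fintype.sum_unique, one_smul]; exact (anchor_eq τ.1 y).symm)]
    simp only [Fintype.sum_unique, Man.dirDeriv_const, zero_smul, one_smul, mul_one, add_zero,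
      sub_zero]
    rfl
  leibniz U σ τ h hh x hx := by
    obtain ⟨i, y, rfl⟩ := G.surj x
    have hh' : ∀ y ∈ Man.preim (G.f i) U, (G.Y i).SmoothAt (fun y ↦ h (G.f i y)) y := fun y hy ↦
      (hh _ hy).comp_hom (G.f i)
    have h1 : locΓ i (VBundle.smul h hh τ) = VBundle.smul _ hh' (locΓ i τ) :=
      Subtype.ext (funext fun y ↦ map_smul (μ (G := G) rfl).symm _ _)
    have h2 := (G.P i).leibniz _ (locΓ i σ) (locΓ i τ) _ hh' y hx
    rw [← h1, ← locΓ_bracket, ← locΓ_bracket, Man.dirDeriv_comp (G.f i) (hh _ hx)] at h2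
    have h3 := h2.trans (congrArg (fun v ↦ T.dirDeriv h (G.f i y) v • locΓ i τ y +
      h (G.f i y) • locΓ i (bracket U σ τ) y) (anchor_eq σ.1 y).symm)
    refine (μ_loc rfl _).symm.trans ((congrArg (μ (G := G) rfl) h3).trans ?_)
    refine (map_add (μ (G := G) rfl) _ _).trans (congrArg₂ (· + ·) ?_ ?_)
    · exact (map_smul (μ (G := G) rfl) _ _).trans (congrArg _ (μ_loc rfl _))
    · exact (map_smul (μ (G := G) rfl) _ _).trans (congrArg _ (μ_loc rfl _))

/-- The identifications of the fibres define cartesian morphisms to the glued Lie algebroid. -/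
theorem exists_glueHom (i : ι) : ∃ φ : (G.P i).Hom G.glue (G.f i), φ.IsCart ∧
    ∀ y a, φ.toFun y a = μ (G := G) rfl a := by
  let φ : ∀ y, (G.P i).Fiber y →ₗ[ℝ] G.glue.Fiber (G.f i y) :=
    fun y ↦ (μ (G := G) rfl).toLinearMap
  have hac : ∀ y a, G.glue.anchor (G.f i y) (φ y a) = Man.dMap (G.f i) y ((G.P i).anchor y a) :=
    fun y a ↦ anchor_μ y a
  refine ⟨⟨φ, fun e he e' he' v y hy ↦ ?_, hac, fun U ξ ν y hU ↦ ?_⟩,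
    LieAlgebroid.Hom.isCart_of_bijective (G.etale i) fun y ↦ (μ (G := G) rfl).bijective,
    fun _ _ ↦ rfl⟩
  · exact (smoothAt_coord_μ he' hy.2 (VBundle.secAt_symm he hy.1 v)).contMDiffWithinAt
  · obtain ⟨e, he, hy⟩ := G.glue.exists_mem_baseSet (G.f i y)
    refine LieAlgebroid.map_bracket_of_frame φ hac ξ ν y he hy ?_
    let V : TopologicalSpace.Opens T := ⟨e.baseSet, e.isOpen_baseSet⟩
    let b : Fin e.rank → G.bundle.Γ V := fun k ↦ VBundle.frame (E := G.bundle) he k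
    have hb : ∀ (σ : G.bundle.Γ V) (y : G.Y i), φ y (locΓ i σ y) = σ.1 (G.f i y) := fun σ y ↦
      μ_loc rfl σ.1
    have hc : ∀ (ξ : (G.P i).Γ U) k, (G.Y i).SmoothAt
        (fun y ↦ e.coord (G.f i y) (φ y (ξ y)) k) y := fun ξ k ↦
      contMDiffAt_pi_space.1 (smoothAt_coord_μ he hy (VBundle.secAt_of_mem_Γ ξ hU)) k
    have hξ : ∀ ξ : (G.P i).Γ U, ∀ᶠ y in 𝓝 y, (LieAlgebroid.Hom.id (G.P i)).toFun y (ξ y) =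
        ∑ k, e.coord (G.f i y) (φ y (ξ y)) k • locΓ i (b k) y := fun ξ ↦ by
      filter_upwards [(e.isOpen_baseSet.preimage (G.f i).contMDiff.continuous).mem_nhds hy]
        with y hy
      refine (μ (G := G) rfl).injective (Eq.trans ?_ (map_sum (φ y) _ _).symm)
      refine (VBundle.eq_sum_frame (E := G.bundle) he hy _).trans
        (Finset.sum_congr rfl fun k _ ↦ ?_)
      exact ((map_smul (φ y) _ _).trans (congrArg _ (hb (b k) y))).symm
    have h1 := (LieAlgebroid.Hom.id (G.P i)).map_bracket U ξ ν y hU (Man.preim (G.f i) V) hy _ _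
      _ (fun k ↦ locΓ i (b k)) _ (fun k ↦ locΓ i (b k)) (hc ξ) (hc ν) (hξ ξ) (hξ ν)
    refine (congrArg (φ y) h1).trans ?_
    unfold LieAlgebroid.bracketFormula
    refine (map_sub (φ y) _ _).trans (congrArg₂ (· - ·) ((map_add (φ y) _ _).trans
      (congrArg₂ (· + ·) ?_ ?_)) ?_)
    · refine (map_sum (φ y) _ _).trans (Finset.sum_congr rfl fun k _ ↦ ?_)
      refine (map_sum (φ y) _ _).trans (Finset.sum_congr rfl fun l _ ↦ ?_)
      refine (map_smul (φ y) _ _).trans (congrArg _ (Eq.trans ?_ (hb (bracket V (b k) (b l)) y)))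
      rw [locΓ_bracket]
      rfl
    · refine (map_sum (φ y) _ _).trans (Finset.sum_congr rfl fun k _ ↦ ?_)
      exact (map_smul (φ y) _ _).trans (congrArg _ (hb (b k) y))
    · refine (map_sum (φ y) _ _).trans (Finset.sum_congr rfl fun k _ ↦ ?_)
      exact (map_smul (φ y) _ _).trans (congrArg _ (hb (b k) y))

end GlueData

/-! ### Descent data of a fibred category as transport of arrows -/

namespace FibredStack

open CategoryTheory.Functor Opposite Bicategory

open Functor.Fiber (fiberInclusion)

variable {𝒮 : Type u₁} {𝒳 : Type u₂} [Category.{v₁} 𝒮] [Category.{v₂} 𝒳]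

theorem map_fiberInclusion {p : 𝒳 ⥤ 𝒮} {T : 𝒮} (a : Fiber p T) :
    p.obj (fiberInclusion.obj a) = T := a.2

variable (p : 𝒳 ⥤ 𝒮) [p.IsFibered]

/-- The coherence isomorphisms of the fibre pseudofunctor are compatible with the projections from
the pullbacks. -/
theorem mapComp'_hom_fac {R S T : 𝒮} (f : R ⟶ S) (g : S ⟶ T) (fg : R ⟶ T) (h : f ≫ g = fg)
    (h' : g.op.toLoc ≫ f.op.toLoc = fg.op.toLoc) (a : Fiber p T) :
    (fiberInclusion.map (((fiberPseudofunctor p).mapComp' g.op.toLoc f.op.toLoc fg.op.toLoc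
      h').hom.toNatTrans.app a : pull p fg a ⟶ pull p f (pull p g a)) ≫
        pullMap p f (pull p g a) ≫ pullMap p g a : (pull p fg a).1 ⟶ a.1) = pullMap p fg a := by
  subst h
  have : (fiberPseudofunctor p).mapComp' g.op.toLoc f.op.toLoc (f ≫ g).op.toLoc h' =
      (fiberPseudofunctor p).mapComp g.op.toLoc f.op.toLoc :=
    (fiberPseudofunctor p).mapComp'_eq_mapComp _ _
  rw [this]
  exact pullCompIso_hom_fac p f g a

theorem mapComp'_inv_fac {R S T : 𝒮} (f : R ⟶ S) (g : S ⟶ T) (fg : R ⟶ T) (h : f ≫ g = fg)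
    (h' : g.op.toLoc ≫ f.op.toLoc = fg.op.toLoc) (a : Fiber p T) :
    (fiberInclusion.map (((fiberPseudofunctor p).mapComp' g.op.toLoc f.op.toLoc fg.op.toLoc
      h').inv.toNatTrans.app a : pull p f (pull p g a) ⟶ pull p fg a) ≫
        pullMap p fg a : (pull p f (pull p g a)).1 ⟶ a.1) =
      pullMap p f (pull p g a) ≫ pullMap p g a := by
  subst h
  have : (fiberPseudofunctor p).mapComp' g.op.toLoc f.op.toLoc (f ≫ g).op.toLoc h' =
      (fiberPseudofunctor p).mapComp g.op.toLoc f.op.toLoc :=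
    (fiberPseudofunctor p).mapComp'_eq_mapComp _ _
  rw [this]
  exact pullCompIso_inv_fac p f g a

variable {p} {S : 𝒮} {ι : Type w} {X : ι → 𝒮} {f : ∀ i, X i ⟶ S}
  (D : (fiberPseudofunctor p).DescentData f)

/-- The objects of a descent datum, as objects of the fibres. -/
def descObj (i : ι) : Fiber p (X i) := D.obj i

/-- The gluing morphisms of a descent datum, as morphisms of the fibres. -/
def descHom {Y : 𝒮} (q : Y ⟶ S) {i j : ι} (g : Y ⟶ X i) (g' : Y ⟶ X j) (h : g ≫ f i = q)
    (h' : g' ≫ f j = q) : pull p g (descObj D i) ⟶ pull p g' (descObj D j) :=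
  D.hom q g g' h h'

theorem descHom_comp {Y : 𝒮} (q : Y ⟶ S) {i j k : ι} (g : Y ⟶ X i) (g' : Y ⟶ X j) (g'' : Y ⟶ X k)
    (h : g ≫ f i = q) (h' : g' ≫ f j = q) (h'' : g'' ≫ f k = q) :
    descHom D q g g' h h' ≫ descHom D q g' g'' h' h'' = descHom D q g g'' h h'' :=
  D.hom_comp q g g' g'' h h' h''

/-- The compatibility of the gluing morphisms with pullback, after projection to the objects of the
descent datum. -/
theorem descHom_pull {Y Z : 𝒮} (k : Z ⟶ Y) (q : Y ⟶ S) {i j : ι} (g : Y ⟶ X i) (g' : Y ⟶ X j)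
    (h : g ≫ f i = q) (h' : g' ≫ f j = q) (hk : (k ≫ g) ≫ f i = k ≫ q)
    (hk' : (k ≫ g') ≫ f j = k ≫ q) :
    fiberInclusion.map (descHom D (k ≫ q) (k ≫ g) (k ≫ g') hk hk') ≫
        pullMap p (k ≫ g') (descObj D j) =
      fiberInclusion.map (pullCompIso p k g (descObj D i)).hom ≫ pullMap p k _ ≫
        fiberInclusion.map (descHom D q g g' h h') ≫ pullMap p g' (descObj D j) := by
  have e : descHom D (k ≫ q) (k ≫ g) (k ≫ g') hk hk' =
      (pullCompIso p k g (descObj D i)).hom ≫ pullHom p k (descHom D q g g' h h') ≫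
        (pullCompIso p k g' (descObj D j)).inv := by
    refine (D.pullHom_hom k q (k ≫ q) rfl g g' h h' _ _ rfl rfl).symm.trans ?_
    unfold Pseudofunctor.LocallyDiscreteOpToCat.pullHom
    rw [show (fiberPseudofunctor p).mapComp' g.op.toLoc k.op.toLoc (k ≫ g).op.toLoc _ =
      (fiberPseudofunctor p).mapComp g.op.toLoc k.op.toLoc from
      (fiberPseudofunctor p).mapComp'_eq_mapComp _ _,
      show (fiberPseudofunctor p).mapComp' g'.op.toLoc k.op.toLoc (k ≫ g').op.toLoc _ =
      (fiberPseudofunctor p).mapComp g'.op.toLoc k.op.toLoc from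
      (fiberPseudofunctor p).mapComp'_eq_mapComp _ _]
    rfl
  rw [e]
  simp only [Functor.map_comp, Category.assoc]
  rw [pullCompIso_inv_fac, ← Category.assoc (fiberInclusion.map (pullHom p _ _)), pullHom_fac,
    Category.assoc]

/-- The structure map `p E_i ⟶ S` of the `i`-th object of a descent datum. -/
def descBase (i : ι) : p.obj (fiberInclusion.obj (descObj D i)) ⟶ S := eqToHom
    (map_fiberInclusion (descObj D i)) ≫ f i

theorem comp_descBase {c : 𝒮} {i : ι} (g : c ⟶ p.obj (fiberInclusion.obj (descObj D i))) :
    (g ≫ eqToHom (map_fiberInclusion (descObj D i))) ≫ f i = g ≫ descBase D i :=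
  Category.assoc _ _ _

/-- The transport of an arrow `u : c ⟶ E_i` along a descent datum: the arrow `c ⟶ E_j` over `g`
which corresponds to `u` under the gluing morphism between the pullbacks of `E_i` and `E_j` to the
base of `c`. -/
noncomputable def transport {c : 𝒳} {i j : ι} (u : c ⟶ fiberInclusion.obj (descObj D i))
    (g : p.obj c ⟶ p.obj (fiberInclusion.obj (descObj D j)))
    (h : p.map u ≫ descBase D i = g ≫ descBase D j) : c ⟶ fiberInclusion.obj (descObj D j) :=
  IsCartesian.map p (p.map u ≫ eqToHom (map_fiberInclusion (descObj D i)))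
      (pullMap p (p.map u ≫ eqToHom (map_fiberInclusion (descObj D i))) (descObj D i)) u ≫
    fiberInclusion.map (descHom D (p.map u ≫ descBase D i)
        (p.map u ≫ eqToHom (map_fiberInclusion (descObj D i)))
      (g ≫ eqToHom (map_fiberInclusion (descObj D j))) (comp_descBase D _)
          ((comp_descBase D _).trans h.symm)) ≫
    pullMap p (g ≫ eqToHom (map_fiberInclusion (descObj D j))) (descObj D j)

theorem comp_descHom {c : 𝒳} {Y : 𝒮} (q : Y ⟶ S) {i j : ι} (g : Y ⟶ X i) (g' : Y ⟶ X j)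
    (h : g ≫ f i = q) (h' : g' ≫ f j = q) (k : p.obj c ⟶ Y)
    (w : c ⟶ fiberInclusion.obj (pull p g (descObj D i)))
    [p.IsHomLift k w] (u : c ⟶ fiberInclusion.obj (descObj D i))
    (hu : w ≫ pullMap p g (descObj D i) = u) (q₁ : p.obj c ⟶ S) (a : p.obj c ⟶ X i)
    (b : p.obj c ⟶ X j) (hq : q₁ = k ≫ q) (ha : a = k ≫ g) (hb : b = k ≫ g')
    (h₁ : a ≫ f i = q₁) (h₂ : b ≫ f j = q₁) [p.IsHomLift a u] :
    IsCartesian.map p a (pullMap p a (descObj D i)) u ≫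
        fiberInclusion.map (descHom D q₁ a b h₁ h₂) ≫ pullMap p b (descObj D j) =
      w ≫ fiberInclusion.map (descHom D q g g' h h') ≫ pullMap p g' (descObj D j) := by
  subst hq ha hb
  rw [descHom_pull D k q g g' h h', ← Category.assoc (fiberInclusion.map (pullCompIso p k g _).hom),
    ← Category.assoc]
  congr 1
  refine IsStronglyCartesian.ext p g (pullMap p g (descObj D i)) k ?_
  rw [Category.assoc, Category.assoc, pullCompIso_hom_fac, IsCartesian.fac, hu]

/-- The transport of an arrow can be computed from any factorisation through a pullback. -/
theorem transport_eq {c : 𝒳} {Y : 𝒮} (q : Y ⟶ S) {i j : ι} (g : Y ⟶ X i) (g' : Y ⟶ X j)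
    (h : g ≫ f i = q) (h' : g' ≫ f j = q) (w : c ⟶ fiberInclusion.obj (pull p g (descObj D i)))
        (k : p.obj c ⟶ Y)
    [p.IsHomLift k w] (u : c ⟶ fiberInclusion.obj (descObj D i))
        (hu : w ≫ pullMap p g (descObj D i) = u)
    (l : p.obj c ⟶ p.obj (fiberInclusion.obj (descObj D j)))
        (hl : l ≫ eqToHom (map_fiberInclusion (descObj D j)) = k ≫ g')
    (hul : p.map u ≫ descBase D i = l ≫ descBase D j) :
    transport D u l hul =
      w ≫ fiberInclusion.map (descHom D q g g' h h') ≫ pullMap p g' (descObj D j) := by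
  have ha : p.map u ≫ eqToHom (map_fiberInclusion (descObj D i)) = k ≫ g := by
    have : p.IsHomLift (k ≫ g) u := hu ▸ inferInstance
    rw [IsHomLift.fac' p (k ≫ g) u]
    simp
  exact comp_descHom D q g g' h h' k w u hu _ _ _
    (by rw [← comp_descBase, ha, Category.assoc, h]) ha hl _ _

theorem map_transport {c : 𝒳} {i j : ι} (u : c ⟶ fiberInclusion.obj (descObj D i))
    (g : p.obj c ⟶ p.obj (fiberInclusion.obj (descObj D j)))
    (h : p.map u ≫ descBase D i = g ≫ descBase D j) : p.map (transport D u g h) = g := by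
  have : p.IsHomLift (g ≫ eqToHom (map_fiberInclusion (descObj D j))) (transport D u g h) := by
    unfold transport
    infer_instance
  have := IsHomLift.fac' p (g ≫ eqToHom (map_fiberInclusion (descObj D j))) (transport D u g h)
  simpa using this

theorem transport_transport {c : 𝒳} {i j k : ι} (u : c ⟶ fiberInclusion.obj (descObj D i))
    (g : p.obj c ⟶ p.obj (fiberInclusion.obj (descObj D j)))
        (h : p.map u ≫ descBase D i = g ≫ descBase D j)
    (g' : p.obj c ⟶ p.obj (fiberInclusion.obj (descObj D k)))
    (h' : p.map (transport D u g h) ≫ descBase D j = g' ≫ descBase D k)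
    (h'' : p.map u ≫ descBase D i = g' ≫ descBase D k) :
    transport D (transport D u g h) g' h' = transport D u g' h'' := by
  refine (transport_eq D (p.map u ≫ descBase D i) (g ≫ eqToHom (map_fiberInclusion (descObj D j)))
    (g' ≫ eqToHom (map_fiberInclusion (descObj D k))) ((comp_descBase D _).trans h.symm)
    ((comp_descBase D _).trans h''.symm) (IsCartesian.map p
        (p.map u ≫ eqToHom (map_fiberInclusion (descObj D i)))
      (pullMap p (p.map u ≫ eqToHom (map_fiberInclusion (descObj D i))) (descObj D i)) u ≫
    fiberInclusion.map (descHom D (p.map u ≫ descBase D i)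
        (p.map u ≫ eqToHom (map_fiberInclusion (descObj D i)))
      (g ≫ eqToHom (map_fiberInclusion (descObj D j))) (comp_descBase D _)
          ((comp_descBase D _).trans h.symm)))
    (𝟙 _) _ (Category.assoc _ _ _) g' (Category.id_comp _).symm h').trans ?_
  rw [Category.assoc, ← Category.assoc (fiberInclusion.map _), ← Functor.map_comp, descHom_comp]
  rfl

theorem comp_transport {c c' : 𝒳} {i j : ι} (w : c' ⟶ c) (u : c ⟶ fiberInclusion.obj (descObj D i))
    (g : p.obj c ⟶ p.obj (fiberInclusion.obj (descObj D j)))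
        (h : p.map u ≫ descBase D i = g ≫ descBase D j)
    (h' : p.map (w ≫ u) ≫ descBase D i = (p.map w ≫ g) ≫ descBase D j) :
    w ≫ transport D u g h = transport D (w ≫ u) (p.map w ≫ g) h' := by
  have := transport_eq D (p.map u ≫ descBase D i)
      (p.map u ≫ eqToHom (map_fiberInclusion (descObj D i)))
    (g ≫ eqToHom (map_fiberInclusion (descObj D j))) (comp_descBase D _)
        ((comp_descBase D _).trans h.symm)
    (w ≫ IsCartesian.map p (p.map u ≫ eqToHom (map_fiberInclusion (descObj D i)))
      (pullMap p (p.map u ≫ eqToHom (map_fiberInclusion (descObj D i))) (descObj D i)) u) (p.map w)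
          (w ≫ u)
    (by rw [Category.assoc, IsCartesian.fac]) (p.map w ≫ g) (Category.assoc _ _ _) h'
  rw [this, Category.assoc]
  rfl

/-- A descent datum is effective as soon as its objects map cartesianly to an object over `S`,
compatibly with the transport of arrows. -/
theorem nonempty_iso_of_isCartesian (M : Fiber p S)
    (m : ∀ i, fiberInclusion.obj (descObj D i) ⟶ fiberInclusion.obj M)
    [∀ i, p.IsCartesian (f i) (m i)]
    (hm : ∀ {c : 𝒳} {i j : ι} (u : c ⟶ fiberInclusion.obj (descObj D i))
      (g : p.obj c ⟶ p.obj (fiberInclusion.obj (descObj D j)))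
      (h : p.map u ≫ descBase D i = g ≫ descBase D j), transport D u g h ≫ m j = u ≫ m i) :
    Nonempty (((fiberPseudofunctor p).toDescentData f).obj M ≅ D) := by
  let e : ∀ i, pull p (f i) M ≅ descObj D i := fun i ↦ fiberIso p (f i) (pullMap p (f i) M) (m i)
  have he : ∀ i, fiberInclusion.map (e i).hom ≫ m i = pullMap p (f i) M := fun i ↦
    fiberIso_hom_fac p (f i) (pullMap p (f i) M) (m i)
  have key : ∀ {Y : 𝒮} (q : Y ⟶ S) {i j : ι} (g : Y ⟶ X i) (g' : Y ⟶ X j) (h : g ≫ f i = q)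
      (h' : g' ≫ f j = q) (α : pull p g (pull p (f i) M) ⟶ pull p q M)
      (β : pull p q M ⟶ pull p g' (pull p (f j) M)),
      fiberInclusion.map α ≫ pullMap p q M = pullMap p g (pull p (f i) M) ≫ pullMap p (f i) M →
      fiberInclusion.map β ≫ pullMap p g' (pull p (f j) M) ≫ pullMap p (f j) M = pullMap p q M →
      pullHom p g (e i).hom ≫ descHom D q g g' h h' = (α ≫ β) ≫ pullHom p g' (e j).hom := by
    intro Y q i j g g' h h' α β hα hβ
    have hc : p.IsCartesian q (pullMap p g' (descObj D j) ≫ m j) := by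
      rw [← h']
      infer_instance
    refine fiber_hom_ext p q (pullMap p g' (descObj D j) ≫ m j) ?_
    have h2 : fiberInclusion.map (descHom D q g g' h h') ≫ pullMap p g' (descObj D j) ≫ m j =
        pullMap p g (descObj D i) ≫ m i := by
      have e0 : p.map (pullMap p g (descObj D i)) =
          eqToHom (map_fiberInclusion (pull p g (descObj D i))) ≫ g ≫
            eqToHom (map_fiberInclusion (descObj D i)).symm :=
        IsHomLift.fac' p g (pullMap p g (descObj D i))
      have e1 : p.map (pullMap p g (descObj D i)) ≫ descBase D i =
          (eqToHom (map_fiberInclusion (pull p g (descObj D i))) ≫ g' ≫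
            eqToHom (map_fiberInclusion (descObj D j)).symm) ≫ descBase D j := by
        rw [← comp_descBase, ← comp_descBase, e0]
        simp only [Category.assoc, eqToHom_trans_assoc, eqToHom_refl, Category.id_comp]
        rw [h, h']
      have : p.IsHomLift (eqToHom (map_fiberInclusion (pull p g (descObj D i))))
          (𝟙 (fiberInclusion.obj (pull p g (descObj D i)))) :=
        IsHomLift.id_lift_eqToHom_domain _ rfl
      have e2 := hm (pullMap p g (descObj D i)) _ e1
      rw [transport_eq D q g g' h h' (𝟙 _)
        (eqToHom (map_fiberInclusion (pull p g (descObj D i)))) _ (Category.id_comp _) _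
        (by simp) e1, Category.id_comp, Category.assoc] at e2
      exact e2
    calc _ = fiberInclusion.map (pullHom p g (e i).hom) ≫ pullMap p g (descObj D i) ≫ m i := by
          rw [Functor.map_comp, Category.assoc, h2]
      _ = pullMap p g _ ≫ pullMap p (f i) M := by
          rw [← Category.assoc, pullHom_fac, Category.assoc, he]
      _ = fiberInclusion.map α ≫ fiberInclusion.map β ≫ pullMap p g' _ ≫
            fiberInclusion.map (e j).hom ≫ m j := by rw [he, hβ, hα]
      _ = _ := by
          rw [← Category.assoc (pullMap p g' _), ← pullHom_fac]
          simp only [Functor.map_comp, Category.assoc]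
  exact ⟨Pseudofunctor.DescentData.isoMk e fun Y q i j g g' h h' ↦
    key q g g' h h' _ _ (mapComp'_inv_fac p g (f i) q h _ M) (mapComp'_hom_fac p g' (f j) q h' _ M)⟩

/-- The descent of morphisms, in terms of arrows of the total category. -/
theorem bijective_toDescentData_map (M N : Fiber p S)
    (H : ∀ ψ : ∀ i, fiberInclusion.obj (pull p (f i) M) ⟶ fiberInclusion.obj N,
      (∀ i, p.IsHomLift (f i) (ψ i)) →
      (∀ (c : 𝒳) (i j : ι) (u : c ⟶ fiberInclusion.obj (pull p (f i) M))
        (v : c ⟶ fiberInclusion.obj (pull p (f j) M)),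
        u ≫ pullMap p (f i) M = v ≫ pullMap p (f j) M → u ≫ ψ i = v ≫ ψ j) →
      ∃! φ : M ⟶ N, ∀ i, pullMap p (f i) M ≫ fiberInclusion.map φ = ψ i) :
    Function.Bijective
      (((fiberPseudofunctor p).toDescentData f).map :
        ((M : (fiberPseudofunctor p).obj (.mk (op S))) ⟶
          (N : (fiberPseudofunctor p).obj (.mk (op S)))) → _) := by
  constructor
  · intro (φ : M ⟶ N) (φ' : M ⟶ N) h
    have h1 : ∀ i, pullHom p (f i) φ = pullHom p (f i) φ' :=
      fun i ↦ congrArg (fun θ ↦ Pseudofunctor.DescentData.Hom.hom θ i) h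
    refine (H (fun i ↦ pullMap p (f i) M ≫ fiberInclusion.map φ)
      (fun i ↦ isHomLift_pullMap_comp p (f i) φ) ?_).unique
      (fun i ↦ rfl) fun i ↦ ?_
    · intro c i j u v huv
      rw [← Category.assoc, huv, Category.assoc]
    · rw [← pullHom_fac, ← pullHom_fac, h1]
  · intro Φ
    let φ : ∀ i, pull p (f i) M ⟶ pull p (f i) N := fun i ↦ Φ.hom i
    have key : ∀ {Y : 𝒮} (q : Y ⟶ S) {i j : ι} (g : Y ⟶ X i) (g' : Y ⟶ X j) (h : g ≫ f i = q)
        (h' : g' ≫ f j = q), ∃ (α : pull p g (pull p (f i) M) ⟶ pull p g' (pull p (f j) M))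
        (β : pull p g (pull p (f i) N) ⟶ pull p g' (pull p (f j) N)),
        fiberInclusion.map α ≫ pullMap p g' (pull p (f j) M) ≫ pullMap p (f j) M =
          pullMap p g (pull p (f i) M) ≫ pullMap p (f i) M ∧
        fiberInclusion.map β ≫ pullMap p g' (pull p (f j) N) ≫ pullMap p (f j) N =
          pullMap p g (pull p (f i) N) ≫ pullMap p (f i) N ∧
        pullHom p g (φ i) ≫ β = α ≫ pullHom p g' (φ j) := by
      intro Y q i j g g' h h'
      have hg : (f i).op.toLoc ≫ g.op.toLoc = q.op.toLoc := by rw [← h]; rfl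
      have hg' : (f j).op.toLoc ≫ g'.op.toLoc = q.op.toLoc := by rw [← h']; rfl
      have aux : ∀ (A : Fiber p S) (α : pull p g (pull p (f i) A) ⟶ pull p q A)
          (β : pull p q A ⟶ pull p g' (pull p (f j) A)),
          fiberInclusion.map α ≫ pullMap p q A = pullMap p g _ ≫ pullMap p (f i) A →
          fiberInclusion.map β ≫ pullMap p g' _ ≫ pullMap p (f j) A = pullMap p q A →
          fiberInclusion.map (α ≫ β) ≫ pullMap p g' (pull p (f j) A) ≫ pullMap p (f j) A =
            pullMap p g (pull p (f i) A) ≫ pullMap p (f i) A := fun A α β hα hβ ↦ by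
        rw [Functor.map_comp, Category.assoc, hβ, hα]
      exact ⟨_, _,
        aux M _ _ (mapComp'_inv_fac p g (f i) q h hg M) (mapComp'_hom_fac p g' (f j) q h' hg' M),
        aux N _ _ (mapComp'_inv_fac p g (f i) q h hg N) (mapComp'_hom_fac p g' (f j) q h' hg' N),
            Φ.comm q g g' h h'⟩
    obtain ⟨θ, hθ, -⟩ := H (fun i ↦ fiberInclusion.map (φ i) ≫ pullMap p (f i) N)
      (fun i ↦ inferInstance) fun c i j u v huv ↦ by
        have e0 := congrArg p.map huv
        have hi := IsHomLift.fac' p (f i) (pullMap p (f i) M)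
        have hj := IsHomLift.fac' p (f j) (pullMap p (f j) M)
        rw [Functor.map_comp, Functor.map_comp, hi, hj] at e0
        have e1 : (p.map u ≫ eqToHom (map_fiberInclusion (pull p (f i) M))) ≫ f i =
            (p.map v ≫ eqToHom (map_fiberInclusion (pull p (f j) M))) ≫ f j := by
          simpa using congrArg (· ≫ eqToHom (map_fiberInclusion M)) e0
        obtain ⟨α, β, hα, hβ, hαβ⟩ := key _ _ _ rfl e1.symm
        obtain ⟨u', hu', hu''⟩ : ∃ u' : c ⟶ _, u' ≫ pullMap p
            (p.map u ≫ eqToHom (map_fiberInclusion (pull p (f i) M))) _ = u ∧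
            p.IsHomLift (𝟙 (p.obj c)) u' :=
          ⟨_, IsCartesian.fac p (p.map u ≫ eqToHom (map_fiberInclusion (pull p (f i) M)))
            (pullMap p (p.map u ≫ eqToHom (map_fiberInclusion (pull p (f i) M))) _) u,
            inferInstance⟩
        have hv : u' ≫ fiberInclusion.map α ≫ pullMap p _ _ = v := by
          refine IsStronglyCartesian.ext p (f j) (pullMap p (f j) M)
            (p.map v ≫ eqToHom (map_fiberInclusion (pull p (f j) M))) ?_
          rw [Category.assoc, Category.assoc, hα, ← Category.assoc, hu', huv]
        calc u ≫ fiberInclusion.map (φ i) ≫ pullMap p (f i) N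
            = u' ≫ fiberInclusion.map (pullHom p _ (φ i)) ≫ pullMap p _ _ ≫ pullMap p (f i) N := by
              rw [← Category.assoc (fiberInclusion.map _), pullHom_fac, Category.assoc,
                ← Category.assoc u', hu']
          _ = u' ≫ fiberInclusion.map (pullHom p _ (φ i) ≫ β) ≫ pullMap p _ _ ≫
                pullMap p (f j) N := by
              rw [← hβ, Functor.map_comp, Category.assoc]
          _ = (u' ≫ fiberInclusion.map α ≫ pullMap p _ _) ≫
                fiberInclusion.map (φ j) ≫ pullMap p (f j) N := by
              rw [hαβ, Functor.map_comp]
              simp only [Category.assoc]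
              rw [← Category.assoc (fiberInclusion.map (pullHom p _ (φ j))), pullHom_fac,
                Category.assoc]
          _ = _ := by rw [hv]
    refine ⟨θ, Pseudofunctor.DescentData.hom_ext fun i ↦ ?_⟩
    refine pull_hom_ext p (f i) N (pull p (f i) M) ?_
    exact (pullHom_fac p (f i) (a := M) (b := N) θ).trans (hθ i)

end FibredStack

/-! ### Lie algebroids over a category of manifolds -/

/-- The étale maps which are injective, that is, the diffeomorphisms onto open subsets. -/
def Man.IsOpenImm {X Y : Man.{u}} (f : X ⟶ Y) : Prop :=
  IsEtale f ∧ Function.Injective f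

namespace LAOver

variable {𝒮 : Type u₁} [Category.{v₁} 𝒮] {b : 𝒮 ⥤ Man.{u}}

theorem hom_ext {P Q : LAOver b} {φ ψ : P ⟶ Q} (hb : φ.base = ψ.base)
    (h : ∀ a, LA.Hom.tot φ.hom a = LA.Hom.tot ψ.hom a) : φ = ψ :=
  LAOver.Hom.ext hb (LA.hom_ext h)

theorem tot_comp {P Q R : LAOver b} (φ : P ⟶ Q) (ψ : Q ⟶ R) (a : Σ x, P.alg.Fiber x) :
    LA.Hom.tot (φ ≫ ψ).hom a = LA.Hom.tot ψ.hom (LA.Hom.tot φ.hom a) := rfl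

theorem tot_injective_of_bijective {P Q : LA.{u}} (φ : P ⟶ Q)
    (hb : Function.Injective φ.base) (h : ∀ x, Function.Injective (φ.algHom.toFun x)) :
    Function.Injective (LA.Hom.tot φ) := by
  rintro ⟨x, a⟩ ⟨x', a'⟩ e
  obtain rfl : x = x' := hb (congrArg Sigma.fst e)
  exact congrArg (Sigma.mk x) (h x (eq_of_heq (Sigma.mk.inj e).2))

theorem base_eq_of_isHomLift {P Q : LAOver b} (f : P.base ⟶ Q.base) (φ : P ⟶ Q)
    (h : (proj b).IsHomLift f φ) : φ.base = f :=
  (@IsHomLift.eq_of_isHomLift _ _ _ _ (proj b) P Q f φ h).symm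

theorem isHomLift_of_base_eq {P Q : LAOver b} {f : P.base ⟶ Q.base} (φ : P ⟶ Q)
    (h : φ.base = f) : (proj b).IsHomLift f φ := by
  subst h
  exact (inferInstance : (proj b).IsHomLift ((proj b).map φ) φ)

theorem isStronglyCartesian_of_isCart {P Q : LAOver b} (φ : P ⟶ Q)
    (h : φ.hom.algHom.IsCart) : (proj b).IsStronglyCartesian φ.base φ where
  toIsHomLift := (inferInstance : (proj b).IsHomLift ((proj b).map φ) φ)
  universal_property' {R} g ψ hψ := by
    have hb : ψ.base = g ≫ φ.base := base_eq_of_isHomLift (P := R) (g ≫ φ.base) ψ hψ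
    obtain ⟨χ, ⟨h1, h2⟩, hu⟩ := LA.existsUnique_lift h ψ.hom (b.map g) (by
      exact ψ.hom_base.trans ((congrArg b.map hb).trans ((b.map_comp (X := R.base) g φ.base).trans
        (congrArg (b.map (X := R.base) g ≫ ·) φ.hom_base.symm))))
    let χ' : R ⟶ P := ⟨g, χ, h1⟩
    refine ⟨χ', ⟨(inferInstance : (proj b).IsHomLift ((proj b).map χ') χ'),
      LAOver.Hom.ext hb.symm h2⟩, ?_⟩
    rintro χ'' ⟨h3, h4⟩
    have h5 : χ''.base = g := base_eq_of_isHomLift (P := R) g χ'' h3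
    exact LAOver.Hom.ext h5 (hu _ ⟨by rw [χ''.hom_base, h5], congrArg LAOver.Hom.hom h4⟩)

/-- The pullback of a Lie algebroid along a morphism of the base category which is a submersion. -/
noncomputable def pb (P : LAOver b) {W : 𝒮} (g : W ⟶ P.base) (hg : Man.submersion (b.map g)) :
    LAOver b := ⟨W, P.alg.pullback (b.map g) hg⟩

/-- The projection of the pullback of a Lie algebroid. -/
noncomputable def pbMap (P : LAOver b) {W : 𝒮} (g : W ⟶ P.base)
    (hg : Man.submersion (b.map g)) : P.pb g hg ⟶ P :=
  ⟨g, ⟨b.map g, P.alg.pullbackHom (b.map g) hg⟩, rfl⟩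

theorem isStronglyCartesian_pbMap (P : LAOver b) {W : 𝒮} (g : W ⟶ P.base)
    (hg : Man.submersion (b.map g)) : (proj b).IsStronglyCartesian g (P.pbMap g hg) :=
  isStronglyCartesian_of_isCart (P.pbMap g hg) (P.alg.isCart_pullbackHom (b.map g) hg)

theorem isFibered_proj (h : ∀ {S T : 𝒮} (f : S ⟶ T), Man.submersion (b.map f)) :
    (proj b).IsFibered :=
  Functor.IsFibered.of_exists_isStronglyCartesian fun P _ g ↦
    ⟨_, P.pbMap g (h g), P.isStronglyCartesian_pbMap g (h g)⟩

theorem bijective_pbMap (P : LAOver b) {W : 𝒮} (g : W ⟶ P.base) (hg : Man.IsEtale (b.map g))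
    (x : b.obj W) : Function.Bijective ((P.pbMap g hg.submersion).hom.algHom.toFun x) :=
  (P.alg.isCart_pullbackHom (b.map g) hg.submersion).bijective hg x

theorem exists_tot_pbMap (P : LAOver b) {W : 𝒮} (g : W ⟶ P.base) (hg : Man.IsEtale (b.map g))
    (x : b.obj W) (a : Σ y, P.alg.Fiber y) (ha : b.map g x = a.1) :
    ∃ c, LA.Hom.tot (P.pbMap g hg.submersion).hom ⟨x, c⟩ = a := by
  obtain ⟨y, a⟩ := a
  obtain rfl : b.map g x = y := ha
  obtain ⟨c, hc⟩ := (P.bijective_pbMap g hg x).2 a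
  exact ⟨c, congrArg (Sigma.mk _) hc⟩

/-- Cartesian arrows over étale maps are fibrewise bijective. -/
theorem bijective_of_isCartesian {P Q : LAOver b} (φ : P ⟶ Q) {S T : 𝒮} (f : S ⟶ T)
    [hφ : (proj b).IsCartesian f φ] (he : Man.IsEtale (b.map φ.base)) (x : b.obj P.base) :
    Function.Bijective (φ.hom.algHom.toFun x) := by
  have h1 : (proj b).IsHomLift f φ := inferInstance
  have h2 : ∃ (g : P.base ⟶ Q.base), g = φ.base ∧ (proj b).IsCartesian g φ := by
    cases h1
    exact ⟨_, rfl, hφ⟩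
  obtain ⟨_, rfl, h3⟩ := h2
  -- `φ` is isomorphic to the projection of the pullback, by an isomorphism `θ` over the identity.
  have h4 := Q.isStronglyCartesian_pbMap φ.base he.submersion
  let θ : P ≅ Q.pb φ.base he.submersion :=
    Functor.IsCartesian.domainUniqueUpToIso (proj b) φ.base (Q.pbMap φ.base he.submersion) φ
  have h5 : θ.hom ≫ Q.pbMap φ.base he.submersion = φ :=
    Functor.IsCartesian.fac (proj b) φ.base (Q.pbMap φ.base he.submersion) φ
  have h6 : θ.hom.base = 𝟙 _ :=
    base_eq_of_isHomLift (P := P) (Q := Q.pb φ.base he.submersion) (𝟙 P.base) θ.hom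
      (Functor.IsCartesian.domainUniqueUpToIso_inv_isHomLift (proj b) φ.base
        (Q.pbMap φ.base he.submersion) φ)
  have h7 : ∀ y, θ.hom.hom.base y = y := fun y ↦ by
    have e : θ.hom.hom.base = 𝟙 (b.obj P.base) :=
      θ.hom.hom_base.trans ((congrArg b.map h6).trans (b.map_id P.base))
    exact congrArg (fun k : b.obj P.base ⟶ b.obj P.base ↦ k y) e
  have h8 : Function.LeftInverse (LA.Hom.tot θ.inv.hom) (LA.Hom.tot θ.hom.hom) := fun a ↦ by
    rw [← tot_comp, θ.hom_inv_id]
    rfl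
  have h9 : Function.LeftInverse (LA.Hom.tot θ.hom.hom) (LA.Hom.tot θ.inv.hom) := fun a ↦ by
    rw [← tot_comp, θ.inv_hom_id]
    rfl
  have hk := Q.bijective_pbMap φ.base he
  have h10 : ∀ a, LA.Hom.tot φ.hom a =
      LA.Hom.tot (Q.pbMap φ.base he.submersion).hom (LA.Hom.tot θ.hom.hom a) := fun a ↦ by
    rw [← tot_comp, h5]
  constructor
  · intro a a' e
    have e1 : LA.Hom.tot φ.hom ⟨x, a⟩ = LA.Hom.tot φ.hom ⟨x, a'⟩ := congrArg (Sigma.mk _) e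
    rw [h10, h10] at e1
    have e2 : LA.Hom.tot θ.hom.hom ⟨x, a⟩ = LA.Hom.tot θ.hom.hom ⟨x, a'⟩ :=
      congrArg (Sigma.mk _) ((hk _).1 (eq_of_heq (Sigma.mk.inj e1).2))
    exact eq_of_heq (Sigma.mk.inj (h8.injective e2)).2
  · intro c
    obtain ⟨d, hd⟩ := Q.exists_tot_pbMap φ.base he x ⟨φ.hom.base x, c⟩
      (congrArg (fun k : b.obj P.base ⟶ b.obj Q.base ↦ k x) φ.hom_base.symm)
    obtain ⟨⟨x', a⟩, ha⟩ := h9.surjective ⟨x, d⟩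
    obtain rfl : x' = x := (h7 x').symm.trans (congrArg Sigma.fst ha)
    have e1 := h10 ⟨x', a⟩
    rw [ha, hd] at e1
    exact ⟨a, eq_of_heq (Sigma.mk.inj e1).2⟩

end LAOver

/-! ### Descent of morphisms -/

/-- A morphism of Lie algebroids over `X` can be defined on a family of cartesian morphisms with
codomain `A` of which those over étale maps cover `X`. -/
theorem LieAlgebroid.exists_hom_of_cover {X : Man.{u}} {A B : LieAlgebroid X} {ι : Type w}
    (Q : ι → LA.{u}) (κ : ∀ i, Q i ⟶ ⟨X, A⟩)
    (cover : ∀ x : X, ∃ i, (∀ y, Function.Bijective ((κ i).algHom.toFun y)) ∧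
      Man.IsOpenImm (κ i).base ∧ ∃ y, (κ i).base y = x)
    (ψ : ∀ i, Q i ⟶ ⟨X, B⟩) (hψ : ∀ i, (ψ i).base = (κ i).base)
    (compat : ∀ i j a a', Man.IsOpenImm (κ i).base → LA.Hom.tot (κ i) a = LA.Hom.tot (κ j) a' →
      LA.Hom.tot (ψ i) a = LA.Hom.tot (ψ j) a') :
    ∃ φ : A.Hom B (𝟙 X), ∀ i a,
      LA.Hom.tot (ψ i) a = LA.Hom.tot (⟨𝟙 X, φ⟩ : LA.Hom ⟨X, A⟩ ⟨X, B⟩) (LA.Hom.tot (κ i) a) := by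
  have h0 : ∀ i, ∃ θ : (Q i).alg.Hom B (κ i).base, ψ i = ⟨(κ i).base, θ⟩ := fun i ↦ by
    have := hψ i
    generalize ψ i = ψi at this
    obtain ⟨k, θ⟩ := ψi
    obtain rfl : k = (κ i).base := this
    exact ⟨θ, rfl⟩
  choose θ hθ using h0
  have h1 : ∀ x : X, ∃ L : A.Fiber x →ₗ[ℝ] B.Fiber x, ∀ j a' v,
      LA.Hom.tot (κ j) a' = ⟨x, v⟩ → LA.Hom.tot (ψ j) a' = ⟨x, L v⟩ := by
    intro x
    obtain ⟨i, hb, he, y, rfl⟩ := cover x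
    refine ⟨((θ i).toFun y).comp (LinearEquiv.ofBijective _ (hb y)).symm.toLinearMap,
      fun j a' v h ↦ ?_⟩
    have e : LA.Hom.tot (κ i) ⟨y, (LinearEquiv.ofBijective _ (hb y)).symm v⟩ = ⟨_, v⟩ :=
      congrArg (Sigma.mk _) ((LinearEquiv.ofBijective _ (hb y)).apply_symm_apply v)
    rw [← compat i j _ a' he (e.trans h.symm), hθ i]
    rfl
  choose L hL using h1
  obtain ⟨φ, hφ⟩ := LieAlgebroid.exists_hom_of_local (A := A) (B := B) (𝟙 X) L fun x ↦ by
    obtain ⟨i, hb, he, y, hy⟩ := cover x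
    refine ⟨(Q i).base, (Q i).alg, (κ i).base, (κ i).algHom, (θ i), y, he.1,
      LieAlgebroid.Hom.isCart_of_bijective he.1 hb, hy, fun z c ↦ ?_⟩
    have := hL _ i ⟨z, c⟩ _ rfl
    rw [hθ i] at this
    exact eq_of_heq (Sigma.mk.inj this).2
  refine ⟨φ, fun i a ↦ (hL _ i a _ rfl).trans ?_⟩
  rw [← hφ]
  rfl

namespace LAOver

variable {𝒮 : Type u₁} [Category.{v₁} 𝒮] {b : 𝒮 ⥤ Man.{u}}

/-- The properties of the base categories which descent of Lie algebroids requires: all morphisms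
are submersions, and the fibre product of a morphism with an open immersion can be approximated
locally in the base category. -/
class IsLocalBase (b : 𝒮 ⥤ Man.{u}) : Prop where
  faithful : b.Faithful
  submersion {S T : 𝒮} (f : S ⟶ T) : Man.submersion (b.map f)
  refine {S Y₁ Y₂ : 𝒮} (q₁ : Y₁ ⟶ S) (q₂ : Y₂ ⟶ S) (h : Man.IsOpenImm (b.map q₂)) (y₁ : b.obj Y₁)
    (y₂ : b.obj Y₂) (e : b.map q₁ y₁ = b.map q₂ y₂) : ∃ (W : 𝒮) (g₁ : W ⟶ Y₁) (g₂ : W ⟶ Y₂)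
      (z : b.obj W), Man.IsOpenImm (b.map g₁) ∧ g₁ ≫ q₁ = g₂ ≫ q₂ ∧ b.map g₁ z = y₁ ∧
        b.map g₂ z = y₂

theorem tot_injective_of_isCartesian {P Q : LAOver b} (κ : P ⟶ Q) {S T : 𝒮} (f : S ⟶ T)
    [(proj b).IsCartesian f κ] (h : Man.IsOpenImm (b.map κ.base)) :
    Function.Injective (LA.Hom.tot κ.hom) :=
  tot_injective_of_bijective κ.hom (by rw [κ.hom_base]; exact h.2)
    fun x ↦ (bijective_of_isCartesian κ f h.1 x).1

/-- The approximation of fibre products with open immersions, lifted to Lie algebroids. -/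
theorem exists_refine [IsLocalBase b] {S Y : 𝒮} (P : LAOver b) (q₁ : P.base ⟶ S) (q₂ : Y ⟶ S)
    (h : Man.IsOpenImm (b.map q₂)) (a : Σ x, P.alg.Fiber x) (y : b.obj Y)
    (e : b.map q₁ a.1 = b.map q₂ y) :
    ∃ (c : LAOver b) (s : c ⟶ P) (g : c.base ⟶ Y) (c₀ : Σ x, c.alg.Fiber x),
      Man.IsOpenImm (b.map s.base) ∧ (proj b).IsStronglyCartesian s.base s ∧
        s.base ≫ q₁ = g ≫ q₂ ∧ LA.Hom.tot s.hom c₀ = a ∧ b.map g c₀.1 = y := by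
  obtain ⟨W, g₁, g₂, z, hg₁, hg, hz₁, hz₂⟩ := IsLocalBase.refine q₁ q₂ h _ _ e
  obtain ⟨c, hc⟩ := P.exists_tot_pbMap g₁ hg₁.1 z a hz₁
  exact ⟨_, P.pbMap g₁ hg₁.1.submersion, g₂, ⟨z, c⟩, hg₁,
    P.isStronglyCartesian_pbMap g₁ hg₁.1.submersion, hg, hc, hz₂⟩

/-- Morphisms from `A` to `B` correspond to compatible families of arrows on cartesian arrows to `A`
of which those over open immersions cover the base. -/
theorem existsUnique_hom_of_cover [IsLocalBase b] {S : 𝒮} (A B : LieAlgebroid (b.obj S))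
    {ι : Type w} (Q : ι → LAOver b) (κ : ∀ i, Q i ⟶ ⟨S, A⟩)
    (hκ : ∀ i, (proj b).IsStronglyCartesian (κ i).base (κ i))
    (cover : ∀ x, ∃ i, Man.IsOpenImm (b.map (κ i).base) ∧ ∃ y, b.map (κ i).base y = x)
    (ψ : ∀ i, Q i ⟶ ⟨S, B⟩) (hψ : ∀ i, (ψ i).base = (κ i).base)
    (compat : ∀ (c : LAOver b) (i j : ι) (s : c ⟶ Q i) (t : c ⟶ Q j), s ≫ κ i = t ≫ κ j →
      s ≫ ψ i = t ≫ ψ j) :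
    ∃! φ : (⟨S, A⟩ : LAOver b) ⟶ ⟨S, B⟩, φ.base = 𝟙 S ∧ ∀ i, κ i ≫ φ = ψ i := by
  -- Compatibility on arrows gives compatibility on vectors: two vectors with the same image in `A`
  -- come from one vector of a common refinement.
  have key : ∀ i j a a', Man.IsOpenImm (b.map (κ i).base) →
      LA.Hom.tot (κ i).hom a = LA.Hom.tot (κ j).hom a' →
      LA.Hom.tot (ψ i).hom a = LA.Hom.tot (ψ j).hom a' := by
    intro i j a a' hi e
    have e0 : b.map (κ j).base a'.1 = b.map (κ i).base a.1 := by
      rw [← (κ j).hom_base, ← (κ i).hom_base]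
      exact (congrArg Sigma.fst e).symm
    obtain ⟨c, s, g, c₀, -, -, hg, hc, hz⟩ := exists_refine (Q j) _ _ hi a' a.1 e0
    have hs : (proj b).IsHomLift (s.base ≫ (κ j).base) (s ≫ κ j) :=
      isHomLift_of_base_eq (s ≫ κ j) rfl
    have := hκ i
    let t : c ⟶ Q i := Functor.IsStronglyCartesian.map (proj b) (κ i).base (κ i) hg (s ≫ κ j)
    have ht : t ≫ κ i = s ≫ κ j :=
      Functor.IsStronglyCartesian.fac (proj b) (κ i).base (κ i) hg (s ≫ κ j)
    have e1 : LA.Hom.tot t.hom c₀ = a := by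
      refine tot_injective_of_isCartesian (κ i) (κ i).base hi ?_
      rw [e, ← tot_comp, ht, tot_comp, ← hc]
    rw [← e1, ← hc, ← tot_comp, ← tot_comp, compat _ j i s t ht.symm]
  obtain ⟨φ, hφ⟩ := LieAlgebroid.exists_hom_of_cover (A := A) (B := B) (fun i ↦ (Q i).toLA)
    (fun i ↦ (κ i).hom) (fun x ↦ by
      obtain ⟨i, hi, y, hy⟩ := cover x
      have e := (κ i).hom_base
      have := hκ i
      exact ⟨i, bijective_of_isCartesian (κ i) (κ i).base hi.1, e ▸ hi, y, e ▸ hy⟩)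
    (fun i ↦ (ψ i).hom) (fun i ↦ by rw [(ψ i).hom_base, (κ i).hom_base, hψ i])
    (fun i j a a' hi ↦ key i j a a' ((κ i).hom_base ▸ hi))
  refine ⟨⟨𝟙 S, ⟨𝟙 _, φ⟩, (b.map_id S).symm⟩, ⟨rfl, fun i ↦ hom_ext ?_ fun a ↦ (hφ i a).symm⟩, ?_⟩
  · exact (Category.comp_id (κ i).base).trans (hψ i).symm
  · rintro φ' ⟨h1, h2⟩
    refine hom_ext h1 fun a ↦ ?_
    obtain ⟨i, hi, y, hy⟩ := cover a.1
    have := hκ i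
    obtain ⟨c, hc⟩ : ∃ c, LA.Hom.tot (κ i).hom ⟨y, c⟩ = a := by
      obtain ⟨x, a⟩ := a
      rw [← (κ i).hom_base] at hy
      obtain rfl : (κ i).hom.base y = x := hy
      obtain ⟨c, hc⟩ := (bijective_of_isCartesian (κ i) (κ i).base hi.1 y).2 a
      exact ⟨c, congrArg (Sigma.mk _) hc⟩
    rw [← hc, ← tot_comp, h2, hφ i]

instance [IsLocalBase b] : (proj b).IsFibered := isFibered_proj IsLocalBase.submersion

/-- A property of a morphism of the base category holds for the base of any arrow over it. -/
theorem of_isHomLift {P Q : LAOver b} {S T : 𝒮} (f : S ⟶ T) (φ : P ⟶ Q)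
    (h : (proj b).IsHomLift f φ) (Pr : ∀ {S T : 𝒮}, (S ⟶ T) → Prop) (hf : Pr f) : Pr φ.base := by
  cases h
  exact hf

theorem openImm_eqToHom {R R' T : 𝒮} (h : R' = R) (h' : T = T) (f : R ⟶ T) (x : b.obj T)
    (hf : Man.IsOpenImm (b.map f) ∧ ∃ y, b.map f y = x) :
    Man.IsOpenImm (b.map (eqToHom h ≫ f ≫ eqToHom h')) ∧
      ∃ y, b.map (eqToHom h ≫ f ≫ eqToHom h') y = x := by
  subst h
  simpa using hf

/-- Morphisms in the fibres descend along families of morphisms of which those which are open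
immersions cover the base. -/
theorem bijective_toDescentData_map [IsLocalBase b] {S : 𝒮} {ι : Type w} {X : ι → 𝒮}
    (f : ∀ i, X i ⟶ S)
    (cover : ∀ x, ∃ i, Man.IsOpenImm (b.map (f i)) ∧ ∃ y, b.map (f i) y = x)
    (M N : (FibredStack.fiberPseudofunctor (proj b)).obj (.mk (.op S))) :
    Function.Bijective (((FibredStack.fiberPseudofunctor (proj b)).toDescentData f).map :
      (M ⟶ N) → _) := by
  obtain ⟨⟨S', A⟩, hM⟩ := M
  obtain ⟨⟨S'', B⟩, hN⟩ := N
  obtain rfl : S' = S := hM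
  obtain rfl : S'' = S' := hN
  let M : Functor.Fiber (proj b) S'' := ⟨⟨S'', A⟩, rfl⟩
  let N : Functor.Fiber (proj b) S'' := ⟨⟨S'', B⟩, rfl⟩
  refine FibredStack.bijective_toDescentData_map M N fun ψ hψ compat ↦ ?_
  let κ : ∀ i, (FibredStack.pull (proj b) (f i) M).1 ⟶ (⟨S'', A⟩ : LAOver b) :=
    fun i ↦ FibredStack.pullMap (proj b) (f i) M
  let ψ' : ∀ i, (FibredStack.pull (proj b) (f i) M).1 ⟶ (⟨S'', B⟩ : LAOver b) := ψ
  have hκ : ∀ i, (proj b).IsStronglyCartesian (f i) (κ i) := fun i ↦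
    (inferInstance : (proj b).IsStronglyCartesian (f i) (FibredStack.pullMap (proj b) (f i) M))
  obtain ⟨φ, ⟨h1, h2⟩, h3⟩ := existsUnique_hom_of_cover A B _ κ
    (fun i ↦ of_isHomLift (f i) (κ i) (hκ i).toIsHomLift
      (fun g ↦ (proj b).IsStronglyCartesian g (κ i)) (hκ i))
    (fun x ↦ by
      obtain ⟨i, hi⟩ := cover x
      have hi' := openImm_eqToHom
        (IsHomLift.domain_eq (proj b) (f i) (FibredStack.pullMap (proj b) (f i) M)) rfl
        (f i) x hi
      have e : (κ i).base = eqToHom _ ≫ f i ≫ eqToHom rfl :=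
        IsHomLift.fac' (proj b) (f i) (FibredStack.pullMap (proj b) (f i) M)
      exact ⟨i, e ▸ hi'⟩) ψ'
    (fun i ↦ (IsHomLift.fac' (proj b) (f i) (ψ i)).trans
      (IsHomLift.fac' (proj b) (f i) (FibredStack.pullMap (proj b) (f i) M)).symm)
    (fun c i j s t h ↦ compat c i j s t h)
  refine ⟨⟨φ, isHomLift_of_base_eq φ h1⟩, h2, fun φ' hφ' ↦ ?_⟩
  exact Subtype.ext (h3 φ'.1 ⟨base_eq_of_isHomLift (𝟙 S'') φ'.1 φ'.2, hφ'⟩)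

/-- A sieve is covering if and only if it contains a jointly surjective family of open
immersions. -/
class HasOpenCovers (b : 𝒮 ⥤ Man.{u}) (J : GrothendieckTopology 𝒮) : Prop where
  exists_mem {S : 𝒮} {R : Sieve S} (hR : R ∈ J S) (x : b.obj S) :
    ∃ (X : 𝒮) (f : X ⟶ S), R f ∧ Man.IsOpenImm (b.map f) ∧ ∃ y, b.map f y = x
  generate_mem {S : 𝒮} (R : Presieve S) (hR : ∀ ⦃X : 𝒮⦄ (f : X ⟶ S), R f → Man.IsOpenImm (b.map f))
    (h : ∀ x : b.obj S, ∃ (X : 𝒮) (f : X ⟶ S) (y : b.obj X), R f ∧ b.map f y = x) :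
    Sieve.generate R ∈ J S

theorem isPrestack_proj [IsLocalBase b] (J : GrothendieckTopology 𝒮) [HasOpenCovers b J] :
    (FibredStack.fiberPseudofunctor (proj b)).IsPrestack J := by
  refine .of_isPrestackFor fun S R hR ↦ ?_
  rw [Pseudofunctor.isPrestackFor_iff, Functor.FullyFaithful.nonempty_iff_map_bijective]
  refine bijective_toDescentData_map _ fun x ↦ ?_
  obtain ⟨X, f, hf, h⟩ := HasOpenCovers.exists_mem hR x
  exact ⟨⟨Over.mk f, hf⟩, h⟩

end LAOver

/-! ### Effectiveness of descent data -/

namespace FibredStack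

variable {𝒮 : Type u₁} {𝒳 : Type u₂} [Category.{v₁} 𝒮] [Category.{v₂} 𝒳] {p : 𝒳 ⥤ 𝒮}

theorem isCartesian_comp_eqToHom {R S S' : 𝒮} {c a : 𝒳} (f : R ⟶ S) (h : S = S') (φ : c ⟶ a)
    [hφ : p.IsCartesian f φ] : p.IsCartesian (f ≫ eqToHom h) φ := by
  subst h
  simpa using hφ

open Functor.Fiber (fiberInclusion)

/-- The transport of a cartesian arrow is cartesian. -/
theorem isCartesian_transport [p.IsFibered] {S : 𝒮} {ι : Type w} {X : ι → 𝒮} {f : ∀ i, X i ⟶ S}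
    (D : (fiberPseudofunctor p).DescentData f) {c : 𝒳} {i j : ι}
    (u : c ⟶ fiberInclusion.obj (descObj D i))
        (g : p.obj c ⟶ p.obj (fiberInclusion.obj (descObj D j)))
    (h : p.map u ≫ descBase D i = g ≫ descBase D j) [p.IsCartesian (p.map u) u] :
    p.IsCartesian (g ≫ eqToHom (map_fiberInclusion (descObj D j))) (transport D u g h) := by
  have h1 := isCartesian_comp_eqToHom (p := p) (p.map u) (map_fiberInclusion (descObj D i)) u
  let θ := Functor.IsCartesian.domainUniqueUpToIso p
    (p.map u ≫ eqToHom (map_fiberInclusion (descObj D i)))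
    (pullMap p (p.map u ≫ eqToHom (map_fiberInclusion (descObj D i))) (descObj D i)) u
  let δ : pull p (p.map u ≫ eqToHom (map_fiberInclusion (descObj D i))) (descObj D i) ≅
      pull p (g ≫ eqToHom (map_fiberInclusion (descObj D j))) (descObj D j) :=
    D.iso (p.map u ≫ descBase D i) _ _ (comp_descBase D _) ((comp_descBase D _).trans h.symm)
  have h2 : p.IsHomLift (𝟙 (p.obj c)) (fiberInclusion.mapIso δ).hom :=
    (inferInstance : p.IsHomLift (𝟙 (p.obj c)) (fiberInclusion.map δ.hom))
  have h3 : p.IsCartesian (g ≫ eqToHom (map_fiberInclusion (descObj D j)))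
      ((fiberInclusion.mapIso δ).hom ≫
        pullMap p (g ≫ eqToHom (map_fiberInclusion (descObj D j))) (descObj D j)) :=
    inferInstance
  exact (inferInstance : p.IsCartesian (g ≫ eqToHom (map_fiberInclusion (descObj D j)))
    (θ.hom ≫ (fiberInclusion.mapIso δ).hom ≫
      pullMap p (g ≫ eqToHom (map_fiberInclusion (descObj D j))) (descObj D j)))

end FibredStack

namespace Man

theorem _root_.IsLocalDiffeomorphAt.congr_of_eventuallyEq {X Y : Man.{u}} {f h : X → Y} {x : X}
    (hh : IsLocalDiffeomorphAt (𝓡 X.dim) (𝓡 Y.dim) ∞ h x) (e : f =ᶠ[𝓝 x] h) :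
    IsLocalDiffeomorphAt (𝓡 X.dim) (𝓡 Y.dim) ∞ f x := by
  obtain ⟨Φ, hx, hΦ⟩ := hh
  obtain ⟨U, hU, hUo, hxU⟩ := eventually_nhds_iff.1 e
  let Ψ := Φ.toOpenPartialHomeomorph.restrOpen U hUo
  have hΨ : Ψ.source = Φ.source ∩ U := Φ.toOpenPartialHomeomorph.restrOpen_source U hUo
  refine ⟨⟨Ψ.toPartialEquiv, Ψ.open_source, Ψ.open_target,
    Φ.contMDiffOn_toFun.mono fun y hy ↦ (hΨ ▸ hy : y ∈ Φ.source ∩ U).1,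
    Φ.contMDiffOn_invFun.mono fun y hy ↦ hy.1⟩, (hΨ ▸ ⟨hx, hxU⟩ : x ∈ Ψ.source), fun y hy ↦ ?_⟩
  have hy' : y ∈ Φ.source ∩ U := hΨ ▸ hy
  exact (hU y hy'.2).trans (hΦ hy'.1)

theorem IsEtale.of_comp {X Y Z : Man.{u}} {f : X ⟶ Y} {g : Y ⟶ Z} (hg : IsEtale g)
    (h : IsEtale (f ≫ g)) : IsEtale f := by
  intro x
  have h1 : IsLocalDiffeomorphAt (𝓡 X.dim) (𝓡 Y.dim) ∞
      (fun y ↦ (hg (f x)).localInverse ((f ≫ g) y)) x :=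
    IsLocalDiffeomorphAt.comp (K := 𝓡 Y.dim) (P := Y.carrier) (h x)
      (hg (f x)).localInverse_isLocalDiffeomorphAt
  refine h1.congr_of_eventuallyEq ?_
  filter_upwards [f.contMDiff.continuous.continuousAt.eventually
    (hg (f x)).localInverse_eventuallyEq_left] with y hy
  exact hy.symm

theorem IsOpenImm.comp {X Y Z : Man.{u}} {f : X ⟶ Y} {g : Y ⟶ Z} (hf : IsOpenImm f)
    (hg : IsOpenImm g) : IsOpenImm (f ≫ g) :=
  ⟨hf.1.comp hg.1, hg.2.comp hf.2⟩

end Man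

namespace LAOver

variable {𝒮 : Type u₁} [Category.{v₁} 𝒮] {b : 𝒮 ⥤ Man.{u}}

/-- A descent datum for Lie algebroids over a family of open immersions, as a family of Lie
algebroids with a transport of arrows. -/
structure TransportData (b : 𝒮 ⥤ Man.{u}) (S : 𝒮) (ι : Type w) where
  E : ι → LAOver b
  r : ∀ i, (E i).base ⟶ S
  openImm : ∀ i, Man.IsOpenImm (b.map (r i))
  surj : ∀ x : b.obj S, ∃ i y, b.map (r i) y = x
  tr : ∀ {c : LAOver b} {i j : ι} (s : c ⟶ E i) (g : c.base ⟶ (E j).base),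
    s.base ≫ r i = g ≫ r j → (c ⟶ E j)
  tr_base : ∀ {c : LAOver b} {i j : ι} (s : c ⟶ E i) (g : c.base ⟶ (E j).base)
    (h : s.base ≫ r i = g ≫ r j), (tr s g h).base = g
  tr_tr : ∀ {c : LAOver b} {i j k : ι} (s : c ⟶ E i) (g : c.base ⟶ (E j).base)
    (h : s.base ≫ r i = g ≫ r j) (g' : c.base ⟶ (E k).base)
    (h' : (tr s g h).base ≫ r j = g' ≫ r k) (h'' : s.base ≫ r i = g' ≫ r k),
    tr (tr s g h) g' h' = tr s g' h''
  comp_tr : ∀ {c c' : LAOver b} {i j : ι} (v : c' ⟶ c) (s : c ⟶ E i) (g : c.base ⟶ (E j).base)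
    (h : s.base ≫ r i = g ≫ r j) (h' : (v ≫ s).base ≫ r i = (v.base ≫ g) ≫ r j),
    v ≫ tr s g h = tr (v ≫ s) (v.base ≫ g) h'
  exists_isCartesian : ∀ {c : LAOver b} {i j : ι} (s : c ⟶ E i) (g : c.base ⟶ (E j).base)
    (h : s.base ≫ r i = g ≫ r j), (proj b).IsCartesian s.base s →
    ∃ (T : 𝒮) (k : c.base ⟶ T), (proj b).IsCartesian k (tr s g h)

namespace TransportData

variable {S : 𝒮} {ι : Type w} (D : TransportData b S ι)

/-- The transport of a cartesian arrow over an étale map is étale on bases and fibrewise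
bijective. -/
theorem bijective_tr {c : LAOver b} {i j : ι} (s : c ⟶ D.E i) (g : c.base ⟶ (D.E j).base)
    (h : s.base ≫ D.r i = g ≫ D.r j) (hs : (proj b).IsCartesian s.base s)
    (he : Man.IsEtale (b.map s.base)) :
    Man.IsEtale (b.map (D.tr s g h).base) ∧
      ∀ x, Function.Bijective ((D.tr s g h).hom.algHom.toFun x) := by
  have hg : Man.IsEtale (b.map g) := by
    refine (D.openImm j).1.of_comp ?_
    rw [← b.map_comp, ← h, b.map_comp]
    exact he.comp (D.openImm i).1
  obtain ⟨T, k, hk⟩ := D.exists_isCartesian s g h hs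
  have := (D.tr_base s g h).symm ▸ hg
  exact ⟨this, fun x ↦ bijective_of_isCartesian _ k this x⟩

theorem tr_congr {c : LAOver b} {i j : ι} {s s' : c ⟶ D.E i} {g g' : c.base ⟶ (D.E j).base}
    (hs : s = s') (hg : g = g') (h : s.base ≫ D.r i = g ≫ D.r j)
    (h' : s'.base ≫ D.r i = g' ≫ D.r j) : D.tr s g h = D.tr s' g' h' := by
  subst hs hg
  rfl

variable [IsLocalBase b]

theorem hom_ext_r {W : 𝒮} {i : ι} {g g' : W ⟶ (D.E i).base} (h : g ≫ D.r i = g' ≫ D.r i) :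
    g = g' := by
  have := IsLocalBase.faithful (b := b)
  refine b.map_injective (Man.hom_ext fun x ↦ (D.openImm i).2 ?_)
  have := congrArg b.map h
  rw [b.map_comp, b.map_comp] at this
  exact congrArg (fun k : b.obj W ⟶ b.obj S ↦ k x) this

/-- The relation between the fibres at two points with the same image in `S` which the transport of
arrows defines is a linear isomorphism. -/
theorem exists_equiv {i j : ι} {y : b.obj (D.E i).base} {y' : b.obj (D.E j).base}
    (h : b.map (D.r i) y = b.map (D.r j) y') :
    ∃ L : (D.E i).alg.Fiber y ≃ₗ[ℝ] (D.E j).alg.Fiber y',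
      ∀ (c : LAOver b) (s : c ⟶ D.E i) (g : c.base ⟶ (D.E j).base)
        (h : s.base ≫ D.r i = g ≫ D.r j) (c₀ : Σ x, c.alg.Fiber x) a a',
        LA.Hom.tot s.hom c₀ = ⟨y, a⟩ → LA.Hom.tot (D.tr s g h).hom c₀ = ⟨y', a'⟩ → L a = a' := by
  -- The isomorphism is read off from one cartesian arrow `s₀` through `y`; any other arrow `s` is
  -- compared with it on a common refinement `c₂`.
  obtain ⟨c', s₀, g₀, ⟨z, d₀⟩, hs, hs₀, hg, e, hz⟩ :=
    exists_refine (D.E i) (D.r i) (D.r j) (D.openImm j) ⟨y, 0⟩ y' h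
  obtain rfl : s₀.hom.base z = y := congrArg Sigma.fst e
  have hb := bijective_of_isCartesian s₀ s₀.base hs.1 z
  have hb' := (D.bijective_tr s₀ g₀ hg (hs₀.isCartesian_of_isStronglyCartesian) hs.1).2 z
  obtain rfl : (D.tr s₀ g₀ hg).hom.base z = y' := by
    rw [← hz, (D.tr s₀ g₀ hg).hom_base, D.tr_base]
  refine ⟨(LinearEquiv.ofBijective _ hb).symm.trans (LinearEquiv.ofBijective _ hb'),
    fun c s g hh c₀ a a' h1 h2 ↦ ?_⟩
  have e0 : b.map (s.base ≫ D.r i) c₀.1 = b.map (s₀.base ≫ D.r i) z := by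
    rw [b.map_comp, b.map_comp, ← s.hom_base, ← s₀.hom_base]
    exact congrArg (b.map (D.r i)) (congrArg Sigma.fst h1)
  obtain ⟨c₂, v₁, k₂, c₁, -, -, hk, rfl, rfl⟩ := exists_refine c (s.base ≫ D.r i)
    (s₀.base ≫ D.r i) (by rw [b.map_comp]; exact hs.comp (D.openImm i)) c₀ z e0
  have hk' : (v₁ ≫ s).base = k₂ ≫ s₀.base :=
    D.hom_ext_r ((Category.assoc _ _ _).trans (hk.trans (Category.assoc _ _ _).symm))
  have hv : (proj b).IsHomLift (v₁ ≫ s).base (v₁ ≫ s) := isHomLift_of_base_eq (v₁ ≫ s) rfl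
  let v₂ : c₂ ⟶ c' := Functor.IsStronglyCartesian.map (proj b) s₀.base s₀ hk' (v₁ ≫ s)
  have hv₂ : v₂ ≫ s₀ = v₁ ≫ s := Functor.IsStronglyCartesian.fac (proj b) s₀.base s₀ hk' (v₁ ≫ s)
  have hb₂ : v₂.base = k₂ := base_eq_of_isHomLift k₂ v₂
    (Functor.IsStronglyCartesian.map_isHomLift (proj b) s₀.base s₀ hk' (v₁ ≫ s))
  have h' : (v₁ ≫ s).base ≫ D.r i = (v₁.base ≫ g) ≫ D.r j := by
    rw [Category.assoc, ← hh]
    exact Category.assoc _ _ _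
  have h'' : (v₂ ≫ s₀).base ≫ D.r i = (v₂.base ≫ g₀) ≫ D.r j := by
    rw [Category.assoc, ← hg]
    exact Category.assoc _ _ _
  have htr : v₂ ≫ D.tr s₀ g₀ hg = v₁ ≫ D.tr s g hh := by
    rw [D.comp_tr v₁ s g hh h', D.comp_tr v₂ s₀ g₀ hg h'']
    exact D.tr_congr hv₂ (D.hom_ext_r (by rw [← h'', ← h', hv₂])) _ _
  have e1 : LA.Hom.tot v₂.hom c₁ = ⟨b.map k₂ c₁.1, (LinearEquiv.ofBijective _ hb).symm a⟩ := by
    refine tot_injective_of_isCartesian s₀ s₀.base hs ?_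
    rw [← tot_comp, hv₂, tot_comp, h1]
    exact congrArg (Sigma.mk _) ((LinearEquiv.ofBijective _ hb).apply_symm_apply a).symm
  rw [← tot_comp, ← htr, tot_comp, e1] at h2
  exact eq_of_heq (Sigma.mk.inj h2).2

/-- The fibrewise isomorphisms which the transport of arrows defines. -/
noncomputable def t {i j : ι} {y : b.obj (D.E i).base} {y' : b.obj (D.E j).base}
    (h : b.map (D.r i) y = b.map (D.r j) y') :
    (D.E i).alg.Fiber y ≃ₗ[ℝ] (D.E j).alg.Fiber y' :=
  (D.exists_equiv h).choose

theorem t_eq {i j : ι} {y : b.obj (D.E i).base} {y' : b.obj (D.E j).base}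
    (h : b.map (D.r i) y = b.map (D.r j) y') {c : LAOver b} (s : c ⟶ D.E i)
    (g : c.base ⟶ (D.E j).base) (hg : s.base ≫ D.r i = g ≫ D.r j) (c₀ : Σ x, c.alg.Fiber x)
    {a a'} (ha : LA.Hom.tot s.hom c₀ = ⟨y, a⟩) (ha' : LA.Hom.tot (D.tr s g hg).hom c₀ = ⟨y', a'⟩) :
    D.t h a = a' :=
  (D.exists_equiv h).choose_spec c s g hg c₀ a a' ha ha'

theorem exists_eq_mk {α : Type*} {F : α → Type*} (z : Σ x, F x) {x : α} (h : z.1 = x) :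
    ∃ a, z = ⟨x, a⟩ := by
  subst h
  exact ⟨z.2, rfl⟩

/-- The gluing data of Lie algebroids over the manifold of `S`. -/
noncomputable def glueData : GlueData (b.obj S) ι where
  Y i := b.obj (D.E i).base
  P i := (D.E i).alg
  f i := b.map (D.r i)
  etale i := (D.openImm i).1
  surj := D.surj
  t h := D.t h
  t_trans {i j k y y' y''} h h' a := by
    obtain ⟨c, s, g, c₀, -, -, hg, e, rfl⟩ :=
      exists_refine (D.E i) (D.r i) (D.r j) (D.openImm j) ⟨y, a⟩ y' h
    obtain ⟨c₂, v, g₂, c₁, -, -, hg₂, rfl, rfl⟩ := exists_refine c (g ≫ D.r j) (D.r k)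
      (D.openImm k) c₀ y'' (by rw [b.map_comp]; exact h')
    have e1 : (v ≫ s).base ≫ D.r i = (v.base ≫ g) ≫ D.r j := by
      rw [Category.assoc, ← hg]
      exact Category.assoc _ _ _
    have e2 : (D.tr (v ≫ s) (v.base ≫ g) e1).base ≫ D.r j = g₂ ≫ D.r k := by
      rw [D.tr_base, ← hg₂, Category.assoc]
    have e3 : (v ≫ s).base ≫ D.r i = g₂ ≫ D.r k := by
      rw [e1, ← hg₂, Category.assoc]
    obtain ⟨a', ha'⟩ := exists_eq_mk (LA.Hom.tot (D.tr (v ≫ s) (v.base ≫ g) e1).hom c₁)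
      (show _ = b.map g (LA.Hom.tot v.hom c₁).1 by
        rw [← D.comp_tr v s g hg, tot_comp]
        change (D.tr s g hg).hom.base _ = _
        rw [(D.tr s g hg).hom_base, D.tr_base])
    obtain ⟨a'', ha''⟩ := exists_eq_mk (LA.Hom.tot (D.tr (v ≫ s) g₂ e3).hom c₁)
      (show (D.tr (v ≫ s) g₂ e3).hom.base _ = b.map g₂ c₁.1 by
        rw [(D.tr (v ≫ s) g₂ e3).hom_base, D.tr_base])
    rw [D.t_eq h (v ≫ s) (v.base ≫ g) e1 c₁ e ha', D.t_eq (h.trans h') (v ≫ s) g₂ e3 c₁ e ha'']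
    refine D.t_eq h' _ g₂ e2 c₁ ha' ?_
    rw [D.tr_tr _ _ _ _ _ e3, ha'']
  exists_local {i j y y'} h := by
    obtain ⟨c, s, g, c₀, hs, hs', hg, e, hz⟩ :=
      exists_refine (D.E i) (D.r i) (D.r j) (D.openImm j) ⟨y, 0⟩ y' h
    have h1 := D.bijective_tr s g hg hs'.isCartesian_of_isStronglyCartesian hs.1
    refine ⟨b.obj c.base, c.alg, s.hom.base, (D.tr s g hg).hom.base, s.hom.algHom,
      (D.tr s g hg).hom.algHom, c₀.1, ?_, ?_, ?_, ?_, congrArg Sigma.fst e, ?_, ?_, ?_⟩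
    · rw [s.hom_base]; exact hs.1
    · rw [LAOver.Hom.hom_base]; exact h1.1
    · refine LieAlgebroid.Hom.isCart_of_bijective ?_ (bijective_of_isCartesian s s.base hs.1)
      rw [s.hom_base]; exact hs.1
    · refine LieAlgebroid.Hom.isCart_of_bijective ?_ h1.2
      rw [LAOver.Hom.hom_base]; exact h1.1
    · rw [LAOver.Hom.hom_base, D.tr_base]; exact hz
    · rw [LAOver.Hom.hom_base, LAOver.Hom.hom_base, D.tr_base]
      exact (b.map_comp _ _).symm.trans ((congrArg b.map hg).trans (b.map_comp _ _))
    · exact fun z h c ↦ D.t_eq h s g hg ⟨z, c⟩ rfl rfl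

/-- The objects of a descent datum map cartesianly to the Lie algebroid obtained by gluing. -/
theorem exists_glue : ∃ (A : LieAlgebroid (b.obj S)) (m : ∀ i, D.E i ⟶ ⟨S, A⟩),
    (∀ i, (m i).base = D.r i ∧ (m i).hom.algHom.IsCart) ∧
    ∀ {c : LAOver b} {i j : ι} (s : c ⟶ D.E i) (g : c.base ⟶ (D.E j).base)
      (h : s.base ≫ D.r i = g ≫ D.r j), D.tr s g h ≫ m j = s ≫ m i := by
  choose φ hφ hφ' using D.glueData.exists_glueHom
  refine ⟨D.glueData.glue, fun i ↦ ⟨D.r i, ⟨_, φ i⟩, rfl⟩, fun i ↦ ⟨rfl, hφ i⟩, ?_⟩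
  intro c i j s g h
  refine hom_ext ?_ fun c₀ ↦ ?_
  · exact (congrArg (· ≫ D.r j) (D.tr_base s g h)).trans h.symm
  · obtain ⟨a, ha⟩ := exists_eq_mk (LA.Hom.tot s.hom c₀) rfl
    obtain ⟨a', ha'⟩ := exists_eq_mk (LA.Hom.tot (D.tr s g h).hom c₀) rfl
    generalize (LA.Hom.tot s.hom c₀).1 = y at a ha
    generalize (LA.Hom.tot (D.tr s g h).hom c₀).1 = y' at a' ha'
    have hy : b.map (D.r i) y = b.map (D.r j) y' := by
      rw [show y = s.hom.base c₀.1 from (congrArg Sigma.fst ha).symm,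
        show y' = (D.tr s g h).hom.base c₀.1 from (congrArg Sigma.fst ha').symm,
        s.hom_base, LAOver.Hom.hom_base, D.tr_base]
      have := congrArg b.map h
      rw [b.map_comp, b.map_comp] at this
      exact congrArg (fun k : b.obj c.base ⟶ b.obj S ↦ k c₀.1) this
    rw [tot_comp, tot_comp, ha, ha']
    obtain rfl := D.t_eq hy s g h c₀ ha ha'
    have key : ∀ {i : ι} {y : b.obj (D.E i).base} {x : b.obj S} (h : b.map (D.r i) y = x) a,
        (⟨b.map (D.r i) y, φ i |>.toFun y a⟩ : Σ x, D.glueData.glue.Fiber x) =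
          ⟨x, GlueData.μ (G := D.glueData) h a⟩ := by
      rintro i y _ rfl a
      exact congrArg (Sigma.mk _) (hφ' i y a)
    exact (key rfl _).trans ((congrArg (Sigma.mk _)
      (GlueData.μ_t (G := D.glueData) hy rfl hy a)).trans (key hy a).symm)

end TransportData

theorem openImm_eqToHom_comp {R R' T : 𝒮} (h : R' = R) (f : R ⟶ T)
    (hf : Man.IsOpenImm (b.map f)) : Man.IsOpenImm (b.map (eqToHom h ≫ f)) := by
  subst h
  simpa using hf

theorem exists_map_eqToHom_comp {R R' T : 𝒮} (h : R' = R) (f : R ⟶ T) (x : b.obj T)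
    (hf : ∃ y, b.map f y = x) : ∃ y, b.map (eqToHom h ≫ f) y = x := by
  subst h
  simpa using hf

theorem isCartesian_of_eqToHom_comp {P Q : LAOver b} {R R' T : 𝒮} (h : R' = R) (f : R ⟶ T)
    (φ : P ⟶ Q) (H : (proj b).IsCartesian (eqToHom h ≫ f) φ) : (proj b).IsCartesian f φ := by
  subst h
  simpa using H

open Functor.Fiber (fiberInclusion)

open FibredStack in
/-- The transport of arrows of a descent datum over a family of open immersions. -/
noncomputable def transportData [IsLocalBase b] {S : 𝒮} {ι : Type w} {X : ι → 𝒮}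
    {f : ∀ i, X i ⟶ S} (D : (fiberPseudofunctor (proj b)).DescentData f)
    (hf : ∀ i, Man.IsOpenImm (b.map (f i))) (hs : ∀ x, ∃ i y, b.map (f i) y = x) :
    TransportData b S ι where
  E i := fiberInclusion.obj (descObj D i)
  r i := descBase D i
  openImm i := openImm_eqToHom_comp (map_fiberInclusion (descObj D i)) (f i) (hf i)
  surj x := by
    obtain ⟨i, y, hy⟩ := hs x
    exact ⟨i, exists_map_eqToHom_comp (map_fiberInclusion (descObj D i)) (f i) x ⟨y, hy⟩⟩
  tr s g h := transport D s g h
  tr_base s g h := map_transport D s g h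
  tr_tr s g h g' h' h'' := transport_transport D s g h g' h' h''
  comp_tr v s g h h' := comp_transport D v s g h h'
  exists_isCartesian s g h hs :=
    ⟨_, _, @isCartesian_transport _ _ _ _ (proj b) _ _ _ _ _ D _ _ _ s g h hs⟩

open FibredStack in
/-- Descent data over covering families of open immersions are effective. -/
theorem essSurj_toDescentData [IsLocalBase b] {S : 𝒮} {ι : Type w} {X : ι → 𝒮}
    (f : ∀ i, X i ⟶ S) (hf : ∀ i, Man.IsOpenImm (b.map (f i)))
    (hs : ∀ x, ∃ i y, b.map (f i) y = x) :
    ((fiberPseudofunctor (proj b)).toDescentData f).EssSurj where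
  mem_essImage D := by
    obtain ⟨A, m, hm, h⟩ := (transportData D hf hs).exists_glue
    let M : Functor.Fiber (proj b) S := ⟨⟨S, A⟩, rfl⟩
    let m' : ∀ i, fiberInclusion.obj (descObj D i) ⟶ fiberInclusion.obj M := m
    have : ∀ i, (proj b).IsCartesian (f i) (m' i) := fun i ↦ by
      have h1 := (isStronglyCartesian_of_isCart (m i) (hm i).2).isCartesian_of_isStronglyCartesian
      rw [(hm i).1] at h1
      exact isCartesian_of_eqToHom_comp _ _ _ h1
    exact ⟨M, nonempty_iso_of_isCartesian D M m' fun u g h' ↦ h u g h'⟩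

/-- Lie algebroids form a stack over every base category of manifolds and submersions whose
covering sieves are those which contain jointly surjective families of open immersions. -/
theorem isStackOver_proj [IsLocalBase b] (J : GrothendieckTopology 𝒮) [HasOpenCovers b J] :
    FibredStack.IsStackOver (proj b) J := by
  refine ⟨inferInstance, ?_⟩
  have := isPrestack_proj (b := b) J
  refine .of_isStackFor fun S R hR ↦ ?_
  choose X f hf hi y hy using fun x ↦ HasOpenCovers.exists_mem (b := b) hR x
  have hs : ∀ x, ∃ i y, b.map (f i) y = x := fun x ↦ ⟨x, y x, hy x⟩
  have key : (FibredStack.fiberPseudofunctor (proj b)).IsStackFor (Presieve.ofArrows X f) := by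
    rw [Pseudofunctor.isStackFor_ofArrows_iff]
    have h1 := essSurj_toDescentData f hi hs
    obtain ⟨h2⟩ := Functor.FullyFaithful.nonempty_iff_map_bijective _ |>.2
      (bijective_toDescentData_map f fun x ↦ ⟨x, hi x, y x, hy x⟩)
    have := h2.full
    have := h2.faithful
    exact { }
  refine key.of_le _ (J := J) (HasOpenCovers.generate_mem (b := b) _ ?_ ?_) ?_
  · rintro _ _ ⟨i⟩
    exact hi i
  · exact fun x ↦ ⟨_, f x, y x, ⟨x⟩, hy x⟩
  · rintro _ _ ⟨i⟩
    exact hf i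

end LAOver

/-! ### The two base categories -/

namespace Man

variable {X Y Z : Man.{u}}

/-- The inclusion of an open submanifold. -/
def ofOpensIncl (X : Man.{u}) (U : TopologicalSpace.Opens X) : X.ofOpens U ⟶ X :=
  ⟨Subtype.val, (contMDiff_subtype_val : ContMDiff (𝓡 X.dim) (𝓡 X.dim) ∞ (Subtype.val : U → X))⟩

theorem isOpenImm_ofOpensIncl (U : TopologicalSpace.Opens X) : IsOpenImm (X.ofOpensIncl U) := by
  refine ⟨fun x ↦ ?_, Subtype.val_injective⟩
  let Φ := U.openPartialHomeomorphSubtypeCoe ⟨x⟩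
  have hΦ : Φ.target = U := U.openPartialHomeomorphSubtypeCoe_target ⟨x⟩
  refine ⟨⟨Φ.toPartialEquiv, Φ.open_source, Φ.open_target,
    (X.ofOpensIncl U).contMDiff.contMDiffOn, fun y hy ↦ ContMDiffAt.contMDiffWithinAt ?_⟩,
    trivial, fun y _ ↦ rfl⟩
  refine (ContMDiffAt.subtypeVal_comp_iff (I := 𝓡 X.dim) (I' := 𝓡 X.dim) U Φ.symm y).1 ?_
  refine contMDiffAt_id.congr_of_eventuallyEq ?_
  filter_upwards [Φ.open_target.mem_nhds hy] with z hz
  exact Φ.right_inv hz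

theorem isOpenImm_opensToMan {U V : TopologicalSpace.Opens X} (i : U ⟶ V) :
    IsOpenImm (X.opensToMan.map i) :=
  ⟨IsEtale.of_comp (g := X.ofOpensIncl V) (isOpenImm_ofOpensIncl V).1 (isOpenImm_ofOpensIncl U).1,
    fun _ _ h ↦ Subtype.ext (congrArg (Subtype.val : V → X) h)⟩

instance isLocalBase_opensToMan (X : Man.{u}) : LAOver.IsLocalBase X.opensToMan where
  faithful := ⟨fun _ ↦ Subsingleton.elim _ _⟩
  submersion f := (isOpenImm_opensToMan f).1.submersion
  refine {S Y₁ Y₂} _ _ _ y₁ y₂ e :=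
    have e' : y₁.1 = y₂.1 := congrArg (Subtype.val : S → X) e
    ⟨Y₁ ⊓ Y₂, homOfLE inf_le_left, homOfLE inf_le_right, ⟨y₁.1, y₁.2, e' ▸ y₂.2⟩,
      isOpenImm_opensToMan _, Subsingleton.elim _ _, rfl, Subtype.ext e'⟩

instance hasOpenCovers_opensToMan (X : Man.{u}) :
    LAOver.HasOpenCovers X.opensToMan (Opens.grothendieckTopology X) where
  exists_mem {S R} hR x := by
    obtain ⟨U, f, hf, hx⟩ := hR x.1 x.2
    exact ⟨U, f, hf, isOpenImm_opensToMan f, ⟨x.1, hx⟩, rfl⟩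
  generate_mem {S} R _ h x hx := by
    obtain ⟨U, f, y, hf, hy⟩ := h ⟨x, hx⟩
    refine ⟨U, f, Sieve.le_generate R _ _ hf, ?_⟩
    rw [← show y.1 = x from congrArg Subtype.val hy]
    exact y.2

theorem IsEtale.exists_isOpenImm {f : X ⟶ Y} (hf : IsEtale f) (x : X) :
    ∃ U : TopologicalSpace.Opens X, x ∈ U ∧ IsOpenImm (X.ofOpensIncl U ≫ f) := by
  obtain ⟨N, s, -, hx, hs, hN⟩ := hf.exists_localInverse x
  obtain ⟨U, hU, hUo, hxU⟩ := eventually_nhds_iff.1 (hN _ hx).2.2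
  refine ⟨⟨U, hUo⟩, hs ▸ hxU, (isOpenImm_ofOpensIncl _).1.comp hf, fun y y' h ↦ Subtype.ext ?_⟩
  rw [← hU _ y.2, ← hU _ y'.2]
  exact congrArg s h

theorem IsOpenImm.isOpenEmb {f : X ⟶ Y} (hf : IsOpenImm f) : IsOpenEmb f :=
  ⟨hf.1, .of_continuous_injective_isOpenMap f.contMDiff.continuous hf.2
    (IsLocalDiffeomorph.isOpenMap hf.1)⟩

/-- The fibre product of an open immersion `f : Y ⟶ Z` with a smooth map `g : X ⟶ Z` is an open
submanifold of `X`. -/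
theorem IsOpenImm.exists_lift {f : Y ⟶ Z} (hf : IsOpenImm f) (g : X ⟶ Z) :
    ∃ (U : TopologicalSpace.Opens X) (h : X.ofOpens U ⟶ Y), (∀ x, x ∈ U ↔ g x ∈ Set.range f) ∧
      X.ofOpensIncl U ≫ g = h ≫ f := by
  let U : TopologicalSpace.Opens X :=
    ⟨g ⁻¹' Set.range f, (IsLocalDiffeomorph.isOpen_range hf.1).preimage g.contMDiff.continuous⟩
  choose k hk using fun x : U ↦ (x.2 : g x.1 ∈ Set.range f)
  refine ⟨U, ⟨k, fun x ↦ ?_⟩, fun _ ↦ Iff.rfl, Man.hom_ext fun x ↦ (hk x).symm⟩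
  obtain ⟨N, s, hN, hx, hs, hsN⟩ := hf.1.exists_localInverse (k x)
  rw [hk x] at hx
  have h1 : ContMDiffAt (𝓡 (X.ofOpens U).dim) (𝓡 Y.dim) ∞
      (s ∘ (X.ofOpensIncl U ≫ g)) x :=
    ContMDiffAt.comp (g := s) x (hsN _ hx).2.1 ((X.ofOpensIncl U ≫ g).contMDiff x)
  refine h1.congr_of_eventuallyEq ?_
  have h2 : ∀ᶠ x' in 𝓝 x, (X.ofOpensIncl U ≫ g) x' ∈ N :=
    (X.ofOpensIncl U ≫ g).contMDiff.continuous.continuousAt.eventually (hN.mem_nhds hx)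
  filter_upwards [h2] with x' hx'
  exact hf.2 ((hk x').trans (hsN _ hx').1.symm)

/-- A smooth map whose composition with an étale map is a submersion is a submersion. -/
theorem submersion_of_comp_isEtale {f : X ⟶ Y} {g : Y ⟶ Z} (hg : IsEtale g)
    (h : submersion (f ≫ g)) : submersion f := fun x v ↦ by
  obtain ⟨u, hu⟩ := h x (dMap g (f x) v)
  exact ⟨u, (hg.dMap_bijective (f x)).1 ((dMap_comp f g x u).symm.trans hu)⟩

end Man

namespace ManSub

instance : LAOver.IsLocalBase toMan.{u} where
  faithful := inferInstance
  submersion f := f.property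
  refine {S Y₁ Y₂} q₁ q₂ h y₁ y₂ e := by
    obtain ⟨U, g, hU, hg⟩ := Man.IsOpenImm.exists_lift h q₁.hom
    have hi := Man.isOpenImm_ofOpensIncl (X := Y₁.obj) U
    have h1 : Man.submersion g := Man.submersion_of_comp_isEtale h.1 <| by
      rw [← hg]
      exact Man.submersion.comp_mem _ _ hi.1.submersion q₁.property
    let y : U := ⟨y₁, (hU y₁).2 ⟨y₂, e.symm⟩⟩
    refine ⟨⟨Y₁.obj.ofOpens U⟩, ⟨Y₁.obj.ofOpensIncl U, hi.1.submersion⟩, ⟨g, h1⟩, y, hi,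
      WideSubcategory.hom_ext Man.submersion hg, rfl, h.2 ?_⟩
    exact (congrArg (fun k : Y₁.obj.ofOpens U ⟶ S.obj ↦ k y) hg).symm.trans e

/-- The topology on `ManSub` whose covering sieves of `S` are those whose open immersions
jointly cover `S`. -/
def openImmTopology : GrothendieckTopology ManSub.{u} where
  sieves S := { R | ∀ x : S.obj, ∃ (X : ManSub.{u}) (f : X ⟶ S),
    R f ∧ Man.IsOpenImm f.hom ∧ ∃ y, f.hom y = x }
  top_mem' S x := ⟨S, 𝟙 S, trivial, ⟨(Diffeomorph.refl (𝓡 S.obj.dim) S.obj ∞).isLocalDiffeomorph,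
      Function.injective_id⟩, x, rfl⟩
  pullback_stable' {S Y R} q hR y := by
    obtain ⟨X, f, hf, hfi, z, hz⟩ := hR (q.hom y)
    obtain ⟨W, g₁, g₂, w, h₁, h, hw, -⟩ :=
      LAOver.IsLocalBase.refine (b := toMan.{u}) q f hfi y z hz.symm
    refine ⟨W, g₁, ?_, h₁, w, hw⟩
    change R (g₁ ≫ q)
    rw [h]
    exact R.downward_closed hf g₂
  transitive' {S R} hR T hT x := by
    obtain ⟨X, f, hf, hfi, y, rfl⟩ := hR x
    obtain ⟨Y, g, hg, hgi, z, rfl⟩ := hT hf y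
    exact ⟨Y, g ≫ f, hg, hgi.comp hfi, z, rfl⟩

/-- Étale maps are open immersions locally on their domain. -/
theorem etaleTopology_le : etaleTopology.{u} ≤ openImmTopology := by
  refine (Precoverage.toGrothendieck_le_iff_le_toPrecoverage).2 fun S R hR ↦ ?_
  rw [GrothendieckTopology.mem_toPrecoverage_iff]
  intro x
  obtain ⟨X, f, y, hf, rfl⟩ := hR.2 x
  obtain ⟨U, hU, hi⟩ := (hR.1 f hf).exists_isOpenImm y
  have hU' : Man.submersion (X.obj.ofOpensIncl U) := (Man.isOpenImm_ofOpensIncl U).1.submersion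
  let i : (⟨X.obj.ofOpens U⟩ : ManSub) ⟶ X := ⟨X.obj.ofOpensIncl U, hU'⟩
  exact ⟨_, i ≫ f, (Sieve.generate R).downward_closed (Sieve.le_generate R _ _ hf) i, hi,
    ⟨y, hU⟩, rfl⟩

theorem openCoverTopology_le : openCoverTopology.{u} ≤ openImmTopology :=
  (Precoverage.toGrothendieck_mono (J := openCovers) (K := etaleCovers)
    fun _ _ hR ↦ ⟨fun _ f hf ↦ (hR.1 f hf).1, hR.2⟩).trans
    etaleTopology_le

instance : LAOver.HasOpenCovers toMan.{u} openCoverTopology.{u} where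
  exists_mem hR x := openCoverTopology_le _ hR x
  generate_mem _ hR h :=
    Precoverage.generate_mem_toGrothendieck ⟨fun _ f hf ↦ (hR f hf).isOpenEmb, h⟩

instance : LAOver.HasOpenCovers toMan.{u} etaleTopology.{u} where
  exists_mem hR x := etaleTopology_le _ hR x
  generate_mem _ hR h :=
    Precoverage.generate_mem_toGrothendieck ⟨fun _ f hf ↦ (hR f hf).1, h⟩

end ManSub

theorem mainTheorem2 :
    (∀ X : Man.{u}, FibredStack.IsStackOver (LAOver.proj X.opensToMan)
      (Opens.grothendieckTopology X)) ∧
    FibredStack.IsStackOver (LAOver.proj ManSub.toMan.{u}) ManSub.openCoverTopology.{u} ∧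
    FibredStack.IsStackOver (LAOver.proj ManSub.toMan.{u}) ManSub.etaleTopology.{u} :=
  ⟨fun X ↦ LAOver.isStackOver_proj (b := X.opensToMan) _,
    LAOver.isStackOver_proj (b := ManSub.toMan) _,
    LAOver.isStackOver_proj (b := ManSub.toMan) _⟩
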